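/- Let $T>0$ and let $X=(X_t)_{t\in[0,T]}$ and $Y=(Y_t)_{t\in[0,T]}$ be real-valued random processes on a probability space whose paths are almost surely Hölder continuous on $[0,T]$ of orders $\alpha>0$ and $\beta>0$, respectively, where $\alpha+\beta>1$. Assume that for every $t\in(0,T)$ the random variable $X_t$ admits a probability density function $p_t$, that $\sup_y p_t(y)\le\hat p_t$ for almost every $t$, where $\int_0^T\hat p_t\,dt<\infty$, and that \[ \sup_{0\le s<t\le T}\frac{E|X_t-X_s|^{\delta}}{|t-s|^{\lambda}}<\infty \] for some $\delta>1$ and $\lambda>1$ such that $\frac{\lambda}{1+\delta}+\beta>1$. Let $f:\mathbb{R}\to\mathbb{R}$ be of locally finite variation. In addition, assume that there is a finite constant $c_0$ such that either (i) $p_t(x)\le c_0$ for all $x\in\mathbb{R}$ and all $t\in(0,T)$, and the limit $f(X_{0+})=\lim_{t\downarrow0}f(X_t)$ exists almost surely; or (ii) for some $\epsilon>0$, $p_t(x)\le c_0$ for all $|x|\ge\epsilon/2$ and all $t\in(0,T)$, and $f$ restricted to $(-\epsilon,\epsilon)$ is Lipschitz continuous. For a tagged partition $\pi=(t_0,\dots,t_k;\xi_1,\dots,\xi_k)$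 of $[0,T]$, i.e. $0=t_0<t_1<\dots<t_k=T$ and $\xi_i\in[t_{i-1},t_i]$, write $\|\pi\|=\max_i(t_i-t_{i-1})$ and $\mathrm{RS}(f\circ X,Y,\pi)=\sum_{i=1}^k f(X_{\xi_i})(Y_{t_i}-Y_{t_{i-1}})$. Then there exists a random variable $(\mathrm{RS})\int_0^T f(X_t)\,dY_t$ such that \[ \mathrm{RS}(f\circ X,Y,\pi_n)\ \longrightarrow\ (\mathrm{RS})\int_0^T f(X_t)\,dY_t\qquad\text{in probability} \] for any sequence of tagged partitions with $\|\pi_n\|\to0$, and almost surely the Zähle–Stieltjes integral $(\mathrm{ZS})\int_0^T f(X_t)\,dY_t$ exists and \[ (\mathrm{RS})\int_0^T f(X_t)\,dY_t\ =\ (\mathrm{ZS})\int_0^T f(X_t)\,dY_t . \] Furthermore, the convergence holds almost surely for any sequence of tagged partitions satisfying $\sum_{n=1}^\infty\|\pi_n\|^a<\infty$ for some $a<\frac{\lambda}{1+\delta}+\beta-1$. Here the Zähle–Stieltjes integral of $u$ against $g$ over $(0,T)$ is \[ (\mathrm{ZS})\int_0^T u\,dg=(-1)^{\kappa}\int_0^T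 D^{\kappa}_{0+}(u-u(0+))(t)\,D^{1-\kappa}_{T-}(g-g(T-))(t)\,dt+u(0+)\,(g(T-)-g(0+)), \] defined when the limits $u(0+),g(0+),g(T-)$ exist and $u-u(0+)\in I^{\kappa}_{0+}(L_p(0,T))$, $g-g(T-)\in I^{1-\kappa}_{T-}(L_q(0,T))$ for some $\kappa\in[0,1]$ and $p,q\in[1,\infty]$ with $1/p+1/q=1$ (the value does not depend on the choice of $\kappa,p,q$). Here $I^{\kappa}_{0+}\varphi(t)=\frac{1}{\Gamma(\kappa)}\int_0^t\varphi(s)(t-s)^{\kappa-1}ds$ and $I^{\kappa}_{T-}\varphi(t)=\frac{(-1)^{-\kappa}}{\Gamma(\kappa)}\int_t^T\varphi(s)(s-t)^{\kappa-1}ds$ with $(-1)^{\kappa}=e^{i\pi\kappa}$ are the Riemann–Liouville fractional integrals ($I^0$ is the identity), and the fractional derivatives $D^{\kappa}_{0+}$, $D^{\kappa}_{T-}$ are their inverses. -/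

import Mathlib

open MeasureTheory Set Filter Topology
open scoped ENNReal NNReal

noncomputable section

/-- A tagged partition `0 = t₀ < t₁ < ⋯ < t_k = T` of `[0, T]` with tags `ξᵢ ∈ [tᵢ₋₁, tᵢ]`. -/
structure TaggedPartition (T : ℝ) where
  /-- the number of intervals -/
  k : ℕ
  /-- the division points -/
  t : Fin (k + 1) → ℝ
  /-- the tags -/
  ξ : Fin k → ℝ
  t_zero : t 0 = 0
  t_last : t (Fin.last k) = T
  t_strictMono : StrictMono t
  tag_mem : ∀ i : Fin k, ξ i ∈ Set.Icc (t i.castSucc) (t i.succ)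

/-- The mesh `max_i (tᵢ - tᵢ₋₁)`. -/
def TaggedPartition.mesh {T : ℝ} (π : TaggedPartition T) : ℝ :=
  ⨆ i : Fin π.k, (π.t i.succ - π.t i.castSucc)

/-- The Riemann-Stieltjes sum `∑ᵢ f(ξᵢ) (g(tᵢ) - g(tᵢ₋₁))` of `f` against `g` along `π`. -/
def TaggedPartition.rsSum {T : ℝ} (π : TaggedPartition T) (f g : ℝ → ℝ) : ℝ :=
  ∑ i : Fin π.k, f (π.ξ i) * (g (π.t i.succ) - g (π.t i.castSucc))

/-- The left Riemann-Liouville fractional integral `I^κ_{a+} φ` of order `κ ≥ 0`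
(the identity for `κ = 0`). -/
def leftRL (a κ : ℝ) (φ : ℝ → ℝ) (t : ℝ) : ℝ :=
  if κ = 0 then φ t
  else (Real.Gamma κ)⁻¹ * ∫ s in Set.Ioo a t, φ s * (t - s) ^ (κ - 1)

/-- The right Riemann-Liouville fractional integral `I^κ_{b-} φ` of order `κ ≥ 0`
(the identity for `κ = 0`), without the unimodular constant `(-1)^{-κ} = e^{-iπκ}` that is
sometimes included; see `HasZSIntegral`. -/
def rightRL (b κ : ℝ) (φ : ℝ → ℝ) (t : ℝ) : ℝ :=
  if κ = 0 then φ t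
  else (Real.Gamma κ)⁻¹ * ∫ s in Set.Ioo t b, φ s * (s - t) ^ (κ - 1)

/-- `φ` is the left Riemann-Liouville fractional derivative `D^κ_{a+} h = (I^κ_{a+})⁻¹ h` on
`(a, b)`, and `h` belongs to `I^κ_{a+}(L_p(a, b))`. Such a `φ` is almost everywhere unique. -/
def IsLeftFracDeriv (a b κ : ℝ) (p : ℝ≥0∞) (h φ : ℝ → ℝ) : Prop :=
  MemLp φ p (volume.restrict (Set.Ioo a b)) ∧
    ∀ᵐ t ∂(volume.restrict (Set.Ioo a b)), h t = leftRL a κ φ t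

/-- `ψ` is the right Riemann-Liouville fractional derivative `D^κ_{b-} h = (I^κ_{b-})⁻¹ h` on
`(a, b)`, up to the constant `(-1)^κ`, and `h` belongs to `I^κ_{b-}(L_q(a, b))`. -/
def IsRightFracDeriv (a b κ : ℝ) (q : ℝ≥0∞) (h ψ : ℝ → ℝ) : Prop :=
  MemLp ψ q (volume.restrict (Set.Ioo a b)) ∧
    ∀ᵐ t ∂(volume.restrict (Set.Ioo a b)), h t = rightRL b κ ψ t

/-- The fractional Zähle-Stieltjes integral `(ZS) ∫_a^b f dg` exists and equals `I`:
the limits `f(a+)`, `g(a+)`, `g(b-)` exist, `f - f(a+) ∈ I^κ_{a+}(L_p)` and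
`g - g(b-) ∈ I^{1-κ}_{b-}(L_q)` for some `κ ∈ [0, 1]` and conjugate exponents `p, q ∈ [1, ∞]`, and
`I = (-1)^κ ∫_a^b D^κ_{a+} (f - f(a+)) D^{1-κ}_{b-} (g - g(b-)) dt + f(a+) (g(b-) - g(a+))`.
The factor `(-1)^κ = e^{iπκ}` and the factor `(-1)^{1-κ} = e^{iπ(1-κ)}` contained in `D^{1-κ}_{b-}`
multiply to `-1`, which is the sign of the integral below. -/
def HasZSIntegral (a b : ℝ) (f g : ℝ → ℝ) (I : ℝ) : Prop :=
  ∃ fa ga gb : ℝ,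
    Tendsto f (𝓝[>] a) (𝓝 fa) ∧ Tendsto g (𝓝[>] a) (𝓝 ga) ∧ Tendsto g (𝓝[<] b) (𝓝 gb) ∧
    ∃ κ : ℝ, 0 ≤ κ ∧ κ ≤ 1 ∧ ∃ p q : ℝ≥0∞, 1 ≤ p ∧ 1 ≤ q ∧ p⁻¹ + q⁻¹ = 1 ∧
    ∃ φ ψ : ℝ → ℝ,
      IsLeftFracDeriv a b κ p (fun t => f t - fa) φ ∧
      IsRightFracDeriv a b (1 - κ) q (fun t => g t - gb) ψ ∧
      I = -(∫ t in Set.Ioo a b, φ t * ψ t) + fa * (gb - ga)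

/-- `q` is a probability density function of the real random variable `Z`. -/
def IsDensityOf {Ω : Type*} [MeasurableSpace Ω] (P : Measure Ω) (Z : Ω → ℝ) (q : ℝ → ℝ) : Prop :=
  Measurable q ∧ (∀ y, 0 ≤ q y) ∧
    P.map Z = (volume : Measure ℝ).withDensity (fun y => ENNReal.ofReal (q y))

/-- Almost all paths of the process `X` are Hölder continuous of order `r` on `[0, T]`. -/
def HolderProcess {Ω : Type*} [MeasurableSpace Ω] (P : Measure Ω) (T : ℝ) (r : ℝ≥0)
    (X : ℝ → Ω → ℝ) : Prop :=
  ∀ᵐ ω ∂P, ∃ C : ℝ≥0, HolderOnWith C r (fun t => X t ω) (Set.Icc 0 T)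

end

/-! The two integrals are compared through the averages `rsAverage u g h 0 T`, that is `∫ u(r)
(g(r+h) - g(r)) / h dr`, as `h ↓ 0`.

Zähle–Stieltjes side (`exists_hasZSIntegral`). If the Marchaud kernel of order `κ` of a bounded `u`
is absolutely integrable, the Marchaud derivative of `u - u(0)` lies in `L¹` and is its fractional
derivative (`MarchaudIntegrable.eq_leftRL`). A `β`-Hölder `g` with `1 - κ < β` has a bounded
derivative of order `1 - κ`. Fractional integration by parts turns the averages into a pairing of
the first derivative with moving averages of the second, and Lebesgue differentiation identifies the
limit with the Zähle–Stieltjes integral.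

Riemann–Stieltjes side (`L1Holder.rsSum_sub_le`). This is a Young estimate in which the integrand is
`γ`-Hölder only in `L¹`, while the integrator is pathwise `β`-Hölder with a deterministic constant,
so products cost no integrability. Passing from step `2h` to step `h` costs powers of `h` that sum
geometrically when `γ + β > 1`. The sums then differ from the limit of the averages by at most a
multiple of `mesh ^ (γ + β - 1)` in `L¹`.

Probability (`L1Le_increment`). For `f` of bounded variation and `X_s` with bounded density, the
increment `f(X_t) - f(X_s)` has mean at most a constant times `η + P(|X_t - X_s| ≥ η)`. Markov's
inequality and `η = |t - s| ^ (λ/(1+δ))` give mean Hölder order `γ = λ/(1+δ)`. Densities matter only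
where `f` varies, so on an interval where `f` is Lipschitz no bound is needed. Accordingly `f` is
split into `f ∘ clampAbs c`, treated path by path, and `outerPart`, treated in mean.

`exists_integral_of_clamped` combines these after localizing to events with controlled Hölder
constants. Summable `L¹` errors give almost sure convergence, and subsequences give convergence in
probability. -/

noncomputable section


/-! ### Power kernels and their convolutions -/

/-- The power kernel `r ↦ r^{κ-1}` on the positive half-line, extended by zero. -/
def powKernel (κ r : ℝ) : ℝ := if 0 < r then r ^ (κ - 1) else 0

lemma powKernel_of_pos (κ : ℝ) {r : ℝ} (hr : 0 < r) : powKernel κ r = r ^ (κ - 1) := if_pos hr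

lemma powKernel_of_nonpos (κ : ℝ) {r : ℝ} (hr : r ≤ 0) : powKernel κ r = 0 := if_neg hr.not_gt

lemma powKernel_nonneg (κ r : ℝ) : 0 ≤ powKernel κ r := by
  unfold powKernel; split_ifs with h
  · exact Real.rpow_nonneg h.le _
  · exact le_rfl

lemma powKernel_one_of_pos {r : ℝ} (hr : 0 < r) : powKernel 1 r = 1 := by
  simp [powKernel_of_pos 1 hr]

lemma measurable_powKernel (κ : ℝ) : Measurable (powKernel κ) :=
  Measurable.ite measurableSet_Ioi (by fun_prop) measurable_const

lemma leftRL_eq_integral_powKernel {κ : ℝ} (hκ : κ ≠ 0) {φ : ℝ → ℝ} (t : ℝ) :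
    leftRL 0 κ φ t =
      (Real.Gamma κ)⁻¹ * ∫ s, (Ioi (0 : ℝ)).indicator φ s * powKernel κ (t - s) := by
  rw [leftRL, if_neg hκ, ← integral_indicator measurableSet_Ioo]
  congr 2
  ext s
  by_cases h0 : 0 < s
  · by_cases h1 : s < t
    · simp [indicator, h0, h1, powKernel]
    · simp [indicator, h0, h1, powKernel]
  · simp [indicator, h0]

/-- The beta density with parameters `κ` and `1 - κ` has total mass one, and `Γ(κ + (1 - κ)) = 1`.
-/
lemma integral_beta_kernel {κ : ℝ} (h0 : 0 < κ) (h1 : κ < 1) :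
    IntegrableOn (fun s : ℝ => s ^ (κ - 1) * (1 - s) ^ (-κ)) (Ioo 0 1) ∧
      ∫ s in Ioo (0 : ℝ) 1, s ^ (κ - 1) * (1 - s) ^ (-κ) = Real.Gamma κ * Real.Gamma (1 - κ) := by
  have h1' : 0 < 1 - κ := by linarith
  have hB := ProbabilityTheory.lintegral_betaPDF_eq_one h0 h1'
  rw [ProbabilityTheory.lintegral_betaPDF] at hB
  have hb : ProbabilityTheory.beta κ (1 - κ) = Real.Gamma κ * Real.Gamma (1 - κ) := by
    simp [ProbabilityTheory.beta]
  have hbpos := ProbabilityTheory.beta_pos h0 h1'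
  set b := ProbabilityTheory.beta κ (1 - κ) with hbdef
  have e : ∀ x : ℝ, 1 / b * x ^ (κ - 1) * (1 - x) ^ (1 - κ - 1) =
      1 / b * (x ^ (κ - 1) * (1 - x) ^ (-κ)) := fun x => by
    rw [mul_assoc]; congr 3; ring
  simp_rw [e] at hB
  have hnn : 0 ≤ᵐ[volume.restrict (Ioo (0 : ℝ) 1)]
      fun x : ℝ => 1 / b * (x ^ (κ - 1) * (1 - x) ^ (-κ)) := by
    filter_upwards [ae_restrict_mem measurableSet_Ioo] with x hx
    have := Real.rpow_nonneg hx.1.le (κ - 1)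
    have := Real.rpow_nonneg (sub_nonneg.2 hx.2.le) (-κ)
    simp only [Pi.zero_apply]
    positivity
  have hmeas : AEStronglyMeasurable (fun x : ℝ => 1 / b * (x ^ (κ - 1) * (1 - x) ^ (-κ)))
      (volume.restrict (Ioo (0 : ℝ) 1)) := by
    apply Measurable.aestronglyMeasurable
    fun_prop
  have hint : IntegrableOn (fun x : ℝ => 1 / b * (x ^ (κ - 1) * (1 - x) ^ (-κ))) (Ioo 0 1) := by
    refine (lintegral_ofReal_ne_top_iff_integrable hmeas hnn).1 ?_
    rw [hB]; simp
  have hval : ∫ x in Ioo (0 : ℝ) 1, 1 / b * (x ^ (κ - 1) * (1 - x) ^ (-κ)) = 1 := by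
    rw [integral_eq_lintegral_of_nonneg_ae hnn hmeas, hB]; simp
  constructor
  · have := hint.const_mul b
    refine this.congr ?_
    filter_upwards with x
    field_simp
  · rw [integral_const_mul] at hval
    rw [← hb]
    field_simp at hval
    exact hval

/-- For `x > 0` the substitution `s ↦ 1 - s/x` removes `x`, since the two exponents add up to `-1`;
what remains is the beta integral. Complementary orders thus compose to plain integration, the fact
behind Abel inversion. -/
lemma integral_powKernel_conv_compl {κ : ℝ} (h0 : 0 < κ) (h1 : κ < 1) (x : ℝ) :
    Integrable (fun s => powKernel κ (x - s) * powKernel (1 - κ) s) ∧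
      ∫ s, powKernel κ (x - s) * powKernel (1 - κ) s =
        Real.Gamma κ * Real.Gamma (1 - κ) * powKernel 1 x := by
  by_cases hx : 0 < x
  · have e : (fun s => powKernel κ (x - s) * powKernel (1 - κ) s) =
        fun s => x⁻¹ * (Ioo (0 : ℝ) 1).indicator
          (fun s : ℝ => s ^ (κ - 1) * (1 - s) ^ (-κ)) (-x⁻¹ * s + 1) := by
      ext s
      have e1 : -x⁻¹ * s + 1 = (x - s) / x := by field_simp; ring
      have e2 : 1 - (x - s) / x = s / x := by field_simp; ring
      by_cases hs : 0 < s
      · by_cases hs' : 0 < x - s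
        · have hmem : (x - s) / x ∈ Ioo (0 : ℝ) 1 :=
            ⟨by positivity, by rw [div_lt_one hx]; linarith⟩
          rw [e1, indicator_of_mem hmem, e2, powKernel_of_pos _ hs, powKernel_of_pos _ hs',
            Real.div_rpow hs'.le hx.le, Real.div_rpow hs.le hx.le,
            show (1 - κ - 1 : ℝ) = -κ by ring]
          have : x ^ (κ - 1) * x ^ (-κ) = x⁻¹ := by
            rw [← Real.rpow_add hx, ← Real.rpow_neg_one]; congr 1; ring
          have hp := Real.rpow_pos_of_pos hx (κ - 1)
          have hp' := Real.rpow_pos_of_pos hx (-κ)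
          rw [← this]; field_simp
        · rw [powKernel_of_nonpos _ (not_lt.1 hs'), indicator_of_notMem]
          · simp
          · rw [e1]; intro h
            have := h.1
            exact hs' (by simpa [hx] using (div_pos_iff_of_pos_right hx).1 this)
      · rw [powKernel_of_nonpos (1 - κ) (not_lt.1 hs), indicator_of_notMem]
        · simp
        · rw [e1]; intro h
          have := h.2
          rw [div_lt_one hx] at this
          linarith
    obtain ⟨hi, hv⟩ := integral_beta_kernel h0 h1
    rw [← integrable_indicator_iff measurableSet_Ioo] at hi
    rw [← integral_indicator measurableSet_Ioo] at hv
    have hne : -x⁻¹ ≠ 0 := by simp [hx.ne']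
    rw [e]
    constructor
    · exact ((hi.comp_add_right 1).comp_mul_left' hne).const_mul _
    · rw [integral_const_mul, Measure.integral_comp_mul_left
        (fun y => (Ioo (0 : ℝ) 1).indicator (fun s : ℝ => s ^ (κ - 1) * (1 - s) ^ (-κ)) (y + 1)),
        integral_add_right_eq_self, hv, powKernel_one_of_pos hx]
      simp [abs_of_pos hx, hx.ne']
  · have e : (fun s => powKernel κ (x - s) * powKernel (1 - κ) s) = fun _ => 0 := by
      ext s
      by_cases hs : 0 < s
      · rw [powKernel_of_nonpos κ (by linarith)]; simp
      · rw [powKernel_of_nonpos (1 - κ) (by linarith)]; simp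
    rw [e, powKernel_of_nonpos 1 (not_lt.1 hx)]
    simp

lemma integral_powKernel_conv_one {κ : ℝ} (h0 : 0 < κ) (x : ℝ) :
    Integrable (fun s => powKernel 1 (x - s) * powKernel κ s) ∧
      ∫ s, powKernel 1 (x - s) * powKernel κ s = max x 0 ^ κ / κ := by
  have e : (fun s => powKernel 1 (x - s) * powKernel κ s) =
      (Ioo 0 x).indicator fun s => s ^ (κ - 1) := by
    ext s
    by_cases hs : 0 < s
    · by_cases hs' : s < x
      · simp [indicator, hs, hs', powKernel]
      · simp [indicator, hs, hs', powKernel]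
    · simp [indicator, hs, powKernel]
  rw [e]
  by_cases hx : 0 < x
  · constructor
    · rw [integrable_indicator_iff measurableSet_Ioo, intervalIntegral.integrableOn_Ioo_rpow_iff hx]
      linarith
    · rw [integral_indicator measurableSet_Ioo, ← integral_Ioc_eq_integral_Ioo,
        ← intervalIntegral.integral_of_le hx.le, integral_rpow (Or.inl (by linarith)),
        max_eq_left hx.le]
      simp [h0.ne']
  · have : Ioo 0 x = ∅ := Ioo_eq_empty hx
    rw [this, max_eq_right (not_lt.1 hx), Real.zero_rpow h0.ne']
    simp

lemma integral_one_conv_powKernel {κ : ℝ} (h0 : 0 < κ) (x : ℝ) :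
    Integrable (fun s => powKernel κ (x - s) * powKernel 1 s) ∧
      ∫ s, powKernel κ (x - s) * powKernel 1 s = max x 0 ^ κ / κ := by
  obtain ⟨hi, hv⟩ := integral_powKernel_conv_one h0 x
  constructor
  · refine (hi.comp_sub_left x).congr ?_
    filter_upwards with s
    simp [mul_comm]
  · rw [← hv, ← integral_sub_left_eq_self _ _ x]
    simp [mul_comm]

/-- Associativity of convolution on the half-line, with the outer convolution evaluated at `t`. -/
lemma integral_kernel_assoc {a b c m : ℝ → ℝ} {t M : ℝ} (ha : Measurable a) (hb : Measurable b)
    (ha0 : ∀ x, 0 ≤ a x) (hb0 : ∀ x, 0 ≤ b x)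
    (hab : ∀ x, Integrable (fun s => a (x - s) * b s)) (hm : ∀ x, ∫ s, a (x - s) * b s = m x)
    (hM : ∀ x ≤ t, m x ≤ M) (hc : Integrable c) (hc0 : ∀ r ≤ 0, c r = 0) :
    Integrable (fun z : ℝ × ℝ => c z.1 * (a (t - z.2) * b (z.2 - z.1))) (volume.prod volume) ∧
    Integrable (fun s => a (t - s) * ∫ r, c r * b (s - r)) ∧
      ∫ s, a (t - s) * ∫ r, c r * b (s - r) = ∫ r, c r * m (t - r) := by
  have hin : ∀ r, Integrable (fun s => a (t - s) * b (s - r)) ∧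
      ∫ s, a (t - s) * b (s - r) = m (t - r) := by
    intro r
    have e : (fun s => a (t - s) * b (s - r)) =
        fun s => (fun s' => a (t - r - s') * b s') (s - r) := by
      ext s; congr 2; ring
    rw [e]
    exact ⟨(hab (t - r)).comp_sub_right r, (integral_sub_right_eq_self
      (fun s' => a (t - r - s') * b s') r).trans (hm _)⟩
  have hm0 : ∀ x, 0 ≤ m x := fun x => by
    rw [← hm]; exact integral_nonneg fun s => mul_nonneg (ha0 _) (hb0 _)
  have hmeas : AEStronglyMeasurable (fun z : ℝ × ℝ => c z.1 * (a (t - z.2) * b (z.2 - z.1)))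
      (volume.prod volume) := by
    refine hc.aestronglyMeasurable.comp_fst.mul (Measurable.aestronglyMeasurable ?_)
    fun_prop
  have mmeas : AEStronglyMeasurable (fun r => m (t - r)) volume := by
    have : (fun r => m (t - r)) = fun r => ∫ s, a (t - s) * b (s - r) := by
      ext r; rw [(hin r).2]
    rw [this]
    exact (StronglyMeasurable.integral_prod_right
      (f := fun r s => a (t - s) * b (s - r))
      (Measurable.stronglyMeasurable (by simp only [Function.uncurry_def]; fun_prop))).aestronglyMeasurable
  have hprod : Integrable (fun z : ℝ × ℝ => c z.1 * (a (t - z.2) * b (z.2 - z.1)))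
      (volume.prod volume) := by
    rw [integrable_prod_iff hmeas]
    refine ⟨Eventually.of_forall fun r => (hin r).1.const_mul (c r), ?_⟩
    have e : (fun r => ∫ s, ‖c r * (a (t - s) * b (s - r))‖) = fun r => ‖c r‖ * m (t - r) := by
      ext r
      simp_rw [norm_mul, integral_const_mul, Real.norm_of_nonneg (ha0 _),
        Real.norm_of_nonneg (hb0 _), (hin r).2]
    rw [e]
    refine (hc.norm.mul_const M).mono (hc.norm.aestronglyMeasurable.mul mmeas) ?_
    filter_upwards with r
    -- The bound `M` on `m` is needed only up to `t`: where `c` does not vanish, `r > 0` and so `t -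
    -- r < t`.
    by_cases hr : r ≤ 0
    · simp [hc0 r hr]
    · have := hM (t - r) (by linarith)
      have h0 := hm0 (t - r)
      simp only [norm_mul, norm_norm, Real.norm_of_nonneg h0, Real.norm_of_nonneg (h0.trans this)]
      gcongr
  have e1 : (fun s => a (t - s) * ∫ r, c r * b (s - r)) =
      fun s => ∫ r, c r * (a (t - s) * b (s - r)) := by
    ext s
    rw [← integral_const_mul]
    congr 1; ext r; ring
  rw [e1]
  refine ⟨hprod, ?_, ?_⟩
  · exact hprod.integral_prod_right
  · rw [← integral_integral_swap (f := fun r s => c r * (a (t - s) * b (s - r))) hprod]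
    congr 1; ext r
    rw [integral_const_mul, (hin r).2]


/-! ### The Marchaud derivative inverts the fractional integral -/

/-- The Marchaud fractional derivative of order `κ` of a function on the line. -/
def marchaud (κ : ℝ) (v : ℝ → ℝ) (t : ℝ) : ℝ :=
  κ / Real.Gamma (1 - κ) * ∫ r in Ioi (0 : ℝ), (v t - v (t - r)) * r ^ (-1 - κ)

/-- Absolute integrability of the kernel defining the Marchaud derivative over `(0, T)`. -/
def MarchaudIntegrable (T κ : ℝ) (v : ℝ → ℝ) : Prop :=
  Integrable (fun z : ℝ × ℝ => (v z.1 - v (z.1 - z.2)) * z.2 ^ (-1 - κ))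
    ((volume.restrict (Ioo 0 T)).prod (volume.restrict (Ioi 0)))

lemma MarchaudIntegrable.integrableOn {T κ : ℝ} {v : ℝ → ℝ} (h : MarchaudIntegrable T κ v) :
    IntegrableOn (marchaud κ v) (Ioo 0 T) :=
  (Integrable.integral_prod_left h).const_mul _

/-- Fubini on `{0 < q < r}` with `∫_q^∞ r^(-1-κ) dr = q^(-κ)/κ`. Absolute convergence comes from `w`
being bounded and zero past `t`, and from `q^(-κ)` being integrable at zero. -/
lemma integral_Ioi_mul_rpow_tail {κ : ℝ} (h0 : 0 < κ) (h1 : κ < 1) {w : ℝ → ℝ} {B t : ℝ}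
    (hw : Measurable w) (hB : ∀ q, |w q| ≤ B) (hwt : ∀ q, t ≤ q → w q = 0) :
    ∫ r in Ioi (0 : ℝ), r ^ (-1 - κ) * ∫ q in (0 : ℝ)..r, w q =
      κ⁻¹ * ∫ q in Ioi (0 : ℝ), w q * q ^ (-κ) := by
  have htail : ∀ q, 0 < q → IntegrableOn (fun r : ℝ => r ^ (-1 - κ)) (Ioi q) ∧
      ∫ r in Ioi q, r ^ (-1 - κ) = q ^ (-κ) / κ := by
    intro q hq
    refine ⟨integrableOn_Ioi_rpow_of_lt (by linarith) hq, ?_⟩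
    rw [integral_Ioi_rpow_of_lt (by linarith) hq, show -1 - κ + 1 = -κ by ring]
    field_simp
  have hB0 : 0 ≤ B := (abs_nonneg _).trans (hB 0)
  set G : ℝ → ℝ → ℝ := fun q r => w q * (Ioi q).indicator (fun r : ℝ => r ^ (-1 - κ)) r with hG
  have hGm : Measurable (Function.uncurry G) := by
    have : Function.uncurry G = fun z : ℝ × ℝ =>
        w z.1 * {z : ℝ × ℝ | z.1 < z.2}.indicator (fun z : ℝ × ℝ => z.2 ^ (-1 - κ)) z := by
      ext z
      simp [hG, Function.uncurry, indicator]
    rw [this]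
    refine (hw.comp measurable_fst).mul (Measurable.indicator (by fun_prop) ?_)
    exact measurableSet_lt measurable_fst measurable_snd
  have hin : ∀ q, 0 < q → IntegrableOn (fun r => (Ioi q).indicator (fun r : ℝ => r ^ (-1 - κ)) r)
      (Ioi 0) ∧ ∫ r in Ioi (0 : ℝ), (Ioi q).indicator (fun r : ℝ => r ^ (-1 - κ)) r
        = q ^ (-κ) / κ := by
    intro q hq
    have hsub : Ioi (0 : ℝ) ∩ Ioi q = Ioi q := inter_eq_right.2 (Ioi_subset_Ioi hq.le)
    rw [setIntegral_indicator measurableSet_Ioi, hsub]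
    refine ⟨?_, (htail q hq).2⟩
    exact ((integrable_indicator_iff measurableSet_Ioi).2 (htail q hq).1).integrableOn
  have hprod : Integrable (Function.uncurry G)
      ((volume.restrict (Ioi 0)).prod (volume.restrict (Ioi 0))) := by
    rw [integrable_prod_iff hGm.aestronglyMeasurable]
    constructor
    · filter_upwards [ae_restrict_mem measurableSet_Ioi] with q hq
      exact (hin q hq).1.const_mul (w q)
    · have hdom : IntegrableOn (fun q => B / κ * (Ioo 0 t).indicator (fun q : ℝ => q ^ (-κ)) q)
          (Ioi 0) := by
        refine Integrable.const_mul (Integrable.integrableOn ?_) _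
        rw [integrable_indicator_iff measurableSet_Ioo]
        by_cases ht : 0 < t
        · rw [intervalIntegral.integrableOn_Ioo_rpow_iff ht]; linarith
        · simp [Ioo_eq_empty ht]
      refine Integrable.mono' hdom ?_ ?_
      · exact (StronglyMeasurable.integral_prod_right (f := fun q r => ‖Function.uncurry G (q, r)‖)
          hGm.norm.stronglyMeasurable).aestronglyMeasurable
      · filter_upwards [ae_restrict_mem measurableSet_Ioi] with q hq
        have hq' : 0 < q := hq
        have e : ∫ r in Ioi (0 : ℝ), ‖Function.uncurry G (q, r)‖ = |w q| * (q ^ (-κ) / κ) := by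
          rw [← (hin q hq).2, ← integral_const_mul]
          refine setIntegral_congr_fun measurableSet_Ioi fun r hr => ?_
          have hr' : 0 < r := hr
          simp only [Function.uncurry, hG, norm_mul, Real.norm_eq_abs]
          congr 1
          refine abs_of_nonneg (indicator_nonneg (fun r hr => ?_) r)
          exact Real.rpow_nonneg (hq'.trans hr).le _
        rw [e]
        have hp := Real.rpow_nonneg hq'.le (-κ)
        by_cases hqt : q < t
        · rw [indicator_of_mem (show q ∈ Ioo 0 t from ⟨hq', hqt⟩), Real.norm_of_nonneg (by positivity)]
          calc |w q| * (q ^ (-κ) / κ) ≤ B * (q ^ (-κ) / κ) := by gcongr; exact hB q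
            _ = _ := by ring
        · rw [hwt q (not_lt.1 hqt)]; simp [indicator, hqt]
  have hswap := integral_integral_swap hprod
  have eL : ∫ q in Ioi (0 : ℝ), ∫ r in Ioi (0 : ℝ), G q r =
      κ⁻¹ * ∫ q in Ioi (0 : ℝ), w q * q ^ (-κ) := by
    rw [← integral_const_mul]
    refine setIntegral_congr_fun measurableSet_Ioi fun q hq => ?_
    simp only [hG]
    rw [integral_const_mul, (hin q hq).2]; field_simp
  rw [← eL, hswap]
  refine setIntegral_congr_fun measurableSet_Ioi fun r hr => ?_
  have hr' : (0 : ℝ) < r := hr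
  rw [intervalIntegral.integral_of_le hr'.le, integral_Ioc_eq_integral_Ioo, ← integral_const_mul,
    ← integral_indicator measurableSet_Ioo, ← integral_indicator measurableSet_Ioi]
  congr 1
  ext q
  by_cases h0 : 0 < q
  · by_cases h1 : q < r
    · simp [hG, indicator, h0, h1, mul_comm]
    · simp [hG, indicator, h0, h1]
  · simp [indicator, h0]

/-- After exchanging the integrals, `v(s) - v(s - r)` integrated over `s ∈ (0, t)` telescopes to
`∫_{t-r}^t v`, because `v` vanishes to the left of zero. The tail lemma then produces the kernel of
order `1 - κ`, its `κ⁻¹` cancelling the factor `κ` of `marchaud`. -/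
lemma MarchaudIntegrable.integral_marchaud {T κ : ℝ} {v : ℝ → ℝ} (h : MarchaudIntegrable T κ v)
    (h0 : 0 < κ) (h1 : κ < 1) (hv : Measurable v) {B : ℝ} (hB : ∀ t, |v t| ≤ B)
    (hv0 : ∀ t ≤ 0, v t = 0) {t : ℝ} (ht : 0 ≤ t) (htT : t ≤ T) :
    ∫ s in (0 : ℝ)..t, marchaud κ v s =
      (Real.Gamma (1 - κ))⁻¹ * ∫ s, v s * powKernel (1 - κ) (t - s) := by
  have hii : ∀ a b, IntervalIntegrable v volume a b := fun a b => by
    rw [intervalIntegrable_iff]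
    exact Measure.integrableOn_of_bounded (M := B) (by simp) hv.aestronglyMeasurable
      (Eventually.of_forall hB)
  have hprod : Integrable (Function.uncurry fun s r : ℝ => (v s - v (s - r)) * r ^ (-1 - κ))
      ((volume.restrict (Ioo 0 t)).prod (volume.restrict (Ioi 0))) := by
    refine Integrable.mono_measure h ?_
    exact Measure.prod_mono (Measure.restrict_mono (Ioo_subset_Ioo_right htT) le_rfl) le_rfl
  have hin : ∀ r ∈ Ioi (0 : ℝ), ∫ s in Ioo 0 t, (v s - v (s - r)) * r ^ (-1 - κ) =
      r ^ (-1 - κ) * ∫ q in (0 : ℝ)..r, v (t - q) := by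
    intro r hr
    have hr' : (0 : ℝ) < r := hr
    rw [integral_mul_const, mul_comm, ← integral_Ioc_eq_integral_Ioo,
      ← intervalIntegral.integral_of_le ht, intervalIntegral.integral_sub (hii _ _)
        ((hii (0 - r) (t - r)).comp_sub_right r |> fun h => by simpa using h),
      intervalIntegral.integral_comp_sub_right, intervalIntegral.integral_comp_sub_left]
    congr 1
    have z : ∫ s in (0 - r)..0, v s = 0 := by
      rw [intervalIntegral.integral_congr (g := fun _ => (0 : ℝ))]
      · simp
      · intro s hs
        rw [uIcc_of_le (by linarith)] at hs
        exact hv0 s hs.2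
    have a1 := intervalIntegral.integral_add_adjacent_intervals (hii (0 - r) 0) (hii 0 (t - r))
    have a2 := intervalIntegral.integral_add_adjacent_intervals (hii 0 (t - r)) (hii (t - r) t)
    rw [sub_zero]
    linarith
  rw [intervalIntegral.integral_of_le ht, integral_Ioc_eq_integral_Ioo]
  simp only [marchaud]
  rw [integral_const_mul, integral_integral_swap hprod, setIntegral_congr_fun measurableSet_Ioi hin,
    integral_Ioi_mul_rpow_tail h0 h1 (w := fun q => v (t - q)) (t := t) (by fun_prop)
      (fun q => hB _) (fun q hq => hv0 _ (by linarith))]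
  have e : ∫ s, v s * powKernel (1 - κ) (t - s) = ∫ q in Ioi (0 : ℝ), v (t - q) * q ^ (-κ) := by
    rw [← integral_sub_left_eq_self _ _ t, ← integral_indicator measurableSet_Ioi]
    congr 1
    ext q
    by_cases hq : 0 < q
    · simp [indicator, hq, powKernel]
    · simp [indicator, hq, powKernel]
  rw [e]
  field_simp

lemma ae_eq_of_forall_integral_eq {w v : ℝ → ℝ} {T : ℝ}
    (hw : IntegrableOn w (Ioo 0 T)) (hv : IntegrableOn v (Ioo 0 T))
    (h : ∀ t ∈ Ioo 0 T, ∫ s in (0 : ℝ)..t, w s = ∫ s in (0 : ℝ)..t, v s) :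
    ∀ᵐ t ∂(volume.restrict (Ioo 0 T)), w t = v t := by
  by_cases hT : 0 < T
  swap
  · simp [Ioo_eq_empty hT]
  have hw' : IntervalIntegrable w volume 0 T := by
    rwa [intervalIntegrable_iff_integrableOn_Ioo_of_le hT.le]
  have hv' : IntervalIntegrable v volume 0 T := by
    rwa [intervalIntegrable_iff_integrableOn_Ioo_of_le hT.le]
  have a1 := hw'.ae_hasDerivAt_integral
  have a2 := hv'.ae_hasDerivAt_integral
  filter_upwards [ae_restrict_mem measurableSet_Ioo, ae_restrict_of_ae a1, ae_restrict_of_ae a2]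
    with t ht h1 h2
  have hm : t ∈ uIcc 0 T := by rw [uIcc_of_le hT.le]; exact Ioo_subset_Icc_self ht
  have z : (0 : ℝ) ∈ uIcc 0 T := left_mem_uIcc
  refine (h1 hm 0 z).unique ((h2 hm 0 z).congr_of_eventuallyEq ?_)
  filter_upwards [isOpen_Ioo.mem_nhds ht] with s hs using h s hs

/-- Abel's argument. With `φ = marchaud κ v` one has `I¹φ = I^(1-κ)v`. Applying `I^κ` gives `I¹(I^κ
φ) = I^κ I¹ φ = I^κ I^(1-κ) v = I¹v`, and differentiating the two primitives gives `I^κ φ = v`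
almost everywhere. -/
lemma MarchaudIntegrable.eq_leftRL {T κ : ℝ} {v : ℝ → ℝ} (h : MarchaudIntegrable T κ v)
    (h0 : 0 < κ) (h1 : κ < 1) (hv : Measurable v) {B : ℝ} (hB : ∀ t, |v t| ≤ B)
    (hv0 : ∀ t ≤ 0, v t = 0) :
    ∀ᵐ t ∂(volume.restrict (Ioo 0 T)), v t = leftRL 0 κ (marchaud κ v) t := by
  set φ := (Ioo 0 T).indicator (marchaud κ v) with hφ
  set V := (Ioo 0 T).indicator v with hV
  have hφi : Integrable φ := (integrable_indicator_iff measurableSet_Ioo).2 h.integrableOn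
  have hvi : IntegrableOn v (Ioo 0 T) :=
    Measure.integrableOn_of_bounded (M := B) (by simp) hv.aestronglyMeasurable
      (Eventually.of_forall hB)
  have hVi : Integrable V := (integrable_indicator_iff measurableSet_Ioo).2 hvi
  have hφ0 : ∀ r ≤ 0, φ r = 0 := fun r hr => indicator_of_notMem (fun h => h.1.not_ge hr) _
  have hV0 : ∀ r ≤ 0, V r = 0 := fun r hr => indicator_of_notMem (fun h => h.1.not_ge hr) _
  have hG1 := Real.Gamma_pos_of_pos h0
  have hG2 := Real.Gamma_pos_of_pos (sub_pos.2 h1)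
  have one : ∀ (F : ℝ → ℝ) (t : ℝ), 0 ≤ t →
      ∫ r, (Ioi (0 : ℝ)).indicator F r * powKernel 1 (t - r) = ∫ r in (0 : ℝ)..t, F r := by
    intro F t ht
    rw [intervalIntegral.integral_of_le ht, integral_Ioc_eq_integral_Ioo,
      ← integral_indicator measurableSet_Ioo]
    congr 1; ext r
    by_cases hr : 0 < r
    · by_cases hr' : r < t
      · simp [indicator, hr, hr', powKernel]
      · simp [indicator, hr, hr', powKernel]
    · simp [indicator, hr]
  -- Cutting off at `T` makes the functions integrable on the line. It is invisible at times `t ≤ T`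
  -- since the kernels vanish at nonpositive arguments.
  have trunc : ∀ (F k : ℝ → ℝ) (t : ℝ), t ≤ T → (∀ x ≤ 0, k x = 0) →
      ∫ r, (Ioo 0 T).indicator F r * k (t - r) = ∫ r, (Ioi (0 : ℝ)).indicator F r * k (t - r) := by
    intro F k t ht hk
    congr 1; ext r
    by_cases hr : 0 < r
    · by_cases hr' : r < T
      · simp [indicator, hr, hr']
      · rw [hk _ (by linarith)]; simp
    · simp [indicator, hr]
  have hvI : (Ioi (0 : ℝ)).indicator v = v := by
    ext r; by_cases hr : 0 < r
    · simp [indicator, hr]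
    · simp [indicator, hr, hv0 r (not_lt.1 hr)]
  -- the primitive of `φ` is the fractional integral of `v`
  have key : ∀ s ≤ T, ∫ r, φ r * powKernel 1 (s - r) =
      (Real.Gamma (1 - κ))⁻¹ * ∫ r, V r * powKernel (1 - κ) (s - r) := by
    intro s hs
    rw [trunc _ _ s hs (fun x => powKernel_of_nonpos 1),
      trunc _ _ s hs (fun x => powKernel_of_nonpos _), hvI]
    by_cases hs0 : 0 ≤ s
    · rw [one _ s hs0, h.integral_marchaud h0 h1 hv hB hv0 hs0 hs]
    · have z : ∀ (F : ℝ → ℝ) (κ : ℝ), (∀ r ≤ 0, F r = 0) →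
          ∫ r, F r * powKernel κ (s - r) = 0 := by
        intro F κ hF
        rw [← integral_zero ℝ ℝ]
        congr 1; ext r
        by_cases hr : 0 < r
        · rw [powKernel_of_nonpos _ (by linarith)]; simp
        · simp [hF r (not_lt.1 hr)]
      rw [z _ _ hv0, z _ _ (fun r hr => by simp [indicator, hr.not_gt])]; simp
  set W : ℝ → ℝ := fun s => (Real.Gamma κ)⁻¹ * ∫ r, φ r * powKernel κ (s - r) with hW
  have mbd : ∀ t, ∀ x ≤ t, max x 0 ^ κ / κ ≤ max t 0 ^ κ / κ := fun t x hx => by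
    gcongr
  -- `A1` and `A2` have the same composed kernel, which is the commutation `I¹ I^κ = I^κ I¹`; `A3`
  -- is `I^κ I^(1-κ) = I¹` up to the Gamma factors.
  have A1 := fun t => integral_kernel_assoc (t := t) (measurable_powKernel 1) (measurable_powKernel κ)
    (powKernel_nonneg 1) (powKernel_nonneg κ) (fun x => (integral_powKernel_conv_one h0 x).1)
    (fun x => (integral_powKernel_conv_one h0 x).2) (mbd t) hφi hφ0
  have A2 := fun t => integral_kernel_assoc (t := t) (measurable_powKernel κ) (measurable_powKernel 1)
    (powKernel_nonneg κ) (powKernel_nonneg 1) (fun x => (integral_one_conv_powKernel h0 x).1)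
    (fun x => (integral_one_conv_powKernel h0 x).2) (mbd t) hφi hφ0
  have A3 := fun t => integral_kernel_assoc (t := t) (M := Real.Gamma κ * Real.Gamma (1 - κ))
    (measurable_powKernel κ) (measurable_powKernel (1 - κ))
    (powKernel_nonneg κ) (powKernel_nonneg (1 - κ))
    (fun x => (integral_powKernel_conv_compl h0 h1 x).1)
    (fun x => (integral_powKernel_conv_compl h0 h1 x).2)
    (fun x _ => by
      unfold powKernel; split_ifs <;> simp; positivity) hVi hV0
  have hWV : ∀ t ∈ Ioo 0 T, ∫ s in (0 : ℝ)..t, W s = ∫ s in (0 : ℝ)..t, v s := by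
    intro t ht
    have e1 : ∫ s, powKernel κ (t - s) * ∫ r, φ r * powKernel 1 (s - r) =
        (Real.Gamma (1 - κ))⁻¹ *
          ∫ s, powKernel κ (t - s) * ∫ r, V r * powKernel (1 - κ) (s - r) := by
      rw [← integral_const_mul]
      congr 1; ext s
      by_cases hs : s < t
      · rw [key s (by linarith [ht.2])]; ring
      · rw [powKernel_of_nonpos _ (by linarith)]; simp
    rw [(A2 t).2.2, (A3 t).2.2, ← (A1 t).2.2] at e1
    have e2 : ∫ r, V r * (Real.Gamma κ * Real.Gamma (1 - κ) * powKernel 1 (t - r)) =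
        Real.Gamma κ * Real.Gamma (1 - κ) * ∫ s in (0 : ℝ)..t, v s := by
      rw [← one v t ht.1.le, ← trunc v _ t ht.2.le (fun x => powKernel_of_nonpos 1),
        ← integral_const_mul]
      congr 1; ext r; ring
    have e3 : ∫ s, powKernel 1 (t - s) * ∫ r, φ r * powKernel κ (s - r) =
        Real.Gamma κ * ∫ s in (0 : ℝ)..t, W s := by
      rw [← one W t ht.1.le, ← integral_const_mul]
      congr 1; ext s
      by_cases hs : 0 < s
      · simp only [indicator, mem_Ioi, hs, if_true, hW]; field_simp
      · have : ∫ r, φ r * powKernel κ (s - r) = 0 := by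
          rw [← integral_zero ℝ ℝ]
          congr 1; ext r
          by_cases hr : 0 < r
          · rw [powKernel_of_nonpos _ (by linarith)]; simp
          · simp [hφ0 r (not_lt.1 hr)]
        rw [this]; simp [indicator, hs]
    rw [e2, e3] at e1
    field_simp at e1
    linarith
  have hWi : IntegrableOn W (Ioo 0 T) := by
    have := ((A1 T).2.1.const_mul (Real.Gamma κ)⁻¹).integrableOn (s := Ioo 0 T)
    refine this.congr_fun (fun s hs => ?_) measurableSet_Ioo
    simp only [hW]
    rw [powKernel_one_of_pos (by linarith [hs.2]), one_mul]
  filter_upwards [ae_eq_of_forall_integral_eq hWi hvi hWV, ae_restrict_mem measurableSet_Ioo]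
    with t ht htm
  rw [← ht, leftRL_eq_integral_powKernel h0.ne', hW]
  simp only
  rw [trunc _ _ t htm.2.le (fun x => powKernel_of_nonpos _)]


/-- Near zero the first term of the minimum leaves the exponent `γ - 1 - κ > -1`; near infinity the
second leaves `-1 - κ < -1`. -/
lemma integrableOn_min_rpow_mul {κ γ C B : ℝ} (h0 : 0 < κ) (hγ : κ < γ) (hC : 0 ≤ C) (hB : 0 ≤ B) :
    IntegrableOn (fun r : ℝ => min (C * r ^ γ) B * r ^ (-1 - κ)) (Ioi 0) := by
  have hm : AEStronglyMeasurable (fun r : ℝ => min (C * r ^ γ) B * r ^ (-1 - κ)) volume := by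
    apply Measurable.aestronglyMeasurable; fun_prop
  have e : Ioi (0 : ℝ) = Ioc 0 1 ∪ Ioi 1 := (Ioc_union_Ioi_eq_Ioi zero_le_one).symm
  rw [e]
  refine IntegrableOn.union ?_ ?_
  · have : IntegrableOn (fun r : ℝ => C * r ^ (γ - 1 - κ)) (Ioc 0 1) := by
      refine Integrable.const_mul ?_ _
      have := (intervalIntegral.intervalIntegrable_rpow' (a := 0) (b := 1)
        (r := γ - 1 - κ) (by linarith))
      rwa [intervalIntegrable_iff_integrableOn_Ioc_of_le zero_le_one] at this
    refine Integrable.mono' this hm.restrict ?_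
    filter_upwards [ae_restrict_mem measurableSet_Ioc] with r hr
    have hp := Real.rpow_nonneg hr.1.le (-1 - κ)
    have hp' := Real.rpow_nonneg hr.1.le γ
    rw [Real.norm_of_nonneg (mul_nonneg (le_min (by positivity) hB) hp)]
    calc min (C * r ^ γ) B * r ^ (-1 - κ) ≤ C * r ^ γ * r ^ (-1 - κ) := by
          gcongr; exact min_le_left _ _
      _ = C * r ^ (γ - 1 - κ) := by rw [mul_assoc, ← Real.rpow_add hr.1]; congr 2; ring
  · have : IntegrableOn (fun r : ℝ => B * r ^ (-1 - κ)) (Ioi 1) :=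
      (integrableOn_Ioi_rpow_of_lt (by linarith) one_pos).const_mul _
    refine Integrable.mono' this hm.restrict ?_
    filter_upwards [ae_restrict_mem measurableSet_Ioi] with r hr
    have hr0 : (0 : ℝ) < r := one_pos.trans hr
    have hp := Real.rpow_nonneg hr0.le (-1 - κ)
    have hp' := Real.rpow_nonneg hr0.le γ
    rw [Real.norm_of_nonneg (mul_nonneg (le_min (by positivity) hB) hp)]
    gcongr; exact min_le_right _ _

lemma marchaudIntegrable_of_modulus {T κ : ℝ} {v ρ : ℝ → ℝ} (hv : Measurable v)
    (hρ : IntegrableOn (fun r => ρ r * r ^ (-1 - κ)) (Ioi 0))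
    (h : ∀ t, ∀ r > 0, |v t - v (t - r)| ≤ ρ r) : MarchaudIntegrable T κ v := by
  have hdom : Integrable (fun z : ℝ × ℝ => (1 : ℝ) * (ρ z.2 * z.2 ^ (-1 - κ)))
      ((volume.restrict (Ioo 0 T)).prod (volume.restrict (Ioi 0))) :=
    (integrable_const (1 : ℝ)).mul_prod hρ
  refine Integrable.mono' hdom ?_ ?_
  · apply Measurable.aestronglyMeasurable; fun_prop
  · have : ∀ᵐ z : ℝ × ℝ ∂((volume.restrict (Ioo 0 T)).prod (volume.restrict (Ioi 0))),
        0 < z.2 := by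
      rw [Measure.prod_restrict]
      filter_upwards [ae_restrict_mem (measurableSet_Ioo.prod measurableSet_Ioi)] with z hz
        using hz.2
    filter_upwards [this] with z hz
    rw [norm_mul, Real.norm_eq_abs, Real.norm_of_nonneg (Real.rpow_nonneg hz.le _), one_mul]
    gcongr
    exact h _ _ hz

lemma abs_marchaud_le {κ : ℝ} (h0 : 0 < κ) (h1 : κ < 1) {v ρ : ℝ → ℝ}
    (hρ : IntegrableOn (fun r => ρ r * r ^ (-1 - κ)) (Ioi 0))
    (h : ∀ t, ∀ r > 0, |v t - v (t - r)| ≤ ρ r) (t : ℝ) :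
    |marchaud κ v t| ≤ κ / Real.Gamma (1 - κ) * ∫ r in Ioi (0 : ℝ), ρ r * r ^ (-1 - κ) := by
  have hG := Real.Gamma_pos_of_pos (sub_pos.2 h1)
  rw [marchaud, abs_mul, abs_of_pos (by positivity : 0 < κ / Real.Gamma (1 - κ))]
  gcongr
  rw [← Real.norm_eq_abs]
  refine norm_integral_le_of_norm_le hρ ?_
  filter_upwards [ae_restrict_mem measurableSet_Ioi] with r hr
  have hr' : (0 : ℝ) < r := hr
  rw [norm_mul, Real.norm_eq_abs, Real.norm_of_nonneg (Real.rpow_nonneg hr'.le _)]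
  gcongr
  exact h _ _ hr'

lemma continuous_of_abs_sub_le_rpow {g : ℝ → ℝ} {K β : ℝ} (hβ : 0 < β)
    (hg : ∀ s t, |g t - g s| ≤ K * |t - s| ^ β) : Continuous g := by
  rw [continuous_iff_continuousAt]
  intro s
  rw [ContinuousAt, tendsto_iff_norm_sub_tendsto_zero]
  have : Tendsto (fun t => K * |t - s| ^ β) (𝓝 s) (𝓝 0) := by
    have hc : Continuous fun t : ℝ => K * |t - s| ^ β :=
      continuous_const.mul ((by fun_prop : Continuous fun t : ℝ => |t - s|).rpow_const
        fun _ => Or.inr hβ.le)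
    have := hc.tendsto s
    simpa [hβ.ne'] using this
  exact squeeze_zero (fun _ => norm_nonneg _) (fun t => hg s t) this

/-! ### Averaged Riemann-Stieltjes sums and the Zähle-Stieltjes integral -/

/-- The averaged Riemann-Stieltjes sums `∫_s^t u(r) (g(r+h) - g(r)) / h dr`. -/
def rsAverage (u g : ℝ → ℝ) (h s t : ℝ) : ℝ := ∫ r in s..t, u r * ((g (r + h) - g r) / h)

/-- The integral telescopes to the mean of `g` over `[t, t+h]` minus its mean over `[s, s+h]`, and
each mean is within `K h^β` of the value at the left end. -/
lemma abs_integral_slope_sub_le {g : ℝ → ℝ} {K β : ℝ} (hβ : 0 < β)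
    (hg : ∀ s t, |g t - g s| ≤ K * |t - s| ^ β) {h : ℝ} (hh : 0 < h) (s t : ℝ) :
    |(∫ r in s..t, (g (r + h) - g r) / h) - (g t - g s)| ≤ 2 * K * h ^ β := by
  have hc := continuous_of_abs_sub_le_rpow hβ hg
  have hii : ∀ a b, IntervalIntegrable g volume a b := fun a b => hc.intervalIntegrable a b
  have hK : 0 ≤ K := by
    have := (abs_nonneg _).trans (hg 0 1); simpa using this
  have one : ∀ a, |(∫ r in a..(a + h), g r) - h * g a| ≤ h * (K * h ^ β) := by
    intro a
    have e : (∫ r in a..(a + h), g r) - h * g a = ∫ r in a..(a + h), (g r - g a) := by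
      rw [intervalIntegral.integral_sub (hii _ _) (by simp)]; simp
    rw [e, ← Real.norm_eq_abs]
    have := intervalIntegral.norm_integral_le_of_norm_le_const (a := a) (b := a + h)
      (f := fun r => g r - g a) (C := K * h ^ β) (fun r hr => by
        rw [uIoc_of_le (by linarith)] at hr
        refine (hg a r).trans ?_
        gcongr
        rw [abs_of_pos (by linarith [hr.1])]; linarith [hr.2])
    rw [add_sub_cancel_left, abs_of_pos hh] at this
    linarith
  have e : ∫ r in s..t, (g (r + h) - g r) / h =
      h⁻¹ * ((∫ r in t..(t + h), g r) - ∫ r in s..(s + h), g r) := by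
    simp_rw [div_eq_inv_mul]
    rw [intervalIntegral.integral_const_mul, intervalIntegral.integral_sub
      ((by fun_prop : Continuous fun r => g (r + h)).intervalIntegrable _ _) (hii _ _),
      intervalIntegral.integral_comp_add_right]
    congr 1
    have a1 := intervalIntegral.integral_add_adjacent_intervals (hii s (s + h)) (hii (s + h) (t + h))
    have a2 := intervalIntegral.integral_add_adjacent_intervals (hii s t) (hii t (t + h))
    linarith
  rw [e]
  have e2 : h⁻¹ * ((∫ r in t..(t + h), g r) - ∫ r in s..(s + h), g r) - (g t - g s) =
      h⁻¹ * (((∫ r in t..(t + h), g r) - h * g t) - ((∫ r in s..(s + h), g r) - h * g s)) := by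
    field_simp; ring
  rw [e2, abs_mul, abs_of_pos (inv_pos.2 hh)]
  calc h⁻¹ * |_| ≤ h⁻¹ * (h * (K * h ^ β) + h * (K * h ^ β)) := by
        gcongr
        exact (abs_sub _ _).trans (add_le_add (one t) (one s))
    _ = 2 * K * h ^ β := by field_simp; ring

lemma rightRL_reflect {T κ : ℝ} (ψ : ℝ → ℝ) (t : ℝ) :
    rightRL T κ (fun s => ψ (T - s)) t = leftRL 0 κ ψ (T - t) := by
  unfold rightRL leftRL
  split_ifs with hκ
  · rfl
  · congr 1
    rw [← integral_indicator measurableSet_Ioo, ← integral_indicator measurableSet_Ioo,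
      ← integral_sub_left_eq_self _ _ T]
    congr 1; ext s
    have : T - s ∈ Ioo t T ↔ s ∈ Ioo 0 (T - t) := by
      simp only [mem_Ioo]; constructor <;> rintro ⟨a, b⟩ <;> constructor <;> linarith
    by_cases hs : s ∈ Ioo 0 (T - t)
    · rw [indicator_of_mem hs, indicator_of_mem (this.2 hs)]
      simp only [sub_sub_cancel, sub_right_comm T s t]
    · rw [indicator_of_notMem hs, indicator_of_notMem (fun h => hs (this.1 h))]

lemma measurePreserving_reflect_Ioo (T : ℝ) :
    MeasurePreserving (fun t => T - t) (volume.restrict (Ioo 0 T)) (volume.restrict (Ioo 0 T)) := by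
  have := (Measure.measurePreserving_sub_left volume T).restrict_preimage (s := Ioo 0 T) measurableSet_Ioo
  have e : (fun t => T - t) ⁻¹' Ioo 0 T = Ioo 0 T := by
    ext t; simp only [mem_preimage, mem_Ioo]; constructor <;> rintro ⟨a, b⟩ <;> constructor <;> linarith
  rwa [e] at this

/-- The core of fractional integration by parts. Since `X` is bounded and vanishes beyond `T`, it is
dominated by `L * powKernel 1 (T - ·)`, so the joint integrability from `integral_kernel_assoc`
evaluated at `T` justifies Fubini. -/
lemma integral_mul_powKernel_swap {κ T L : ℝ} (h0 : 0 < κ) {φ X : ℝ → ℝ} (hφ : Integrable φ)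
    (hφ0 : ∀ t ≤ 0, φ t = 0) (hX : Measurable X) (hL : ∀ r, |X r| ≤ L) (hXT : ∀ r, T ≤ r → X r = 0) :
    ∫ t, φ t * ∫ r, X r * powKernel κ (r - t) = ∫ r, X r * ∫ t, φ t * powKernel κ (r - t) := by
  have hp := (integral_kernel_assoc (t := T) (M := max T 0 ^ κ / κ) (measurable_powKernel 1)
    (measurable_powKernel κ) (powKernel_nonneg 1) (powKernel_nonneg κ)
    (fun x => (integral_powKernel_conv_one h0 x).1)
    (fun x => (integral_powKernel_conv_one h0 x).2) (fun x hx => by gcongr) hφ hφ0).1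
  have hL0 : 0 ≤ L := (abs_nonneg _).trans (hL 0)
  have hF : Integrable (Function.uncurry fun t r => φ t * (X r * powKernel κ (r - t)))
      (volume.prod volume) := by
    refine (hp.norm.const_mul L).mono' ?_ ?_
    · refine hφ.aestronglyMeasurable.comp_fst.mul (Measurable.aestronglyMeasurable ?_)
      exact (hX.comp measurable_snd).mul ((measurable_powKernel κ).comp
        (measurable_snd.sub measurable_fst))
    · refine Eventually.of_forall fun z => ?_
      simp only [Function.uncurry, norm_mul, Real.norm_of_nonneg (powKernel_nonneg _ _)]
      have : ‖X z.2‖ ≤ L * powKernel 1 (T - z.2) := by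
        by_cases hz : z.2 < T
        · rw [powKernel_one_of_pos (by linarith), mul_one]; exact hL _
        · rw [hXT _ (not_lt.1 hz), powKernel_of_nonpos 1 (by linarith)]; simp
      have hk := powKernel_nonneg κ (z.2 - z.1)
      calc ‖φ z.1‖ * (‖X z.2‖ * powKernel κ (z.2 - z.1)) ≤
          ‖φ z.1‖ * (L * powKernel 1 (T - z.2) * powKernel κ (z.2 - z.1)) := by gcongr
        _ = _ := by ring
  simp_rw [← integral_const_mul]
  rw [integral_integral_swap hF]
  congr 1; ext r
  congr 1; ext t
  ring


/-- Lebesgue differentiation gives the pointwise limit almost everywhere, and `‖φ‖ L` dominates. -/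
lemma tendsto_integral_mul_average {T L : ℝ} {φ ψ : ℝ → ℝ} (hφ : Integrable φ)
    (hψ : Measurable ψ) (hL : ∀ t, |ψ t| ≤ L) :
    Tendsto (fun h => ∫ t in Ioo 0 T, φ t * (h⁻¹ * ∫ s in t..(t + h), ψ s)) (𝓝[>] 0)
      (𝓝 (∫ t in Ioo 0 T, φ t * ψ t)) := by
  have hloc : LocallyIntegrable ψ := by
    refine (locallyIntegrable_const L).mono hψ.aestronglyMeasurable (Eventually.of_forall fun t => ?_)
    exact (hL t).trans (le_abs_self L)
  have hii : ∀ a b, IntervalIntegrable ψ volume a b := fun a b => by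
    rw [intervalIntegrable_iff]
    exact Measure.integrableOn_of_bounded (M := L) (by simp) hψ.aestronglyMeasurable
      (Eventually.of_forall hL)
  have hcont : Continuous fun x => ∫ s in (0 : ℝ)..x, ψ s :=
    intervalIntegral.continuous_primitive hii 0
  have e : ∀ t h, ∫ s in t..(t + h), ψ s =
      (∫ s in (0 : ℝ)..(t + h), ψ s) - ∫ s in (0 : ℝ)..t, ψ s := fun t h => by
    rw [intervalIntegral.integral_interval_sub_left (hii _ _) (hii _ _)]
  refine tendsto_integral_filter_of_dominated_convergence (fun t => ‖φ t‖ * L) ?_ ?_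
    (hφ.norm.mul_const L).integrableOn ?_
  · refine Eventually.of_forall fun h => (hφ.aestronglyMeasurable.mul ?_).restrict
    simp_rw [e]
    exact Continuous.aestronglyMeasurable (by fun_prop)
  · filter_upwards [self_mem_nhdsWithin] with h hh
    have hh' : (0 : ℝ) < h := hh
    refine Eventually.of_forall fun t => ?_
    rw [norm_mul, norm_mul, norm_inv, Real.norm_of_nonneg hh'.le]
    gcongr
    have := intervalIntegral.norm_integral_le_of_norm_le_const (a := t) (b := t + h)
      (f := ψ) (C := L) (fun r _ => hL r)
    rw [add_sub_cancel_left, abs_of_pos hh'] at this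
    rw [inv_mul_le_iff₀ hh']; linarith
  · refine ae_restrict_of_ae ?_
    filter_upwards [LocallyIntegrable.ae_hasDerivAt_integral hloc] with t ht
    refine Tendsto.const_mul _ ?_
    have := (ht 0).tendsto_slope_zero_right
    refine this.congr fun h => ?_
    rw [e]; simp

/-- The Zähle-Stieltjes integral of a bounded function with integrable Marchaud kernel against a
Hölder function exists, and it is the limit of the averaged Riemann-Stieltjes sums. -/
theorem exists_hasZSIntegral {T κ β K B : ℝ} {u g : ℝ → ℝ} (hT : 0 < T) (h0 : 0 < κ) (h1 : κ < 1)
    (hκβ : 1 - κ < β) (hu : Measurable u) (hB : ∀ t, |u t| ≤ B) (hu0 : ∀ t ≤ 0, u t = u 0)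
    (hlim : Tendsto u (𝓝[>] 0) (𝓝 (u 0))) (hMI : MarchaudIntegrable T κ u)
    (hg : ∀ s t, |g t - g s| ≤ K * |t - s| ^ β) (hg0 : ∀ t ≤ 0, g t = g 0)
    (hgT : ∀ t, T ≤ t → g t = g T) :
    ∃ I, HasZSIntegral 0 T u g I ∧ Tendsto (fun h => rsAverage u g h 0 T) (𝓝[>] 0) (𝓝 I) := by
  have hβ : 0 < β := by linarith
  have hgc : Continuous g := continuous_of_abs_sub_le_rpow hβ hg
  have hK : 0 ≤ K := by
    have := (abs_nonneg _).trans (hg 0 1); simpa using this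
  have hB0 : 0 ≤ B := (abs_nonneg _).trans (hB 0)
  have h0' : 0 < 1 - κ := by linarith
  have h1' : 1 - κ < 1 := by linarith
  -- the integrand
  set v : ℝ → ℝ := fun t => u t - u 0 with hv
  have hvm : Measurable v := by fun_prop
  have hvB : ∀ t, |v t| ≤ B + B := fun t => (abs_sub _ _).trans (add_le_add (hB _) (hB _))
  have hv0 : ∀ t ≤ 0, v t = 0 := fun t ht => by simp [hv, hu0 t ht]
  have hvMI : MarchaudIntegrable T κ v := by
    have : (fun z : ℝ × ℝ => (v z.1 - v (z.1 - z.2)) * z.2 ^ (-1 - κ)) =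
        fun z : ℝ × ℝ => (u z.1 - u (z.1 - z.2)) * z.2 ^ (-1 - κ) := by
      ext z; simp only [hv]; ring
    unfold MarchaudIntegrable; rw [this]; exact hMI
  set φ := marchaud κ v with hφ
  have hφi : IntegrableOn φ (Ioo 0 T) := hvMI.integrableOn
  have hφv := hvMI.eq_leftRL h0 h1 hvm hvB hv0
  -- the integrator, reflected
  set w : ℝ → ℝ := fun t => g (T - t) - g T with hw
  have hwc : Continuous w := by fun_prop
  have hwm : Measurable w := hwc.measurable
  have hw0 : ∀ t ≤ 0, w t = 0 := fun t ht => by simp [hw, hgT (T - t) (by linarith)]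
  obtain ⟨L, hL⟩ : ∃ L, ∀ t, |w t| ≤ L := by
    refine ⟨K * T ^ β, fun t => ?_⟩
    have key : ∀ s ∈ Icc 0 T, |g s - g T| ≤ K * T ^ β := fun s hs => by
      refine (hg T s).trans ?_
      gcongr
      rw [abs_sub_comm, abs_of_nonneg (by linarith [hs.2])]; linarith [hs.1]
    by_cases ht : t ≤ 0
    · rw [hw0 t ht]; simp; positivity
    · by_cases ht' : t ≤ T
      · exact key _ ⟨by linarith, by linarith⟩
      · simp only [hw]
        rw [hg0 (T - t) (by linarith)]
        exact key 0 ⟨le_rfl, hT.le⟩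
  have hL0 : 0 ≤ L := (abs_nonneg _).trans (hL 0)
  -- Here `1 - κ < β` is used: the modulus of `w` is integrable against the kernel of order `1 - κ`,
  -- uniformly in time, so `χ` is bounded and not merely integrable.
  have hρ := integrableOn_min_rpow_mul (C := K) (B := L + L) h0' hκβ hK (by linarith)
  have hwρ : ∀ t, ∀ r > 0, |w t - w (t - r)| ≤ min (K * r ^ β) (L + L) := by
    intro t r hr
    refine le_min ?_ ((abs_sub _ _).trans (add_le_add (hL _) (hL _)))
    have := hg (T - (t - r)) (T - t)
    rw [show T - t - (T - (t - r)) = -r by ring, abs_neg, abs_of_pos hr] at this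
    simpa [hw] using this
  have hwMI : MarchaudIntegrable T (1 - κ) w := marchaudIntegrable_of_modulus hwm hρ hwρ
  have hχm : Measurable (marchaud (1 - κ) w) := by
    refine Measurable.const_mul ?_ _
    refine StronglyMeasurable.measurable (StronglyMeasurable.integral_prod_right
      (f := fun t r => (w t - w (t - r)) * r ^ (-1 - (1 - κ))) (Measurable.stronglyMeasurable ?_))
    simp only [Function.uncurry_def]; fun_prop
  set χ := marchaud (1 - κ) w with hχ
  have hχw := hwMI.eq_leftRL h0' h1' hwm hL hw0
  set D := (1 - κ) / Real.Gamma (1 - (1 - κ)) *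
    ∫ r in Ioi (0 : ℝ), min (K * r ^ β) (L + L) * r ^ (-1 - (1 - κ)) with hD
  have hχD : ∀ t, |χ t| ≤ D := abs_marchaud_le h0' h1' hρ hwρ
  set ψ : ℝ → ℝ := fun t => χ (T - t) with hψ
  -- Without the cut-off, windows `[t, t+h]` reaching past `T` would pick up values of `χ` at
  -- negative times. With it they contribute nothing there, in agreement with `P` vanishing on the
  -- nonpositive half-line.
  set ψ₀ : ℝ → ℝ := (Ioc 0 T).indicator ψ with hψ₀
  have hψm : Measurable ψ := by fun_prop
  have hψ₀m : Measurable ψ₀ := hψm.indicator measurableSet_Ioc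
  have hψ₀D : ∀ t, |ψ₀ t| ≤ D := fun t => by
    by_cases ht : t ∈ Ioc 0 T
    · rw [hψ₀, indicator_of_mem ht]; exact hχD _
    · rw [hψ₀, indicator_of_notMem ht]; simpa using (abs_nonneg _).trans (hχD 0)
  set φ₀ : ℝ → ℝ := (Ioo 0 T).indicator φ with hφ₀
  have hφ₀i : Integrable φ₀ := (integrable_indicator_iff measurableSet_Ioo).2 hφi
  have hφ₀0 : ∀ r ≤ 0, φ₀ r = 0 := fun r hr => indicator_of_notMem (fun h => h.1.not_ge hr) _
  -- fractional integration by parts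
  have hparts : ∀ h > 0, ∫ t in Ioo 0 T, φ₀ t * (h⁻¹ * ∫ s in t..(t + h), ψ₀ s) =
      - ∫ r in (0 : ℝ)..T, v r * ((g (r + h) - g r) / h) := by
    intro h hh
    have hG := Real.Gamma_pos_of_pos h0
    -- `Γ(κ)⁻¹ P` is the primitive of `χ`, so moving averages of `ψ₀` become increments of `P`. By
    -- `hPX` these are fractional integrals of increments of `g`; exchanging the order of
    -- integration then moves `I^κ` onto `φ₀`, which restores `v`.
    set P : ℝ → ℝ := fun x => ∫ s, w s * powKernel κ (x - s) with hP
    have hN : ∀ x, 0 ≤ x → x ≤ T → ∫ s in (0 : ℝ)..x, χ s = (Real.Gamma κ)⁻¹ * P x := by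
      intro x hx hxT
      have := hwMI.integral_marchaud h0' h1' hwm hL hw0 hx hxT
      rwa [sub_sub_cancel] at this
    have hPnp : ∀ x ≤ 0, P x = 0 := by
      intro x hx
      rw [← integral_zero ℝ ℝ]
      simp only [hP]
      congr 1; ext s
      by_cases hs : 0 < s
      · rw [powKernel_of_nonpos _ (by linarith)]; simp
      · simp [hw0 s (not_lt.1 hs)]
    have hχi : ∀ a b, IntervalIntegrable χ volume a b := fun a b => by
      rw [intervalIntegrable_iff]
      exact Measure.integrableOn_of_bounded (M := D) (by simp) hχm.aestronglyMeasurable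
        (Eventually.of_forall hχD)
    have hψ₀i : ∀ a b, IntervalIntegrable ψ₀ volume a b := fun a b => by
      rw [intervalIntegrable_iff]
      exact Measure.integrableOn_of_bounded (M := D) (by simp) hψ₀m.aestronglyMeasurable
        (Eventually.of_forall hψ₀D)
    have hinner : ∀ a b, 0 ≤ a → a ≤ b → b ≤ T →
        ∫ s in a..b, ψ₀ s = (Real.Gamma κ)⁻¹ * (P (T - a) - P (T - b)) := by
      intro a b ha hab hb
      have e1 : ∫ s in a..b, ψ₀ s = ∫ s in a..b, χ (T - s) := by
        rw [intervalIntegral.integral_of_le hab, intervalIntegral.integral_of_le hab]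
        refine setIntegral_congr_fun measurableSet_Ioc fun s hs => ?_
        simp only [hψ₀]
        rw [indicator_of_mem (show s ∈ Ioc 0 T from ⟨by linarith [hs.1], by linarith [hs.2]⟩)]
      rw [e1, intervalIntegral.integral_comp_sub_left, mul_sub,
        ← hN _ (by linarith) (by linarith), ← hN _ (by linarith) (by linarith),
        intervalIntegral.integral_interval_sub_left (hχi _ _) (hχi _ _)]
    have hinc : ∀ t ∈ Ioo 0 T, ∫ s in t..(t + h), ψ₀ s =
        (Real.Gamma κ)⁻¹ * (P (T - t) - P (T - t - h)) := by
      intro t ht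
      by_cases hth : t + h ≤ T
      · rw [hinner t (t + h) ht.1.le (by linarith) hth, sub_add_eq_sub_sub]
      · rw [← intervalIntegral.integral_add_adjacent_intervals (hψ₀i t T) (hψ₀i T (t + h)),
          hinner t T ht.1.le ht.2.le le_rfl, sub_self, hPnp 0 le_rfl,
          hPnp (T - t - h) (by linarith), intervalIntegral.integral_of_le (by linarith : T ≤ t + h),
          setIntegral_congr_fun (g := fun _ => (0 : ℝ)) measurableSet_Ioc]
        · simp
        · intro s hs
          exact indicator_of_notMem (fun hs' => hs.1.not_ge hs'.2) _
    set X : ℝ → ℝ := fun r => g r - g (r + h) with hX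
    have hwP : ∀ (F : ℝ → ℝ) (x : ℝ), Measurable F → (∀ s, |F s| ≤ L) → (∀ s ≤ 0, F s = 0) →
        Integrable fun s => F s * powKernel κ (x - s) := by
      intro F x hF hFL hF0
      refine ((integral_one_conv_powKernel h0 x).1.const_mul L).mono' ?_ ?_
      · exact (hF.mul ((measurable_powKernel κ).comp (measurable_const.sub measurable_id))
          ).aestronglyMeasurable
      · refine Eventually.of_forall fun s => ?_
        have hk := powKernel_nonneg κ (x - s)
        rw [norm_mul, Real.norm_of_nonneg hk, Real.norm_eq_abs]
        by_cases hs : 0 < s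
        · rw [powKernel_one_of_pos hs, mul_one]; gcongr; exact hFL s
        · rw [hF0 s (not_lt.1 hs), powKernel_of_nonpos 1 (not_lt.1 hs)]; simp
    have hPX : ∀ t, P (T - t) - P (T - t - h) = ∫ r, X r * powKernel κ (r - t) := by
      intro t
      have e1 : P (T - t - h) = ∫ s, w (s - h) * powKernel κ (T - t - s) := by
        simp only [hP]
        rw [← integral_sub_right_eq_self _ h]
        congr 1; ext s
        congr 2; ring
      rw [e1]
      simp only [hP]
      rw [← integral_sub (hwP w _ hwm hL hw0) (hwP (fun s => w (s - h)) _ (by fun_prop)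
          (fun s => hL _) (fun s hs => hw0 _ (by linarith))), ← integral_sub_left_eq_self _ _ T]
      congr 1; ext r
      simp only [hw, hX]
      rw [show T - (T - r) = r by ring, show T - (T - r - h) = r + h by ring,
        show T - t - (T - r) = r - t by ring]
      ring
    have hXL : ∀ r, |X r| ≤ L + L := by
      intro r
      have e : X r = w (T - r) - w (T - (r + h)) := by simp only [hw, hX]; ring_nf
      rw [e]
      exact (abs_sub _ _).trans (add_le_add (hL _) (hL _))
    have hswap := integral_mul_powKernel_swap (κ := κ) (T := T) h0 hφ₀i hφ₀0
      (X := X) (by fun_prop) hXL (fun r hr => by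
        simp only [hX]; rw [hgT r hr, hgT (r + h) (by linarith)]; ring)
    have hR : ∫ r, X r * ∫ t, φ₀ t * powKernel κ (r - t) =
        ∫ r in Ioo 0 T, X r * (Real.Gamma κ * v r) := by
      rw [← integral_indicator measurableSet_Ioo]
      refine integral_congr_ae ?_
      rw [ae_restrict_iff' measurableSet_Ioo] at hφv
      filter_upwards [hφv] with r hr
      by_cases hr0 : 0 < r
      · by_cases hrT : r < T
        · rw [indicator_of_mem (show r ∈ Ioo 0 T from ⟨hr0, hrT⟩), hr ⟨hr0, hrT⟩,
            leftRL_eq_integral_powKernel h0.ne', mul_inv_cancel_left₀ hG.ne']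
          congr 2; ext t
          by_cases ht : 0 < t
          · by_cases htT : t < T
            · simp [hφ₀, hφ, indicator, ht, htT]
            · rw [powKernel_of_nonpos _ (by linarith)]; simp
          · simp [hφ₀, indicator, ht]
        · have : X r = 0 := by
            simp only [hX]; rw [hgT r (by linarith), hgT (r + h) (by linarith)]; ring
          rw [this, indicator_of_notMem (fun h => hrT h.2)]; simp
      · have : ∫ t, φ₀ t * powKernel κ (r - t) = 0 := by
          rw [← integral_zero ℝ ℝ]
          congr 1; ext t
          by_cases ht : 0 < t
          · rw [powKernel_of_nonpos _ (by linarith)]; simp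
          · simp [hφ₀0 t (not_lt.1 ht)]
        rw [this, indicator_of_notMem (fun h => hr0 h.1)]; simp
    calc ∫ t in Ioo 0 T, φ₀ t * (h⁻¹ * ∫ s in t..(t + h), ψ₀ s)
        = ∫ t in Ioo 0 T, h⁻¹ * (Real.Gamma κ)⁻¹ *
            (φ₀ t * ∫ r, X r * powKernel κ (r - t)) := by
          refine setIntegral_congr_fun measurableSet_Ioo fun t ht => ?_
          rw [hinc t ht, hPX]; ring
      _ = h⁻¹ * (Real.Gamma κ)⁻¹ * ∫ t, φ₀ t * ∫ r, X r * powKernel κ (r - t) := by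
          rw [integral_const_mul]
          congr 1
          refine setIntegral_eq_integral_of_forall_compl_eq_zero fun t ht => ?_
          rw [hφ₀, indicator_of_notMem ht, zero_mul]
      _ = h⁻¹ * (Real.Gamma κ)⁻¹ * ∫ r in Ioo 0 T, X r * (Real.Gamma κ * v r) := by
          rw [hswap, hR]
      _ = _ := by
          rw [intervalIntegral.integral_of_le hT.le, integral_Ioc_eq_integral_Ioo,
            ← integral_const_mul, ← integral_neg]
          congr 1; ext r
          simp only [hX]; field_simp; ring
  have hlimit := tendsto_integral_mul_average (T := T) hφ₀i hψ₀m hψ₀D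
  have hval : ∫ t in Ioo 0 T, φ₀ t * ψ₀ t = ∫ t in Ioo 0 T, φ t * ψ t :=
    setIntegral_congr_fun measurableSet_Ioo fun t ht => by
      simp only [hφ₀, hψ₀, indicator_of_mem ht, indicator_of_mem (Ioo_subset_Ioc_self ht)]
  rw [hval] at hlimit
  refine ⟨-(∫ t in Ioo 0 T, φ t * ψ t) + u 0 * (g T - g 0), ?_, ?_⟩
  -- The exponents are `p = 1` and `q = ∞`: one derivative is integrable and the other is bounded.
  · refine ⟨u 0, g 0, g T, hlim, (hgc.tendsto 0).mono_left nhdsWithin_le_nhds,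
      (hgc.tendsto T).mono_left nhdsWithin_le_nhds, κ, h0.le, h1.le, 1, ∞, le_rfl, le_top, by simp,
      φ, ψ, ⟨memLp_one_iff_integrable.2 hφi, hφv⟩, ⟨?_, ?_⟩, rfl⟩
    · exact MemLp.of_bound hψm.aestronglyMeasurable D (Eventually.of_forall fun t => hχD _)
    · have := (measurePreserving_reflect_Ioo T).quasiMeasurePreserving.ae hχw
      filter_upwards [this] with t ht
      rw [hψ, rightRL_reflect, ← ht]; simp [hw]
  -- Integration by parts covers `v = u - u(0)`; the constant `u(0)` contributes integrated slopes
  -- of `g`, which converge to the total increment.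
  · have h2 : Tendsto (fun h => u 0 * ∫ r in (0 : ℝ)..T, (g (r + h) - g r) / h) (𝓝[>] 0)
        (𝓝 (u 0 * (g T - g 0))) := by
      refine Tendsto.const_mul _ ?_
      rw [tendsto_iff_norm_sub_tendsto_zero]
      have hz : Tendsto (fun h : ℝ => 2 * K * h ^ β) (𝓝[>] 0) (𝓝 0) := by
        have : Continuous fun h : ℝ => 2 * K * h ^ β :=
          continuous_const.mul (continuous_id.rpow_const fun _ => Or.inr hβ.le)
        have := (this.tendsto 0).mono_left (nhdsWithin_le_nhds (s := Ioi 0))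
        simpa [hβ.ne'] using this
      refine squeeze_zero' (Eventually.of_forall fun _ => norm_nonneg _) ?_ hz
      filter_upwards [self_mem_nhdsWithin] with h hh
      exact abs_integral_slope_sub_le hβ hg hh 0 T
    refine (hlimit.neg.add h2).congr' ?_
    filter_upwards [self_mem_nhdsWithin] with h hh
    have hsl : Continuous fun r => (g (r + h) - g r) / h := by fun_prop
    have hvi : IntervalIntegrable v volume 0 T := by
      rw [intervalIntegrable_iff]
      exact Measure.integrableOn_of_bounded (M := B + B) (by simp) hvm.aestronglyMeasurable
        (Eventually.of_forall hvB)
    rw [hparts h hh, neg_neg, ← intervalIntegral.integral_const_mul,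
      ← intervalIntegral.integral_add (hvi.mul_continuousOn hsl.continuousOn)
        ((hsl.const_mul _).intervalIntegrable _ _), rsAverage]
    congr 1; ext r; simp only [hv]; ring


/-! ### Bounds in mean -/

/-- The `L¹(Q)` norm of `F` is at most `c`. -/
def L1Le {Ω : Type*} [MeasurableSpace Ω] (Q : Measure Ω) (F : Ω → ℝ) (c : ℝ) : Prop :=
  ∫⁻ ω, ‖F ω‖ₑ ∂Q ≤ ENNReal.ofReal c

namespace L1Le

variable {Ω : Type*} [MeasurableSpace Ω] {Q : Measure Ω} {F G : Ω → ℝ} {c d k : ℝ}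

lemma mono (h : L1Le Q F c) (hcd : c ≤ d) : L1Le Q F d :=
  le_trans h (ENNReal.ofReal_le_ofReal hcd)

lemma congr (h : L1Le Q F c) (hFG : ∀ᵐ ω ∂Q, G ω = F ω) : L1Le Q G c := by
  unfold L1Le
  rw [lintegral_congr_ae (g := fun ω => ‖F ω‖ₑ) (by filter_upwards [hFG] with ω h; rw [h])]
  exact h

lemma add (hF : L1Le Q F c) (hG : L1Le Q G d) (hFm : Measurable F) (hc : 0 ≤ c) (hd : 0 ≤ d) :
    L1Le Q (fun ω => F ω + G ω) (c + d) := by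
  unfold L1Le at *
  calc ∫⁻ ω, ‖F ω + G ω‖ₑ ∂Q ≤ ∫⁻ ω, ‖F ω‖ₑ + ‖G ω‖ₑ ∂Q := lintegral_mono fun ω => enorm_add_le _ _
    _ = ∫⁻ ω, ‖F ω‖ₑ ∂Q + ∫⁻ ω, ‖G ω‖ₑ ∂Q := lintegral_add_left hFm.enorm _
    _ ≤ ENNReal.ofReal c + ENNReal.ofReal d := add_le_add hF hG
    _ = _ := (ENNReal.ofReal_add hc hd).symm

lemma neg (hF : L1Le Q F c) : L1Le Q (fun ω => -F ω) c := by
  unfold L1Le at *; simpa using hF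

lemma mul_of_le (hF : L1Le Q F c) (hG : ∀ᵐ ω ∂Q, |G ω| ≤ k) (hk : 0 ≤ k) :
    L1Le Q (fun ω => F ω * G ω) (c * k) := by
  unfold L1Le at *
  calc ∫⁻ ω, ‖F ω * G ω‖ₑ ∂Q ≤ ∫⁻ ω, ‖F ω‖ₑ * ENNReal.ofReal k ∂Q := by
        refine lintegral_mono_ae ?_
        filter_upwards [hG] with ω hω
        rw [enorm_mul]
        gcongr
        rw [← ofReal_norm]
        exact ENNReal.ofReal_le_ofReal hω
    _ = (∫⁻ ω, ‖F ω‖ₑ ∂Q) * ENNReal.ofReal k := lintegral_mul_const' _ _ ENNReal.ofReal_ne_top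
    _ ≤ ENNReal.ofReal c * ENNReal.ofReal k := by gcongr
    _ = _ := (ENNReal.ofReal_mul' hk).symm

lemma of_ae_le [IsFiniteMeasure Q] (hF : ∀ᵐ ω ∂Q, |F ω| ≤ k) (hk : 0 ≤ k) :
    L1Le Q F (Q.real univ * k) := by
  have h1 : L1Le Q (fun _ => (1 : ℝ)) (Q.real univ) := by
    unfold L1Le; simp [measureReal_def]
  simpa using h1.mul_of_le hF hk

lemma sum {ι : Type*} (s : Finset ι) {F : ι → Ω → ℝ} {c : ι → ℝ} (hF : ∀ i ∈ s, L1Le Q (F i) (c i))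
    (hm : ∀ i ∈ s, Measurable (F i)) (hc : ∀ i ∈ s, 0 ≤ c i) :
    L1Le Q (fun ω => ∑ i ∈ s, F i ω) (∑ i ∈ s, c i) := by
  classical
  induction s using Finset.induction_on with
  | empty => simp [L1Le]
  | insert a s ha ih =>
    simp only [Finset.sum_insert ha]
    refine (hF a (by simp)).add (ih (fun i hi => hF i (by simp [hi])) (fun i hi => hm i (by simp [hi]))
      (fun i hi => hc i (by simp [hi]))) (hm a (by simp)) (hc a (by simp)) ?_
    exact Finset.sum_nonneg fun i hi => hc i (by simp [hi])

lemma intervalIntegral [SFinite Q] {w : ℝ → Ω → ℝ} {a b : ℝ} (hw : Measurable (Function.uncurry w))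
    (hab : a ≤ b) (h : ∀ r ∈ Ioc a b, L1Le Q (w r) c) :
    L1Le Q (fun ω => ∫ r in a..b, w r ω) (c * (b - a)) := by
  unfold L1Le at *
  calc ∫⁻ ω, ‖∫ r in a..b, w r ω‖ₑ ∂Q ≤ ∫⁻ ω, (∫⁻ r in Ioc a b, ‖w r ω‖ₑ) ∂Q := by
        refine lintegral_mono fun ω => ?_
        simp only
        rw [intervalIntegral.integral_of_le hab]
        exact enorm_integral_le_lintegral_enorm _
    _ = ∫⁻ r in Ioc a b, ∫⁻ ω, ‖w r ω‖ₑ ∂Q := by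
        refine lintegral_lintegral_swap (Measurable.aemeasurable ?_)
        exact (hw.comp measurable_swap).enorm
    _ ≤ ∫⁻ r in Ioc a b, ENNReal.ofReal c := setLIntegral_mono' measurableSet_Ioc h
    _ = _ := by
        rw [setLIntegral_const, Real.volume_Ioc, ENNReal.ofReal_mul' (by linarith)]

end L1Le

lemma measurable_intervalIntegral_uncurry {Ω : Type*} [MeasurableSpace Ω] {w : ℝ → Ω → ℝ}
    (hw : Measurable (Function.uncurry w)) (a b : ℝ) : Measurable fun ω => ∫ r in a..b, w r ω := by
  have : ∀ a b, Measurable fun ω => ∫ r in Ioc a b, w r ω := fun a b =>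
    (StronglyMeasurable.integral_prod_right (f := fun ω r => w r ω)
      (hw.comp measurable_swap).stronglyMeasurable).measurable
  exact (this a b).sub (this b a)

lemma measurable_rsAverage {Ω : Type*} [MeasurableSpace Ω] {u g : ℝ → Ω → ℝ}
    (hu : Measurable (Function.uncurry u)) (hg : Measurable (Function.uncurry g)) (h s t : ℝ) :
    Measurable fun ω => rsAverage (fun r => u r ω) (fun r => g r ω) h s t := by
  refine measurable_intervalIntegral_uncurry
    (w := fun r ω => u r ω * ((g (r + h) ω - g r ω) / h)) ?_ s t
  refine hu.mul (((hg.comp ((measurable_fst.add_const h).prodMk measurable_snd)).sub hg).div_const h)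

/-- Split `g(r+2h) - g(r)` into two increments of step `h`. Shifting the variable by `h` aligns the
second with the first on `[s, t-h]`, at the price of an increment of `v`; the windows of length `h`
at the two ends are left over. -/
lemma rsAverage_two_mul_sub {v g : ℝ → ℝ} {B : ℝ} (hv : Measurable v) (hB : ∀ r, |v r| ≤ B)
    (hg : Continuous g) {h : ℝ} (hh : 0 < h) (s t : ℝ) :
    rsAverage v g h s t = rsAverage v g (2 * h) s t - (2 * h)⁻¹ *
      ((∫ r in s..(t - h), (v r - v (r + h)) * (g (r + h + h) - g (r + h)))
        + (∫ r in (t - h)..t, v r * (g (r + h + h) - g (r + h)))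
        - ∫ r in s..(s + h), v r * (g (r + h) - g r)) := by
  have hvi : ∀ a b, IntervalIntegrable v volume a b := fun a b => by
    rw [intervalIntegrable_iff]
    exact Measure.integrableOn_of_bounded (M := B) (by simp) hv.aestronglyMeasurable
      (Eventually.of_forall hB)
  have hvhi : ∀ a b, IntervalIntegrable (fun r => v (r + h)) volume a b := fun a b => by
    rw [intervalIntegrable_iff]
    exact Measure.integrableOn_of_bounded (M := B) (by simp)
      (hv.comp (measurable_id.add_const h)).aestronglyMeasurable (Eventually.of_forall fun r => hB _)
  have hD : Continuous fun r => g (r + h) - g r := by fun_prop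
  have hD' : Continuous fun r => g (r + h + h) - g (r + h) := by fun_prop
  have i1 : ∀ a b, IntervalIntegrable (fun r => v r * (g (r + h) - g r)) volume a b :=
    fun a b => (hvi a b).mul_continuousOn hD.continuousOn
  have i2 : ∀ a b, IntervalIntegrable (fun r => v r * (g (r + h + h) - g (r + h))) volume a b :=
    fun a b => (hvi a b).mul_continuousOn hD'.continuousOn
  have i3 : ∀ a b, IntervalIntegrable (fun r => v (r + h) * (g (r + h + h) - g (r + h))) volume a b :=
    fun a b => (hvhi a b).mul_continuousOn hD'.continuousOn
  have e1 : rsAverage v g (2 * h) s t = (2 * h)⁻¹ *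
      ((∫ r in s..t, v r * (g (r + h + h) - g (r + h))) + ∫ r in s..t, v r * (g (r + h) - g r)) := by
    rw [rsAverage, ← intervalIntegral.integral_add (i2 s t) (i1 s t),
      ← intervalIntegral.integral_const_mul]
    congr 1; ext r
    rw [show r + 2 * h = r + h + h by ring]; field_simp; ring
  have e2 : rsAverage v g h s t = (2 * h)⁻¹ * (2 * ∫ r in s..t, v r * (g (r + h) - g r)) := by
    rw [rsAverage, ← intervalIntegral.integral_const_mul, ← intervalIntegral.integral_const_mul]
    congr 1; ext r; field_simp
  have e3 : ∫ r in s..(t - h), (v r - v (r + h)) * (g (r + h + h) - g (r + h)) =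
      (∫ r in s..(t - h), v r * (g (r + h + h) - g (r + h))) -
        ∫ r in (s + h)..t, v r * (g (r + h) - g r) := by
    have := intervalIntegral.integral_comp_add_right (a := s) (b := t - h)
      (fun r => v r * (g (r + h) - g r)) h
    rw [sub_add_cancel] at this
    rw [← this, ← intervalIntegral.integral_sub (i2 _ _) (i3 _ _)]
    congr 1; ext r; ring
  have a1 := intervalIntegral.integral_add_adjacent_intervals (i2 s (t - h)) (i2 (t - h) t)
  have a2 := intervalIntegral.integral_add_adjacent_intervals (i1 s (s + h)) (i1 (s + h) t)
  rw [e1, e2, e3, ← a1, ← a2]; ring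

/-! ### Young's estimate for integrands that are Hölder in mean -/

section Young

variable {Ω : Type*} [MeasurableSpace Ω] {Q : Measure Ω} [IsFiniteMeasure Q] {u g : ℝ → Ω → ℝ}
  {B C K γ β : ℝ}

/-- A bounded process that is `γ`-Hölder in `L¹(Q)`. -/
structure L1Holder (Q : Measure Ω) (u : ℝ → Ω → ℝ) (B C γ : ℝ) : Prop where
  measurable : Measurable (Function.uncurry u)
  bound : ∀ t ω, |u t ω| ≤ B
  nonneg : 0 ≤ C
  holder : ∀ s t, L1Le Q (fun ω => u t ω - u s ω) (C * |t - s| ^ γ)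

/-- A process whose paths are `β`-Hölder with constant `K`, almost everywhere. -/
structure PathHolder (Q : Measure Ω) (g : ℝ → Ω → ℝ) (K β : ℝ) : Prop where
  measurable : Measurable (Function.uncurry g)
  nonneg : 0 ≤ K
  holder : ∀ᵐ ω ∂Q, ∀ s t, |g t ω - g s ω| ≤ K * |t - s| ^ β

/-- In the halving identity the interior term pairs an increment of `u`, of mean `C h^γ`, with one
of `g`, at most `K h^β`, over length at most `t - s`. Each end window has length `h`, and there the
subtraction of `u_s` leaves only a mean of `C (t-s)^γ`. Dividing by `2h` gives the two powers. -/
lemma L1Holder.rsAverage_half (hu : L1Holder Q u B C γ) (hg : PathHolder Q g K β) (hγ : 0 < γ)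
    (hβ : 0 < β) {s t h c : ℝ} (hh : 0 < h) (hst : 2 * h ≤ t - s) (hc : 0 ≤ c)
    (H : L1Le Q (fun ω => rsAverage (fun r => u r ω - u s ω) (fun r => g r ω) (2 * h) s t) c) :
    L1Le Q (fun ω => rsAverage (fun r => u r ω - u s ω) (fun r => g r ω) h s t)
      (c + C * K * ((t - s) / 2 * h ^ (γ + β - 1) + (t - s) ^ γ * h ^ β)) := by
  have hum := hu.measurable
  have hgm := hg.measurable
  have hC := hu.nonneg
  have hK := hg.nonneg
  have hts : 0 < t - s := by linarith
  have us : ∀ a, Measurable fun z : ℝ × Ω => u (z.1 + a) z.2 := fun a =>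
    hum.comp ((measurable_fst.add_const a).prodMk measurable_snd)
  have gs : ∀ a, Measurable fun z : ℝ × Ω => g (z.1 + a) z.2 := fun a =>
    hgm.comp ((measurable_fst.add_const a).prodMk measurable_snd)
  have us' : Measurable fun z : ℝ × Ω => u s z.2 := hum.comp (measurable_const.prodMk measurable_snd)
  have hum' : Measurable fun z : ℝ × Ω => u z.1 z.2 := hum
  have hgm' : Measurable fun z : ℝ × Ω => g z.1 z.2 := hgm
  have gs' : Measurable fun z : ℝ × Ω => g (z.1 + h + h) z.2 :=
    hgm.comp (((measurable_fst.add_const h).add_const h).prodMk measurable_snd)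
  have hinc : ∀ r, ∀ᵐ ω ∂Q, |g (r + h) ω - g r ω| ≤ K * h ^ β := fun r => by
    filter_upwards [hg.holder] with ω hω
    have := hω r (r + h)
    rwa [add_sub_cancel_left, abs_of_pos hh] at this
  set W1 : ℝ → Ω → ℝ := fun r ω => (u r ω - u (r + h) ω) * (g (r + h + h) ω - g (r + h) ω) with hW1
  set W2 : ℝ → Ω → ℝ := fun r ω => (u r ω - u s ω) * (g (r + h + h) ω - g (r + h) ω) with hW2
  set W3 : ℝ → Ω → ℝ := fun r ω => (u r ω - u s ω) * (g (r + h) ω - g r ω) with hW3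
  have m1 : Measurable (Function.uncurry W1) := (hum'.sub (us h)).mul (gs'.sub (gs h))
  have m2 : Measurable (Function.uncurry W2) := (hum'.sub us').mul (gs'.sub (gs h))
  have m3 : Measurable (Function.uncurry W3) := (hum'.sub us').mul ((gs h).sub hgm')
  have hKh : 0 ≤ K * h ^ β := by positivity
  have b1 := L1Le.intervalIntegral (Q := Q) (a := s) (b := t - h) (c := C * h ^ γ * (K * h ^ β)) m1
    (by linarith) (fun r _ => L1Le.mul_of_le (by
      have := hu.holder (r + h) r
      rwa [sub_add_cancel_left, abs_neg, abs_of_pos hh] at this) (hinc (r + h)) hKh)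
  have b2 := L1Le.intervalIntegral (Q := Q) (a := t - h) (b := t)
    (c := C * (t - s) ^ γ * (K * h ^ β)) m2
    (by linarith) (fun r hr => L1Le.mul_of_le ((hu.holder s r).mono (by
      gcongr; rw [abs_of_nonneg (by linarith [hr.1])]; linarith [hr.2])) (hinc (r + h)) hKh)
  have b3 := L1Le.intervalIntegral (Q := Q) (a := s) (b := s + h)
    (c := C * (t - s) ^ γ * (K * h ^ β)) m3
    (by linarith) (fun r hr => L1Le.mul_of_le ((hu.holder s r).mono (by
      gcongr; rw [abs_of_nonneg (by linarith [hr.1])]; linarith [hr.2])) (hinc r) hKh)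
  have M1 := measurable_intervalIntegral_uncurry m1 s (t - h)
  have M2 := measurable_intervalIntegral_uncurry m2 (t - h) t
  have ba := (b1.add b2 M1 (mul_nonneg (by positivity) (by linarith))
    (mul_nonneg (by positivity) (by linarith))).add b3.neg (M1.add M2)
    (add_nonneg (mul_nonneg (by positivity) (by linarith)) (mul_nonneg (by positivity) (by linarith)))
    (mul_nonneg (by positivity) (by linarith))
  have bb := ba.mul_of_le (G := fun _ => -(2 * h)⁻¹) (k := (2 * h)⁻¹)
    (Eventually.of_forall fun _ => by rw [abs_neg, abs_of_pos (by positivity)]) (by positivity)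
  have hAm := measurable_rsAverage (u := fun r ω => u r ω - u s ω) (hum'.sub us') hgm' (2 * h) s t
  have htot := H.add bb hAm hc (by
    have : 0 ≤ t - h - s := by linarith
    have : 0 ≤ t - (t - h) := by linarith
    have : 0 ≤ s + h - s := by linarith
    positivity)
  refine (htot.congr ?_).mono ?_
  · filter_upwards [hg.holder] with ω hω
    rw [rsAverage_two_mul_sub (v := fun r => u r ω - u s ω) (B := B + B)
      ((hum'.comp (measurable_id.prodMk measurable_const)).sub measurable_const)
      (fun r => (abs_sub _ _).trans (add_le_add (hu.bound _ _) (hu.bound _ _)))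
      (continuous_of_abs_sub_le_rpow hβ hω) hh s t]
    simp only [hW1, hW2, hW3, sub_sub_sub_cancel_right]
    ring
  · have e : h ^ (γ + β - 1) = h ^ γ * h ^ β / h := by
      rw [Real.rpow_sub_one hh.ne', Real.rpow_add hh]
    rw [e]
    have h1 : C * h ^ γ * (K * h ^ β) * (t - h - s) ≤ C * h ^ γ * (K * h ^ β) * (t - s) := by
      gcongr; linarith
    have hinv : 0 < (2 * h)⁻¹ := by positivity
    calc _ ≤ c + (C * h ^ γ * (K * h ^ β) * (t - s) +
          C * (t - s) ^ γ * (K * h ^ β) * (t - (t - h)) +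
          C * (t - s) ^ γ * (K * h ^ β) * (s + h - s)) * (2 * h)⁻¹ := by gcongr
      _ = _ := by field_simp; ring

/-- The constant in the local Young estimate. -/
def youngConst (C K γ β : ℝ) : ℝ :=
  C * K * (3 + 2⁻¹ / (2 ^ (γ + β - 1) - 1) + 1 / (2 ^ β - 1))

lemma two_rpow_sub_one_pos {p : ℝ} (hp : 0 < p) : 0 < (2 : ℝ) ^ p - 1 :=
  sub_pos.2 (Real.one_lt_rpow one_lt_two hp)

lemma youngConst_nonneg (hC : 0 ≤ C) (hK : 0 ≤ K) (hβ : 0 < β) (hθ : 1 < γ + β) :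
    0 ≤ youngConst C K γ β := by
  have := two_rpow_sub_one_pos hβ
  have := two_rpow_sub_one_pos (sub_pos.2 hθ)
  unfold youngConst; positivity

/-- Iterated halving. The costs over the steps `h, 2h, …, 2^(n-1) h` are geometric sums with `∑ (2^j
h)^p = ((2^n h)^p - h^p)/(2^p - 1)`; keeping this closed form makes the induction step an identity.
-/
lemma L1Holder.rsAverage_dyadic (hu : L1Holder Q u B C γ) (hg : PathHolder Q g K β) (hγ : 0 < γ)
    (hβ : 0 < β) (hθ : 1 < γ + β) {s t c : ℝ} (hc : 0 ≤ c) (n : ℕ) :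
    ∀ h, 0 < h → 2 ^ n * h ≤ t - s →
    L1Le Q (fun ω => rsAverage (fun r => u r ω - u s ω) (fun r => g r ω) (2 ^ n * h) s t) c →
    L1Le Q (fun ω => rsAverage (fun r => u r ω - u s ω) (fun r => g r ω) h s t)
      (c + C * K * ((t - s) / 2 / (2 ^ (γ + β - 1) - 1) *
          ((2 ^ n * h) ^ (γ + β - 1) - h ^ (γ + β - 1))
        + (t - s) ^ γ / (2 ^ β - 1) * ((2 ^ n * h) ^ β - h ^ β))) := by
  have hC := hu.nonneg
  have hK := hg.nonneg
  have p1 := two_rpow_sub_one_pos hβ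
  have p2 := two_rpow_sub_one_pos (sub_pos.2 hθ)
  induction n with
  | zero => intro h _ _ H; simpa using H
  | succ n ih =>
    intro h hh hle H
    have hts : 0 < t - s := lt_of_lt_of_le (by positivity) hle
    have e : (2 : ℝ) ^ (n + 1) * h = 2 ^ n * (2 * h) := by ring
    rw [e] at hle H ⊢
    have one_le : (1 : ℝ) ≤ 2 ^ n := one_le_pow₀ one_le_two
    have h2 : 2 * h ≤ 2 ^ n * (2 * h) := le_mul_of_one_le_left (by positivity) one_le
    have := ih (2 * h) (by positivity) hle H
    have hm1 : (2 * h) ^ (γ + β - 1) ≤ (2 ^ n * (2 * h)) ^ (γ + β - 1) :=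
      Real.rpow_le_rpow (by positivity) h2 (by linarith)
    have hm2 : (2 * h) ^ β ≤ (2 ^ n * (2 * h)) ^ β :=
      Real.rpow_le_rpow (by positivity) h2 hβ.le
    have := hu.rsAverage_half hg hγ hβ hh (by linarith) (by
      have := sub_nonneg.2 hm1
      have := sub_nonneg.2 hm2
      positivity) this
    refine this.mono (le_of_eq ?_)
    rw [Real.mul_rpow (x := 2) zero_le_two hh.le, Real.mul_rpow (x := 2) zero_le_two hh.le]
    field_simp
    ring

/-- The accumulated cost is governed by the coarsest scale because `γ + β - 1` and `β` are positive,
hence the bound does not depend on `h`. -/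
lemma L1Holder.rsAverage_le (hu : L1Holder Q u B C γ) (hg : PathHolder Q g K β) (hγ : 0 < γ)
    (hβ : 0 < β) (hθ : 1 < γ + β) {s t h : ℝ} (hh : 0 < h) (hst : h ≤ t - s) :
    L1Le Q (fun ω => rsAverage (fun r => u r ω - u s ω) (fun r => g r ω) h s t)
      (C * K * (2 + 2⁻¹ / (2 ^ (γ + β - 1) - 1) + 1 / (2 ^ β - 1)) * (t - s) ^ (γ + β)) := by
  have hC := hu.nonneg
  have hK := hg.nonneg
  have p1 := two_rpow_sub_one_pos hβ
  have p2 := two_rpow_sub_one_pos (sub_pos.2 hθ)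
  have hts : 0 < t - s := by linarith
  -- The scale `H = 2^n h` satisfies `H ≤ t - s < 2H`. There the integrand is bounded directly, and
  -- `(t - s)/H ≤ 2` accounts for the constant `2`.
  obtain ⟨n, hn1, hn2⟩ := exists_nat_pow_near ((one_le_div hh).2 hst) one_lt_two
  rw [le_div_iff₀ hh] at hn1
  rw [div_lt_iff₀ hh] at hn2
  set H := 2 ^ n * h with hH
  have hH0 : 0 < H := by positivity
  have hn3 : t - s < 2 * H := by rw [pow_succ] at hn2; linarith
  have hum' : Measurable fun z : ℝ × Ω => u z.1 z.2 := hu.measurable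
  have hgm' : Measurable fun z : ℝ × Ω => g z.1 z.2 := hg.measurable
  have us' : Measurable fun z : ℝ × Ω => u s z.2 :=
    hu.measurable.comp (measurable_const.prodMk measurable_snd)
  have gs : Measurable fun z : ℝ × Ω => g (z.1 + H) z.2 :=
    hg.measurable.comp ((measurable_fst.add_const H).prodMk measurable_snd)
  have base : L1Le Q (fun ω => rsAverage (fun r => u r ω - u s ω) (fun r => g r ω) H s t)
      (C * K * 2 * (t - s) ^ (γ + β)) := by
    have := L1Le.intervalIntegral (Q := Q) (a := s) (b := t)
      (w := fun r ω => (u r ω - u s ω) * ((g (r + H) ω - g r ω) / H))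
      (c := C * (t - s) ^ γ * (K * H ^ β / H)) ((hum'.sub us').mul ((gs.sub hgm').div_const H))
      (by linarith) (fun r hr => L1Le.mul_of_le ((hu.holder s r).mono (by
        gcongr; rw [abs_of_nonneg (by linarith [hr.1])]; linarith [hr.2])) (by
          filter_upwards [hg.holder] with ω hω
          rw [abs_div, abs_of_pos hH0]
          gcongr
          have := hω r (r + H)
          rwa [add_sub_cancel_left, abs_of_pos hH0] at this) (by positivity))
    refine this.mono ?_
    have e : (t - s) / H ≤ 2 := by rw [div_le_iff₀ hH0]; exact hn3.le
    have e2 : H ^ β ≤ (t - s) ^ β := Real.rpow_le_rpow hH0.le hn1 hβ.le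
    calc C * (t - s) ^ γ * (K * H ^ β / H) * (t - s)
        = C * (t - s) ^ γ * (K * H ^ β) * ((t - s) / H) := by ring
      _ ≤ C * (t - s) ^ γ * (K * (t - s) ^ β) * 2 := by gcongr
      _ = _ := by rw [Real.rpow_add hts]; ring
  have := hu.rsAverage_dyadic hg hγ hβ hθ (by positivity) n h hh hn1 base
  refine this.mono ?_
  have k1 : H ^ (γ + β - 1) - h ^ (γ + β - 1) ≤ (t - s) ^ (γ + β - 1) := by
    have := Real.rpow_nonneg hh.le (γ + β - 1)
    have := Real.rpow_le_rpow hH0.le hn1 (by linarith : 0 ≤ γ + β - 1)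
    linarith
  have k2 : H ^ β - h ^ β ≤ (t - s) ^ β := by
    have := Real.rpow_nonneg hh.le β
    have := Real.rpow_le_rpow hH0.le hn1 hβ.le
    linarith
  calc _ ≤ C * K * 2 * (t - s) ^ (γ + β) + C * K * ((t - s) / 2 / (2 ^ (γ + β - 1) - 1) *
          (t - s) ^ (γ + β - 1) + (t - s) ^ γ / (2 ^ β - 1) * (t - s) ^ β) := by gcongr
    _ = _ := by
      rw [Real.rpow_sub_one hts.ne', Real.rpow_add hts]; field_simp; ring

/-- Local Young estimate in `L¹(Q)`. -/
lemma L1Holder.local_estimate (hu : L1Holder Q u B C γ) (hg : PathHolder Q g K β) (hγ : 0 < γ)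
    (hβ : 0 < β) (hθ : 1 < γ + β) {s t h ξ : ℝ} (hh : 0 < h) (hst : h ≤ t - s) (hξ : ξ ∈ Icc s t) :
    L1Le Q (fun ω => u ξ ω * (g t ω - g s ω) -
        rsAverage (fun r => u r ω) (fun r => g r ω) h s t)
      (youngConst C K γ β * (t - s) ^ (γ + β) + Q.real univ * (B * (2 * K * h ^ β))) := by
  have hC := hu.nonneg
  have hK := hg.nonneg
  have p1 := two_rpow_sub_one_pos hβ
  have p2 := two_rpow_sub_one_pos (sub_pos.2 hθ)
  have hts : 0 < t - s := by linarith
  have hum' : Measurable fun z : ℝ × Ω => u z.1 z.2 := hu.measurable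
  have hgm' : Measurable fun z : ℝ × Ω => g z.1 z.2 := hg.measurable
  have hut : ∀ a, Measurable (u a) := fun a => hu.measurable.comp measurable_prodMk_left
  have hgt : ∀ a, Measurable (g a) := fun a => hg.measurable.comp measurable_prodMk_left
  have gs : Measurable fun z : ℝ × Ω => g (z.1 + h) z.2 :=
    hg.measurable.comp ((measurable_fst.add_const h).prodMk measurable_snd)
  by_cases hne : Nonempty Ω
  swap
  · rw [not_nonempty_iff] at hne
    unfold L1Le
    simp [Measure.eq_zero_of_isEmpty Q]
  have hB : 0 ≤ B := (abs_nonneg _).trans (hu.bound 0 hne.some)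
  -- Three errors: moving the tag from `ξ` to `s`, replacing the increment of `g` by its averaged
  -- slopes against the frozen value `u_s`, and averaging `u - u_s`. Only the second depends on `h`,
  -- and it vanishes as `h ↓ 0`.
  have t1 : L1Le Q (fun ω => (u ξ ω - u s ω) * (g t ω - g s ω))
      (C * (t - s) ^ γ * (K * (t - s) ^ β)) := by
    refine L1Le.mul_of_le ((hu.holder s ξ).mono ?_) ?_ (by positivity)
    · gcongr; rw [abs_of_nonneg (by linarith [hξ.1])]; linarith [hξ.2]
    · filter_upwards [hg.holder] with ω hω
      simpa [abs_of_pos hts] using hω s t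
  have t2 : L1Le Q (fun ω => u s ω * -((∫ r in s..t, (g (r + h) ω - g r ω) / h) - (g t ω - g s ω)))
      (Q.real univ * (B * (2 * K * h ^ β))) := by
    refine L1Le.of_ae_le ?_ (by positivity)
    filter_upwards [hg.holder] with ω hω
    rw [abs_mul, abs_neg]
    gcongr
    · exact hu.bound _ _
    · exact abs_integral_slope_sub_le hβ hω hh s t
  have t3 := (hu.rsAverage_le hg hγ hβ hθ hh hst).neg
  have M1 : Measurable fun ω => (u ξ ω - u s ω) * (g t ω - g s ω) := by fun_prop
  have M2 : Measurable fun ω =>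
      u s ω * -((∫ r in s..t, (g (r + h) ω - g r ω) / h) - (g t ω - g s ω)) := by
    have := measurable_intervalIntegral_uncurry (w := fun r ω => (g (r + h) ω - g r ω) / h)
      ((gs.sub hgm').div_const h) s t
    fun_prop
  have := (t1.add t2 M1 (by positivity) (by positivity)).add t3 (M1.add M2) (by positivity)
    (by positivity)
  refine (this.congr ?_).mono (le_of_eq ?_)
  · filter_upwards [hg.holder] with ω hω
    have hc := continuous_of_abs_sub_le_rpow hβ hω
    have hsl : Continuous fun r => (g (r + h) ω - g r ω) / h := by fun_prop
    have hvi : IntervalIntegrable (fun r => u r ω) volume s t := by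
      rw [intervalIntegrable_iff]
      exact Measure.integrableOn_of_bounded (M := B) (by simp)
        (hum'.comp (measurable_id.prodMk measurable_const)).aestronglyMeasurable
        (Eventually.of_forall fun r => hu.bound r ω)
    have : rsAverage (fun r => u r ω - u s ω) (fun r => g r ω) h s t =
        rsAverage (fun r => u r ω) (fun r => g r ω) h s t -
          u s ω * ∫ r in s..t, (g (r + h) ω - g r ω) / h := by
      simp only [rsAverage]
      rw [← intervalIntegral.integral_const_mul, ← intervalIntegral.integral_sub
        (hvi.mul_continuousOn hsl.continuousOn) ((hsl.const_mul _).intervalIntegrable _ _)]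
      congr 1; ext r; ring
    rw [this]; ring
  -- The `3` in `youngConst` is the `2` from the coarsest scale plus `1` from moving the tag.
  · rw [youngConst, Real.rpow_add hts]; ring

end Young


/-! ### Convergence of Riemann-Stieltjes sums -/

/-- Fatou's lemma. -/
lemma L1Le.of_tendsto {Ω : Type*} [MeasurableSpace Ω] {Q : Measure Ω} {F : ℕ → Ω → ℝ} {G : Ω → ℝ}
    {c : ℕ → ℝ} {d : ℝ} (hF : ∀ n, Measurable (F n))
    (hFG : ∀ᵐ ω ∂Q, Tendsto (fun n => F n ω) atTop (𝓝 (G ω)))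
    (h : ∀ᶠ n in atTop, L1Le Q (F n) (c n)) (hc : Tendsto c atTop (𝓝 d)) : L1Le Q G d := by
  unfold L1Le at *
  calc ∫⁻ ω, ‖G ω‖ₑ ∂Q = ∫⁻ ω, liminf (fun n => ‖F n ω‖ₑ) atTop ∂Q := by
        refine lintegral_congr_ae ?_
        filter_upwards [hFG] with ω hω
        exact ((continuous_enorm.tendsto _).comp hω).liminf_eq.symm
    _ ≤ liminf (fun n => ∫⁻ ω, ‖F n ω‖ₑ ∂Q) atTop := lintegral_liminf_le fun n => (hF n).enorm
    _ ≤ liminf (fun n => ENNReal.ofReal (c n)) atTop := liminf_le_liminf h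
    _ = ENNReal.ofReal d := (ENNReal.tendsto_ofReal hc).liminf_eq

/-- By Tonelli the series of absolute values has finite mean, so it converges almost surely and its
terms tend to zero. -/
lemma ae_tendsto_zero_of_summable_L1Le {Ω : Type*} [MeasurableSpace Ω] {Q : Measure Ω}
    {F : ℕ → Ω → ℝ} {c : ℕ → ℝ} (hF : ∀ n, AEMeasurable (F n) Q) (h : ∀ n, L1Le Q (F n) (c n))
    (hc0 : ∀ n, 0 ≤ c n) (hc : Summable c) : ∀ᵐ ω ∂Q, Tendsto (fun n => F n ω) atTop (𝓝 0) := by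
  have hfin : ∫⁻ ω, ∑' n, ‖F n ω‖ₑ ∂Q ≠ ∞ := by
    rw [lintegral_tsum fun n => (hF n).enorm]
    refine ne_top_of_le_ne_top ?_ (ENNReal.tsum_le_tsum h)
    rw [← ENNReal.ofReal_tsum_of_nonneg hc0 hc]
    exact ENNReal.ofReal_ne_top
  have hm : AEMeasurable (fun ω => ∑' n, ‖F n ω‖ₑ) Q := AEMeasurable.tsum fun n => (hF n).enorm
  filter_upwards [ae_lt_top' hm hfin] with ω hω
  have := ENNReal.tendsto_atTop_zero_of_tsum_ne_top hω.ne
  rw [tendsto_zero_iff_norm_tendsto_zero]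
  have h2 := (ENNReal.tendsto_toReal ENNReal.zero_ne_top).comp this
  simpa [Function.comp_def] using h2

lemma sum_integral_fin {f : ℝ → ℝ} (hf : ∀ a b, IntervalIntegrable f volume a b) :
    ∀ (k : ℕ) (t : Fin (k + 1) → ℝ),
      ∑ i : Fin k, ∫ r in (t i.castSucc)..(t i.succ), f r = ∫ r in (t 0)..(t (Fin.last k)), f r
  | 0, t => by simp
  | k + 1, t => by
    rw [Fin.sum_univ_castSucc]
    have := sum_integral_fin hf k (fun i => t i.castSucc)
    simp only [Fin.succ_castSucc, Fin.castSucc_zero] at this ⊢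
    rw [this, Fin.succ_last, intervalIntegral.integral_add_adjacent_intervals (hf _ _) (hf _ _)]

namespace TaggedPartition

variable {T : ℝ} (π : TaggedPartition T)

lemma gap_pos (i : Fin π.k) : 0 < π.t i.succ - π.t i.castSucc :=
  sub_pos.2 (π.t_strictMono Fin.castSucc_lt_succ)

lemma gap_le_mesh (i : Fin π.k) : π.t i.succ - π.t i.castSucc ≤ π.mesh :=
  le_ciSup (f := fun i : Fin π.k => π.t i.succ - π.t i.castSucc) (Set.finite_range _).bddAbove i

lemma mesh_nonneg : 0 ≤ π.mesh := Real.iSup_nonneg fun i => (π.gap_pos i).le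

lemma sum_gap : ∑ i : Fin π.k, (π.t i.succ - π.t i.castSucc) = T := by
  have := sum_integral_fin (f := fun _ => (1 : ℝ)) (fun a b => by simp) π.k π.t
  simpa [π.t_zero, π.t_last] using this

lemma mesh_pos (hT : 0 < T) : 0 < π.mesh := by
  rcases Nat.eq_zero_or_pos π.k with hk | hk
  · have := π.sum_gap
    have hE : IsEmpty (Fin π.k) := by rw [hk]; infer_instance
    rw [Finset.univ_eq_empty, Finset.sum_empty] at this
    exact absurd this hT.ne
  · exact (π.gap_pos ⟨0, hk⟩).trans_le (π.gap_le_mesh _)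

lemma t_mem_Icc (i : Fin (π.k + 1)) : π.t i ∈ Icc 0 T :=
  ⟨π.t_zero.symm.le.trans (π.t_strictMono.monotone (Fin.zero_le i)),
    (π.t_strictMono.monotone (Fin.le_last i)).trans π.t_last.le⟩

lemma ξ_mem_Icc (i : Fin π.k) : π.ξ i ∈ Icc 0 T :=
  ⟨(π.t_mem_Icc _).1.trans (π.tag_mem i).1, (π.tag_mem i).2.trans (π.t_mem_Icc _).2⟩

lemma mesh_le (hT : 0 < T) : π.mesh ≤ T := by
  refine Real.iSup_le (fun i => ?_) hT.le
  linarith [(π.t_mem_Icc i.succ).2, (π.t_mem_Icc i.castSucc).1]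

lemma rsSum_congr {f f' g g' : ℝ → ℝ} (hf : EqOn f f' (Icc 0 T)) (hg : EqOn g g' (Icc 0 T)) :
    π.rsSum f g = π.rsSum f' g' := by
  unfold rsSum
  refine Finset.sum_congr rfl fun i _ => ?_
  rw [hf (π.ξ_mem_Icc i), hg (π.t_mem_Icc _), hg (π.t_mem_Icc _)]

lemma sum_gap_rpow_le {θ : ℝ} (hθ : 1 < θ) :
    ∑ i : Fin π.k, (π.t i.succ - π.t i.castSucc) ^ θ ≤ T * π.mesh ^ (θ - 1) := by
  have e : T * π.mesh ^ (θ - 1) =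
      ∑ i : Fin π.k, (π.t i.succ - π.t i.castSucc) * π.mesh ^ (θ - 1) := by
    rw [← Finset.sum_mul, π.sum_gap]
  rw [e]
  refine Finset.sum_le_sum fun i _ => ?_
  have h := π.gap_pos i
  calc (π.t i.succ - π.t i.castSucc) ^ θ
      = (π.t i.succ - π.t i.castSucc) * (π.t i.succ - π.t i.castSucc) ^ (θ - 1) := by
        rw [Real.rpow_sub_one h.ne']; field_simp
    _ ≤ _ := by
      gcongr
      exact π.gap_le_mesh i

lemma measurable_rsSum {Ω : Type*} [MeasurableSpace Ω] {u g : ℝ → Ω → ℝ}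
    (hu : ∀ t ∈ Icc 0 T, Measurable (u t)) (hg : ∀ t ∈ Icc 0 T, Measurable (g t)) :
    Measurable fun ω => π.rsSum (fun t => u t ω) (fun t => g t ω) := by
  refine Finset.measurable_sum _ fun i _ => ?_
  exact (hu _ (π.ξ_mem_Icc i)).mul ((hg _ (π.t_mem_Icc _)).sub (hg _ (π.t_mem_Icc _)))

end TaggedPartition

/-- Rate of convergence of Riemann-Stieltjes sums in `L¹(Q)`. -/
theorem L1Holder.rsSum_sub_le {Ω : Type*} [MeasurableSpace Ω] {Q : Measure Ω} [IsFiniteMeasure Q]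
    {u g : ℝ → Ω → ℝ} {B C K γ β T : ℝ} (hu : L1Holder Q u B C γ) (hg : PathHolder Q g K β)
    (hγ : 0 < γ) (hβ : 0 < β) (hθ : 1 < γ + β) {J : Ω → ℝ}
    (hJ : ∀ᵐ ω ∂Q, Tendsto (fun h => rsAverage (fun r => u r ω) (fun r => g r ω) h 0 T) (𝓝[>] 0)
      (𝓝 (J ω))) (π : TaggedPartition T) :
    L1Le Q (fun ω => π.rsSum (fun r => u r ω) (fun r => g r ω) - J ω)
      (youngConst C K γ β * T * π.mesh ^ (γ + β - 1)) := by
  have hC := hu.nonneg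
  have hK := hg.nonneg
  have hy := youngConst_nonneg hC hK hβ hθ
  by_cases hne : Nonempty Ω
  swap
  · rw [not_nonempty_iff] at hne
    unfold L1Le
    simp [Measure.eq_zero_of_isEmpty Q]
  have hB : 0 ≤ B := (abs_nonneg _).trans (hu.bound 0 hne.some)
  have hut : ∀ a, Measurable (u a) := fun a => hu.measurable.comp measurable_prodMk_left
  have hgt : ∀ a, Measurable (g a) := fun a => hg.measurable.comp measurable_prodMk_left
  set e : ℕ → ℝ := fun n => 1 / ((n : ℝ) + 1) with he
  have he0 : ∀ n, 0 < e n := fun n => Nat.one_div_pos_of_nat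
  have hlim0 : Tendsto e atTop (𝓝 0) := tendsto_one_div_add_atTop_nhds_zero_nat
  have hlim : Tendsto e atTop (𝓝[>] 0) :=
    tendsto_nhdsWithin_iff.2 ⟨hlim0, Eventually.of_forall he0⟩
  -- The partition is fixed while the averaging step shrinks: once it is below every gap, the local
  -- estimate applies on each interval. Averages are additive over intervals, the terms `e n ^ β`
  -- disappear in the limit, and Fatou transfers the bound to `J`.
  have hev : ∀ᶠ n in atTop, ∀ i : Fin π.k, e n ≤ π.t i.succ - π.t i.castSucc := by
    rw [eventually_all]
    intro i
    filter_upwards [hlim0.eventually (gt_mem_nhds (π.gap_pos i))] with n hn using hn.le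
  set c : ℕ → ℝ := fun n => ∑ i : Fin π.k,
    (youngConst C K γ β * (π.t i.succ - π.t i.castSucc) ^ (γ + β) +
      Q.real univ * (B * (2 * K * e n ^ β))) with hc
  have hclim : Tendsto c atTop
      (𝓝 (∑ i : Fin π.k, youngConst C K γ β * (π.t i.succ - π.t i.castSucc) ^ (γ + β))) := by
    refine tendsto_finsetSum _ fun i _ => ?_
    have h1 : Tendsto (fun n => e n ^ β) atTop (𝓝 0) := by
      have := hlim0.rpow_const (p := β) (Or.inr hβ.le)
      rwa [Real.zero_rpow hβ.ne'] at this
    have h2 := (((h1.const_mul (2 * K)).const_mul B).const_mul (Q.real univ)).const_add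
      (youngConst C K γ β * (π.t i.succ - π.t i.castSucc) ^ (γ + β))
    simpa using h2
  have main : L1Le Q (fun ω => π.rsSum (fun r => u r ω) (fun r => g r ω) - J ω)
      (∑ i : Fin π.k, youngConst C K γ β * (π.t i.succ - π.t i.castSucc) ^ (γ + β)) := by
    refine L1Le.of_tendsto (F := fun n ω => π.rsSum (fun r => u r ω) (fun r => g r ω) -
      rsAverage (fun r => u r ω) (fun r => g r ω) (e n) 0 T) (fun n => ?_) ?_ ?_ hclim
    · exact (π.measurable_rsSum (fun t _ => hut t) (fun t _ => hgt t)).sub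
        (measurable_rsAverage hu.measurable hg.measurable _ _ _)
    · filter_upwards [hJ] with ω hω
      exact tendsto_const_nhds.sub (hω.comp hlim)
    · filter_upwards [hev] with n hn
      have hi : ∀ i ∈ Finset.univ, L1Le Q (fun ω => u (π.ξ i) ω *
          (g (π.t i.succ) ω - g (π.t i.castSucc) ω) -
          rsAverage (fun r => u r ω) (fun r => g r ω) (e n) (π.t i.castSucc) (π.t i.succ))
          (youngConst C K γ β * (π.t i.succ - π.t i.castSucc) ^ (γ + β) +
            Q.real univ * (B * (2 * K * e n ^ β))) :=
        fun i _ => hu.local_estimate hg hγ hβ hθ (he0 n) (hn i) (π.tag_mem i)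
      refine (L1Le.sum Finset.univ hi (fun i _ => ?_) (fun i _ => ?_)).congr ?_
      · exact ((hut _).mul ((hgt _).sub (hgt _))).sub
          (measurable_rsAverage hu.measurable hg.measurable _ _ _)
      · have := (π.gap_pos i).le
        have := (he0 n).le
        positivity
      · filter_upwards [hg.holder] with ω hω
        rw [Finset.sum_sub_distrib]
        congr 1
        have hc := continuous_of_abs_sub_le_rpow hβ hω
        have hsl : Continuous fun r => (g (r + e n) ω - g r ω) / e n := by fun_prop
        have hvi : ∀ a b, IntervalIntegrable (fun r => u r ω) volume a b := fun a b => by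
          rw [intervalIntegrable_iff]
          exact Measure.integrableOn_of_bounded (M := B) (by simp)
            (hu.measurable.comp (measurable_id.prodMk measurable_const)).aestronglyMeasurable
            (Eventually.of_forall fun r => hu.bound r ω)
        have := sum_integral_fin (fun a b => (hvi a b).mul_continuousOn hsl.continuousOn) π.k π.t
        rw [π.t_zero, π.t_last] at this
        exact this.symm
  refine main.mono ?_
  rw [← Finset.mul_sum, mul_assoc]
  gcongr
  exact π.sum_gap_rpow_le hθ

/-- Pathwise convergence of Riemann-Stieltjes sums of Hölder functions. -/
theorem tendsto_rsSum_of_holder {u g : ℝ → ℝ} {B C K γ β T : ℝ}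
    (hB : ∀ t, |u t| ≤ B) (hu : ∀ s t, |u t - u s| ≤ C * |t - s| ^ γ)
    (hg : ∀ s t, |g t - g s| ≤ K * |t - s| ^ β) (hγ : 0 < γ) (hβ : 0 < β) (hθ : 1 < γ + β) {J : ℝ}
    (hJ : Tendsto (fun h => rsAverage u g h 0 T) (𝓝[>] 0) (𝓝 J)) (π : ℕ → TaggedPartition T)
    (hπ : Tendsto (fun n => (π n).mesh) atTop (𝓝 0)) :
    Tendsto (fun n => (π n).rsSum u g) atTop (𝓝 J) := by
  have nn : ∀ {v : ℝ → ℝ} {D η : ℝ}, (∀ s t, |v t - v s| ≤ D * |t - s| ^ η) → 0 ≤ D := by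
    intro v D η h
    have := (abs_nonneg _).trans (h 0 1); simpa using this
  have hum : Measurable u := (continuous_of_abs_sub_le_rpow hγ hu).measurable
  have hgm : Measurable g := (continuous_of_abs_sub_le_rpow hβ hg).measurable
  -- A deterministic function is a process on a one-point probability space, so the estimate in mean
  -- becomes a pathwise one.
  have H1 : L1Holder (Measure.dirac ()) (fun t (_ : Unit) => u t) B C γ :=
    { measurable := hum.comp measurable_fst
      bound := fun t _ => hB t
      nonneg := nn hu
      holder := fun s t => by
        unfold L1Le
        simp only [lintegral_const, measure_univ, mul_one]
        rw [← ofReal_norm]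
        exact ENNReal.ofReal_le_ofReal (hu s t) }
  have H2 : PathHolder (Measure.dirac ()) (fun t (_ : Unit) => g t) K β :=
    { measurable := hgm.comp measurable_fst
      nonneg := nn hg
      holder := Eventually.of_forall fun _ => hg }
  have key : ∀ n, |(π n).rsSum u g - J| ≤ youngConst C K γ β * T * (π n).mesh ^ (γ + β - 1) := by
    intro n
    have := H1.rsSum_sub_le H2 hγ hβ hθ (J := fun _ => J) (Eventually.of_forall fun _ => hJ) (π n)
    unfold L1Le at this
    simp only [lintegral_const, measure_univ, mul_one] at this
    rw [← ofReal_norm, ENNReal.ofReal_le_ofReal_iff'] at this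
    rcases this with h | h
    · exact h
    · rw [← Real.norm_eq_abs]
      refine h.trans ?_
      have := youngConst_nonneg (nn hu) (nn hg) hβ hθ
      have hT0 : 0 ≤ T := ((π n).t_mem_Icc 0).1.trans ((π n).t_mem_Icc 0).2
      have := (π n).mesh_nonneg
      positivity
  rw [tendsto_iff_norm_sub_tendsto_zero]
  refine squeeze_zero (fun _ => norm_nonneg _) key ?_
  have := (hπ.rpow_const (p := γ + β - 1) (Or.inr (by linarith))).const_mul (youngConst C K γ β * T)
  rwa [Real.zero_rpow (by linarith), mul_zero] at this


/-! ### Functions of bounded variation and their increments -/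

/-- Truncation of a real number to `[-a, a]`. -/
def clampAbs (a x : ℝ) : ℝ := max (-a) (min x a)

lemma monotone_clampAbs (a : ℝ) : Monotone (clampAbs a) := fun x y h => by
  unfold clampAbs; gcongr

lemma clampAbs_mem {a : ℝ} (ha : 0 ≤ a) (x : ℝ) : clampAbs a x ∈ Icc (-a) a :=
  ⟨le_max_left _ _, max_le (by linarith) (min_le_right _ _)⟩

lemma clampAbs_of_mem {a x : ℝ} (hx : x ∈ Icc (-a) a) : clampAbs a x = x := by
  rw [clampAbs, min_eq_left hx.2, max_eq_right hx.1]

lemma abs_clampAbs_sub_le (a x y : ℝ) : |clampAbs a x - clampAbs a y| ≤ |x - y| := by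
  unfold clampAbs
  exact (abs_max_sub_max_le_max _ _ _ _).trans (max_le (by simp) (abs_min_sub_min_le_max _ _ _ _ |>.trans (by simp)))

/-- The part of `f` that is not seen by its truncation to `[-c, c]`, restricted to `[-R, R]`. -/
def outerPart (f : ℝ → ℝ) (c R x : ℝ) : ℝ := f (clampAbs R x) - f (clampAbs c (clampAbs R x))

/-- The difference is the growth of `p` above `c` plus the (negative) growth below `-c`, each of
which is monotone. -/
lemma monotone_sub_clampAbs {p : ℝ → ℝ} (hp : Monotone p) {c : ℝ} (hc : 0 ≤ c) :
    Monotone fun x => p x - p (clampAbs c x) := by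
  have e : (fun x => p x - p (clampAbs c x)) =
      fun x => (p (max x c) - p c) + (p (min x (-c)) - p (-c)) := by
    ext x
    unfold clampAbs
    rcases le_total x (-c) with h | h
    · rw [max_eq_right (h.trans (by linarith)), min_eq_left h, min_eq_left (h.trans (by linarith)),
        max_eq_left h]; ring
    · rcases le_total x c with h' | h'
      · rw [max_eq_right h', min_eq_right h, min_eq_left h', max_eq_right h]; ring
      · rw [max_eq_left h', min_eq_right h, min_eq_right h', max_eq_right (by linarith)]; ring
  rw [e]
  exact ((hp.comp (monotone_id.max monotone_const)).add_const _).add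
    ((hp.comp (monotone_id.min monotone_const)).add_const _)

/-- Write `f = p - q` by Jordan decomposition, remove from both parts what happens on `[-c, c]`, and
add them. The sum is flat on `[-c, c]`, so no density bound will be needed there; truncation to
`[-R, R]` makes its total growth finite. -/
lemma exists_monotone_majorant_outerPart {f : ℝ → ℝ} (hf : LocallyBoundedVariationOn f univ)
    {c R : ℝ} (hc0 : 0 ≤ c) (hR : 0 ≤ R) :
    ∃ m : ℝ → ℝ, Monotone m ∧ (∃ V, 0 ≤ V ∧ ∀ a b, m a - m b ≤ V) ∧
      (∀ a b, |outerPart f c R a - outerPart f c R b| ≤ |m a - m b|) ∧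
      ∀ a ∈ Icc (-c) c, ∀ b ∈ Icc (-c) c, m a = m b := by
  obtain ⟨p, q, hp, hq, hpq⟩ := hf.exists_monotoneOn_sub_monotoneOn
  rw [monotoneOn_univ] at hp hq
  have hp1 := monotone_sub_clampAbs hp hc0
  have hq1 := monotone_sub_clampAbs hq hc0
  set p₁ : ℝ → ℝ := fun x => p x - p (clampAbs c x) with hp₁
  set q₁ : ℝ → ℝ := fun x => q x - q (clampAbs c x) with hq₁
  set m₀ : ℝ → ℝ := fun x => p₁ x + q₁ x with hm₀
  have hmono : Monotone m₀ := hp1.add hq1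
  have hle' : ∀ a b, |(f a - f (clampAbs c a)) - (f b - f (clampAbs c b))| ≤ |m₀ a - m₀ b| := by
    have key : ∀ a b, a ≤ b →
        |(f b - f (clampAbs c b)) - (f a - f (clampAbs c a))| ≤ |m₀ b - m₀ a| := by
      intro a b hab
      have h1 := hp1 hab
      have h2 := hq1 hab
      have e : (f b - f (clampAbs c b)) - (f a - f (clampAbs c a)) =
          (p₁ b - p₁ a) - (q₁ b - q₁ a) := by
        simp only [hpq, hp₁, hq₁, Pi.sub_apply]; ring
      have h3 := hmono hab
      rw [e, abs_of_nonneg (sub_nonneg.2 h3), abs_le]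
      simp only [hm₀]
      constructor <;> linarith
    intro a b
    rcases le_total a b with h | h
    · rw [abs_sub_comm, abs_sub_comm (m₀ a)]; exact key a b h
    · exact key b a h
  have hconst : ∀ a ∈ Icc (-c) c, m₀ a = 0 := by
    intro a ha
    simp only [hm₀, hp₁, hq₁, clampAbs_of_mem ha, sub_self, add_zero]
  refine ⟨fun x => m₀ (clampAbs R x), hmono.comp (monotone_clampAbs R), ⟨m₀ R - m₀ (-R),
    sub_nonneg.2 (hmono (by linarith)), fun a b => ?_⟩, fun a b => hle' _ _, fun a ha b hb => ?_⟩
  · exact sub_le_sub (hmono (clampAbs_mem hR a).2) (hmono (clampAbs_mem hR b).1)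
  · have hc : ∀ x ∈ Icc (-c) c, clampAbs R x ∈ Icc (-c) c := by
      intro x hx
      unfold clampAbs
      refine ⟨le_max_of_le_right (le_min hx.1 (by linarith)), max_le (by linarith) ((min_le_left _ _).trans hx.2)⟩
    simp only [hconst _ (hc a ha), hconst _ (hc b hb)]

/-- On `[-n, n]` shifted integrals of `m` telescope to `∫ (m(x) - m(x - 2n))` over an interval of
length `2η`, which is at most `2ηV`; then `n → ∞`. -/
lemma lintegral_monotone_increment_le {m : ℝ → ℝ} (hm : Monotone m) {V η : ℝ}
    (hV : ∀ a b, m a - m b ≤ V) (hη : 0 ≤ η) :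
    ∫⁻ y, ENNReal.ofReal (m (y + η) - m (y - η)) ≤ ENNReal.ofReal (2 * η * V) := by
  have hii : ∀ a b, IntervalIntegrable m volume a b := fun a b => hm.intervalIntegrable
  have hp : Monotone fun y => m (y + η) := fun a b h => hm (by linarith)
  have hq : Monotone fun y => m (y - η) := fun a b h => hm (by linarith)
  have hcov : AECover volume atTop fun n : ℕ => Ioc (-(n : ℝ)) n :=
    aecover_Ioc (tendsto_neg_atTop_atBot.comp tendsto_natCast_atTop_atTop)
      tendsto_natCast_atTop_atTop
  have hmeas : AEMeasurable (fun y => ENNReal.ofReal (m (y + η) - m (y - η))) volume :=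
    (hp.measurable.sub hq.measurable).ennreal_ofReal.aemeasurable
  refine le_of_tendsto (hcov.lintegral_tendsto_of_countably_generated hmeas) (Eventually.of_forall fun n => ?_)
  have hn : -(n : ℝ) ≤ n := by have : (0 : ℝ) ≤ n := n.cast_nonneg; linarith
  have hi : IntervalIntegrable (fun y => m (y + η) - m (y - η)) volume (-(n : ℝ)) n :=
    hp.intervalIntegrable.sub hq.intervalIntegrable
  rw [intervalIntegrable_iff_integrableOn_Ioc_of_le hn] at hi
  rw [← ofReal_integral_eq_lintegral_ofReal hi
    (Eventually.of_forall fun y => sub_nonneg.2 (hm (by linarith)))]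
  apply ENNReal.ofReal_le_ofReal
  rw [← intervalIntegral.integral_of_le hn, intervalIntegral.integral_sub hp.intervalIntegrable
    hq.intervalIntegrable, intervalIntegral.integral_comp_add_right,
    intervalIntegral.integral_comp_sub_right]
  have e : (∫ x in (-(n : ℝ) + η)..(n + η), m x) - ∫ x in (-(n : ℝ) - η)..(n - η), m x =
      ∫ x in (n - η)..(n + η), (m x - m (x - 2 * n)) := by
    have hr : Monotone fun y => m (y - 2 * n) := fun a b h => hm (by linarith)
    rw [intervalIntegral.integral_sub (hii _ _) hr.intervalIntegrable,
      intervalIntegral.integral_comp_sub_right]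
    have a1 := intervalIntegral.integral_add_adjacent_intervals (hii (-n + η) (n - η))
      (hii (n - η) (n + η))
    have a2 := intervalIntegral.integral_add_adjacent_intervals (hii (-n - η) (-n + η))
      (hii (-n + η) (n - η))
    rw [show (n : ℝ) - η - 2 * n = -n - η by ring, show (n : ℝ) + η - 2 * n = -n + η by ring]
    linarith
  rw [e]
  have hr : Monotone fun y => m (y - 2 * n) := fun a b h => hm (by linarith)
  have := intervalIntegral.integral_mono_on (a := n - η) (b := n + η) (μ := volume) (by linarith)
    ((hii _ _).sub hr.intervalIntegrable) (intervalIntegrable_const (c := V))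
    (fun x _ => hV x (x - 2 * n))
  refine this.trans (le_of_eq ?_)
  rw [intervalIntegral.integral_const, smul_eq_mul]; ring

/-! ### Increments in mean under a density bound -/

section Probability

variable {Ω : Type*} [MeasurableSpace Ω] {P : Measure Ω} {Z Z' : Ω → ℝ} {q h m : ℝ → ℝ}
  {V c₀ η η₀ δ lam C ℓ : ℝ}

lemma IsDensityOf.lintegral_comp (hq : IsDensityOf P Z q) (hZ : Measurable Z) {G : ℝ → ℝ≥0∞}
    (hG : Measurable G) : ∫⁻ ω, G (Z ω) ∂P = ∫⁻ y, ENNReal.ofReal (q y) * G y := by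
  rw [← lintegral_map hG hZ, hq.2.2, lintegral_withDensity_eq_lintegral_mul _ hq.1.ennreal_ofReal hG]
  rfl

/-- If `|Z' - Z| < η`, both values lie within `η` of `Z`, so the increment is at most `m(Z+η) -
m(Z-η)`, whose mean is controlled by the density of `Z` alone. Otherwise it is at most `V`. The
density is needed only at points near which `m` varies. -/
lemma lintegral_increment_le (hZ : Measurable Z) (hZ' : Measurable Z') (hq : IsDensityOf P Z q)
    (hm : Monotone m) (hV : ∀ a b, m a - m b ≤ V) (hhm : ∀ a b, |h a - h b| ≤ |m a - m b|)
    (hη : 0 ≤ η) (hc₀ : 0 ≤ c₀) (hqc : ∀ y, m (y - η) < m (y + η) → q y ≤ c₀) :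
    ∫⁻ ω, ‖h (Z' ω) - h (Z ω)‖ₑ ∂P ≤
      ENNReal.ofReal (c₀ * (2 * η * V)) + ENNReal.ofReal V * P {ω | η ≤ |Z' ω - Z ω|} := by
  have hG : Measurable fun y => ENNReal.ofReal (m (y + η) - m (y - η)) :=
    ((hm.measurable.comp (measurable_id.add_const η)).sub
      (hm.measurable.comp (measurable_id.sub_const η))).ennreal_ofReal
  have hset : MeasurableSet {ω | η ≤ |Z' ω - Z ω|} :=
    measurableSet_le measurable_const (by fun_prop)
  have hpt : ∀ ω, ‖h (Z' ω) - h (Z ω)‖ₑ ≤ ENNReal.ofReal (m (Z ω + η) - m (Z ω - η)) +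
      {ω | η ≤ |Z' ω - Z ω|}.indicator (fun _ => ENNReal.ofReal V) ω := by
    intro ω
    rw [← ofReal_norm, Real.norm_eq_abs]
    by_cases hω : η ≤ |Z' ω - Z ω|
    · rw [indicator_of_mem (show ω ∈ {ω | η ≤ |Z' ω - Z ω|} from hω)]
      refine le_add_left (ENNReal.ofReal_le_ofReal ((hhm _ _).trans ?_))
      exact abs_le.2 ⟨by linarith [hV (Z ω) (Z' ω)], hV _ _⟩
    · rw [indicator_of_notMem (show ω ∉ {ω | η ≤ |Z' ω - Z ω|} from hω), add_zero]
      have := abs_lt.1 (not_le.1 hω)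
      have m1 : m (Z' ω) ≤ m (Z ω + η) := hm (by linarith)
      have m2 : m (Z ω - η) ≤ m (Z' ω) := hm (by linarith)
      have m3 : m (Z ω) ≤ m (Z ω + η) := hm (by linarith)
      have m4 : m (Z ω - η) ≤ m (Z ω) := hm (by linarith)
      exact ENNReal.ofReal_le_ofReal ((hhm _ _).trans (abs_le.2 ⟨by linarith, by linarith⟩))
  calc ∫⁻ ω, ‖h (Z' ω) - h (Z ω)‖ₑ ∂P ≤ ∫⁻ ω, (ENNReal.ofReal (m (Z ω + η) - m (Z ω - η)) +
      {ω | η ≤ |Z' ω - Z ω|}.indicator (fun _ => ENNReal.ofReal V) ω) ∂P := lintegral_mono hpt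
    _ = (∫⁻ y, ENNReal.ofReal (q y) * ENNReal.ofReal (m (y + η) - m (y - η))) +
        ENNReal.ofReal V * P {ω | η ≤ |Z' ω - Z ω|} := by
      rw [← hq.lintegral_comp hZ hG, ← lintegral_indicator_const hset]
      exact lintegral_add_left (hG.comp hZ) _
    _ ≤ (∫⁻ y, ENNReal.ofReal c₀ * ENNReal.ofReal (m (y + η) - m (y - η))) +
        ENNReal.ofReal V * P {ω | η ≤ |Z' ω - Z ω|} := by
      gcongr ?_ + _
      refine lintegral_mono fun y => ?_
      by_cases hy : m (y - η) < m (y + η)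
      · simp only; gcongr; exact hqc y hy
      · simp only; rw [ENNReal.ofReal_of_nonpos (by linarith : m (y + η) - m (y - η) ≤ 0)]; simp
    _ ≤ _ := by
      rw [lintegral_const_mul _ hG, ENNReal.ofReal_mul hc₀]
      gcongr
      exact lintegral_monotone_increment_le hm hV hη

/-- Markov bounds the probability of a large increment by `C ℓ^λ / η^δ`; the choice `η =
ℓ^(λ/(1+δ))` makes this equal to `C η`, balancing it with the density term. When `η > η₀` the
trivial bound `V ≤ (V/η₀) η` suffices. -/
lemma L1Le_increment [IsProbabilityMeasure P] (hZ : Measurable Z) (hZ' : Measurable Z')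
    (hq : IsDensityOf P Z q) (hm : Monotone m) (hV0 : 0 ≤ V) (hV : ∀ a b, m a - m b ≤ V)
    (hhm : ∀ a b, |h a - h b| ≤ |m a - m b|) (hη₀ : 0 < η₀) (hc₀ : 0 ≤ c₀)
    (hqc : ∀ η ≤ η₀, ∀ y, m (y - η) < m (y + η) → q y ≤ c₀) (hδ : 0 < δ) (hC : 0 ≤ C)
    (hℓ : 0 < ℓ)
    (hmom : ∫⁻ ω, ENNReal.ofReal (|Z' ω - Z ω| ^ δ) ∂P ≤ ENNReal.ofReal (C * ℓ ^ lam)) :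
    L1Le P (fun ω => h (Z' ω) - h (Z ω)) ((c₀ * (2 * V) + V * C + V / η₀) * ℓ ^ (lam / (1 + δ))) := by
  set η := ℓ ^ (lam / (1 + δ)) with hη
  have hη0 : 0 < η := Real.rpow_pos_of_pos hℓ _
  by_cases hle : η ≤ η₀
  · have h1 := lintegral_increment_le hZ hZ' hq hm hV hhm hη0.le hc₀ (hqc η hle)
    have hηδ : 0 < η ^ δ := Real.rpow_pos_of_pos hη0 _
    have hmarkov : P {ω | η ≤ |Z' ω - Z ω|} ≤ ENNReal.ofReal (C * η) := by
      have h2 := mul_meas_ge_le_lintegral (μ := P) (f := fun ω => ENNReal.ofReal (|Z' ω - Z ω| ^ δ))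
        (by fun_prop) (ENNReal.ofReal (η ^ δ))
      have hsub : {ω | η ≤ |Z' ω - Z ω|} ⊆
          {ω | ENNReal.ofReal (η ^ δ) ≤ ENNReal.ofReal (|Z' ω - Z ω| ^ δ)} := fun ω hω =>
        ENNReal.ofReal_le_ofReal (Real.rpow_le_rpow hη0.le hω hδ.le)
      have h3 : ENNReal.ofReal (η ^ δ) * P {ω | η ≤ |Z' ω - Z ω|} ≤
          ENNReal.ofReal (η ^ δ) * ENNReal.ofReal (C * η) := by
        refine ((mul_le_mul_right (measure_mono hsub) _).trans h2).trans (hmom.trans (le_of_eq ?_))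
        rw [← ENNReal.ofReal_mul hηδ.le]
        congr 1
        have : η ^ δ * η = ℓ ^ lam := by
          rw [← Real.rpow_add_one hη0.ne', hη, ← Real.rpow_mul hℓ.le]
          congr 1; field_simp; ring
        rw [← this]; ring
      exact (ENNReal.mul_le_mul_iff_right (ENNReal.ofReal_pos.2 hηδ).ne' ENNReal.ofReal_ne_top).1 h3
    unfold L1Le
    calc ∫⁻ ω, ‖h (Z' ω) - h (Z ω)‖ₑ ∂P ≤ ENNReal.ofReal (c₀ * (2 * η * V)) +
          ENNReal.ofReal V * ENNReal.ofReal (C * η) := h1.trans (by gcongr)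
      _ = ENNReal.ofReal (c₀ * (2 * η * V) + V * (C * η)) := by
        rw [← ENNReal.ofReal_mul hV0, ← ENNReal.ofReal_add (by positivity) (by positivity)]
      _ ≤ _ := by
        apply ENNReal.ofReal_le_ofReal
        have : 0 ≤ V / η₀ * η := by positivity
        linarith
  · have h1 : L1Le P (fun ω => h (Z' ω) - h (Z ω)) (P.real univ * V) :=
      L1Le.of_ae_le (Eventually.of_forall fun ω => (hhm _ _).trans
        (abs_le.2 ⟨by linarith [hV (Z ω) (Z' ω)], hV _ _⟩)) hV0
    refine h1.mono ?_
    rw [probReal_univ, one_mul]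
    have h2 : V ≤ V / η₀ * η := by
      rw [div_mul_eq_mul_div, le_div_iff₀ hη₀]
      exact mul_le_mul_of_nonneg_left (not_le.1 hle).le hV0
    have : 0 ≤ (c₀ * (2 * V) + V * C) * η := by positivity
    linarith

lemma IsDensityOf.measure_eq (hq : IsDensityOf P Z q) (hZ : Measurable Z) (x : ℝ) :
    P {ω | Z ω = x} = 0 := by
  have : P {ω | Z ω = x} = P.map Z {x} := by
    rw [Measure.map_apply hZ (measurableSet_singleton x)]; rfl
  rw [this, hq.2.2]
  exact withDensity_absolutelyContinuous _ _ (Real.volume_singleton)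

/-- A random variable that is close to random variables with density bounded near `x` has no atom
at `x`. -/
lemma measure_eq_le [IsProbabilityMeasure P] (hZ : Measurable Z) (hZ' : Measurable Z')
    (hq : IsDensityOf P Z q) {x : ℝ} (hη₀ : 0 < η₀) (hc₀ : 0 ≤ c₀)
    (hqc : ∀ y, |y - x| ≤ η₀ → q y ≤ c₀) (hδ : 0 < δ) (hC : 0 ≤ C) (hℓ : 0 < ℓ)
    (hmom : ∫⁻ ω, ENNReal.ofReal (|Z' ω - Z ω| ^ δ) ∂P ≤ ENNReal.ofReal (C * ℓ ^ lam)) :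
    P {ω | Z' ω = x} ≤ ENNReal.ofReal (2 * (c₀ * 2 + C + 1 / η₀) * ℓ ^ (lam / (1 + δ))) := by
  -- The jumps of `m₁` and `m₂` lie just before and just after `x`. If `Z' = x` and `Z ≠ x`, one of
  -- the two changes by one between `Z` and `Z'`: `m₁` when `Z < x`, `m₂` when `Z > x`. Hence the
  -- two increments in mean dominate the atom.
  set m₁ : ℝ → ℝ := (Ici x).indicator fun _ => 1 with hm₁
  set m₂ : ℝ → ℝ := (Ioi x).indicator fun _ => 1 with hm₂
  have mono1 : Monotone m₁ := fun a b hab => by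
    simp only [hm₁, indicator, mem_Ici]; split_ifs <;> linarith
  have mono2 : Monotone m₂ := fun a b hab => by
    simp only [hm₂, indicator, mem_Ioi]; split_ifs <;> linarith
  have v1 : ∀ a b, m₁ a - m₁ b ≤ 1 := fun a b => by
    simp only [hm₁, indicator]; split_ifs <;> norm_num
  have v2 : ∀ a b, m₂ a - m₂ b ≤ 1 := fun a b => by
    simp only [hm₂, indicator]; split_ifs <;> norm_num
  have q1 : ∀ η ≤ η₀, ∀ y, m₁ (y - η) < m₁ (y + η) → q y ≤ c₀ := by
    intro η hη y hy
    refine hqc y (abs_le.2 ?_)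
    simp only [hm₁, indicator, mem_Ici] at hy
    split_ifs at hy <;> (constructor <;> linarith)
  have q2 : ∀ η ≤ η₀, ∀ y, m₂ (y - η) < m₂ (y + η) → q y ≤ c₀ := by
    intro η hη y hy
    refine hqc y (abs_le.2 ?_)
    simp only [hm₂, indicator, mem_Ioi] at hy
    split_ifs at hy <;> (constructor <;> linarith)
  have L1 := L1Le_increment hZ hZ' hq mono1 zero_le_one v1 (fun a b => le_rfl) hη₀ hc₀ q1 hδ hC hℓ hmom
  have L2 := L1Le_increment hZ hZ' hq mono2 zero_le_one v2 (fun a b => le_rfl) hη₀ hc₀ q2 hδ hC hℓ hmom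
  have hs : MeasurableSet {ω | Z' ω = x} := hZ' (measurableSet_singleton x)
  have hZx : ∀ᵐ ω ∂P, Z ω ≠ x := by
    rw [ae_iff]; simpa using hq.measure_eq hZ x
  calc P {ω | Z' ω = x} = ∫⁻ ω, {ω | Z' ω = x}.indicator 1 ω ∂P := (lintegral_indicator_one hs).symm
    _ ≤ ∫⁻ ω, (‖m₁ (Z' ω) - m₁ (Z ω)‖ₑ + ‖m₂ (Z' ω) - m₂ (Z ω)‖ₑ) ∂P := by
      refine lintegral_mono_ae ?_
      filter_upwards [hZx] with ω hω
      by_cases h' : Z' ω = x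
      · rw [indicator_of_mem (show ω ∈ {ω | Z' ω = x} from h'), h']
        rcases lt_or_gt_of_ne hω with h | h
        · simp [hm₁, hm₂, indicator, h.not_ge]
        · simp [hm₁, hm₂, h, h.le]
      · rw [indicator_of_notMem (show ω ∉ {ω | Z' ω = x} from h')]; exact zero_le
    _ = ∫⁻ ω, ‖m₁ (Z' ω) - m₁ (Z ω)‖ₑ ∂P + ∫⁻ ω, ‖m₂ (Z' ω) - m₂ (Z ω)‖ₑ ∂P :=
      lintegral_add_left ((mono1.measurable.comp hZ').sub (mono1.measurable.comp hZ)).enorm _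
    _ ≤ _ := by
      refine (add_le_add L1 L2).trans (le_of_eq ?_)
      have : 0 ≤ ℓ ^ (lam / (1 + δ)) := Real.rpow_nonneg hℓ.le _
      rw [← ENNReal.ofReal_add (by positivity) (by positivity)]
      congr 1; ring

end Probability


/-! ### Path regularity, stopped processes and localization -/

/-- By Tonelli the mean of the absolute Marchaud integral is at most the integral of `min (C r^γ) D
* r^(-1-κ)`, finite for `0 < κ < γ`. Hölder continuity in mean thus yields a pathwise fractional
derivative although paths may jump. -/
lemma L1Holder.ae_marchaudIntegrable {Ω : Type*} [MeasurableSpace Ω] {Q : Measure Ω}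
    [IsFiniteMeasure Q] {u : ℝ → Ω → ℝ} {B C γ κ T : ℝ} (hu : L1Holder Q u B C γ) (h0 : 0 < κ)
    (hκ : κ < γ) : ∀ᵐ ω ∂Q, MarchaudIntegrable T κ (fun t => u t ω) := by
  by_cases hne : Nonempty Ω
  swap
  · rw [not_nonempty_iff] at hne
    simp [Measure.eq_zero_of_isEmpty Q]
  have hB : 0 ≤ B := (abs_nonneg _).trans (hu.bound 0 hne.some)
  set μ := (volume.restrict (Ioo 0 T)).prod (volume.restrict (Ioi (0 : ℝ))) with hμ
  set D := Q.real univ * (B + B) with hD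
  have hD0 : 0 ≤ D := by positivity
  set G : (ℝ × ℝ) → Ω → ℝ := fun z ω => (u z.1 ω - u (z.1 - z.2) ω) * z.2 ^ (-1 - κ) with hG
  have hum : Measurable fun z : ℝ × Ω => u z.1 z.2 := hu.measurable
  have hGm : Measurable (Function.uncurry G) := by
    refine Measurable.mul (Measurable.sub ?_ ?_) ?_
    · exact hum.comp ((measurable_fst.comp measurable_fst).prodMk measurable_snd)
    · exact hum.comp (((measurable_fst.comp measurable_fst).sub
        (measurable_snd.comp measurable_fst)).prodMk measurable_snd)
    · fun_prop
  have hdom : Integrable (fun z : ℝ × ℝ => (1 : ℝ) * (min (C * z.2 ^ γ) D * z.2 ^ (-1 - κ))) μ :=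
    (integrable_const (1 : ℝ)).mul_prod (integrableOn_min_rpow_mul h0 hκ hu.nonneg hD0)
  have hpos : ∀ᵐ z : ℝ × ℝ ∂μ, 0 < z.2 := by
    rw [hμ, Measure.prod_restrict]
    filter_upwards [ae_restrict_mem (measurableSet_Ioo.prod measurableSet_Ioi)] with z hz using hz.2
  have hfin : ∫⁻ ω, (∫⁻ z, ‖G z ω‖ₑ ∂μ) ∂Q ≠ ∞ := by
    rw [lintegral_lintegral_swap (f := fun ω z => ‖G z ω‖ₑ)
      ((hGm.comp measurable_swap).enorm.aemeasurable)]
    refine ne_top_of_le_ne_top hdom.lintegral_lt_top.ne (lintegral_mono_ae ?_)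
    filter_upwards [hpos] with z hz
    have hz' : 0 ≤ z.2 ^ (-1 - κ) := Real.rpow_nonneg hz.le _
    have h1 : L1Le Q (fun ω => u z.1 ω - u (z.1 - z.2) ω) (min (C * z.2 ^ γ) D) := by
      rcases min_choice (C * z.2 ^ γ) D with h | h
      · rw [h]; simpa [abs_of_pos hz] using hu.holder (z.1 - z.2) z.1
      · rw [h]
        exact L1Le.of_ae_le (Eventually.of_forall fun ω => (abs_sub _ _).trans
          (add_le_add (hu.bound _ _) (hu.bound _ _))) (by linarith)
    have h2 := h1.mul_of_le (G := fun _ => z.2 ^ (-1 - κ))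
      (Eventually.of_forall fun _ => (abs_of_nonneg hz').le) hz'
    rw [one_mul]
    exact h2
  have hm : Measurable fun ω => ∫⁻ z, ‖G z ω‖ₑ ∂μ := hGm.enorm.lintegral_prod_left'
  filter_upwards [ae_lt_top hm hfin] with ω hω
  exact ⟨(hGm.comp (measurable_id.prodMk measurable_const)).aestronglyMeasurable, hω⟩

lemma marchaudIntegrable_of_holder {T κ γ B C : ℝ} {v : ℝ → ℝ} (h0 : 0 < κ) (hκ : κ < γ)
    (hB : ∀ t, |v t| ≤ B) (hv : ∀ s t, |v t - v s| ≤ C * |t - s| ^ γ) :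
    MarchaudIntegrable T κ v := by
  have hC : 0 ≤ C := by
    have := (abs_nonneg _).trans (hv 0 1); simpa using this
  have hB0 : 0 ≤ B := (abs_nonneg _).trans (hB 0)
  refine marchaudIntegrable_of_modulus
    (continuous_of_abs_sub_le_rpow (h0.trans hκ) hv).measurable
    (integrableOn_min_rpow_mul h0 hκ hC (add_nonneg hB0 hB0)) fun t r hr => le_min ?_ ?_
  · simpa [abs_of_pos hr] using hv (t - r) t
  · exact (abs_sub _ _).trans (add_le_add (hB _) (hB _))

/-- Projection of the line onto `[0, T]`. -/
def clampTime (T t : ℝ) : ℝ := max 0 (min t T)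

lemma clampTime_mem {T : ℝ} (hT : 0 ≤ T) (t : ℝ) : clampTime T t ∈ Icc 0 T :=
  ⟨le_max_left _ _, max_le hT (min_le_right _ _)⟩

lemma clampTime_of_mem {T t : ℝ} (ht : t ∈ Icc 0 T) : clampTime T t = t := by
  rw [clampTime, min_eq_left ht.2, max_eq_right ht.1]

lemma clampTime_of_nonpos {T t : ℝ} (ht : t ≤ 0) : clampTime T t = 0 :=
  max_eq_left ((min_le_left _ _).trans ht)

lemma clampTime_of_le {T t : ℝ} (hT : 0 ≤ T) (ht : T ≤ t) : clampTime T t = T := by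
  rw [clampTime, min_eq_right ht, max_eq_right hT]

lemma abs_clampTime_sub_le (T s t : ℝ) : |clampTime T t - clampTime T s| ≤ |t - s| := by
  unfold clampTime
  refine (abs_max_sub_max_le_max _ _ _ _).trans (max_le (by simp) ?_)
  exact (abs_min_sub_min_le_max _ _ _ _).trans (by simp)

/-- A process on the line all of whose paths are `r`-Hölder and constant outside `[0, T]`. -/
structure ClampedHolderProcess {Ω : Type*} [MeasurableSpace Ω] (T r : ℝ) (x : ℝ → Ω → ℝ) : Prop where
  measurable : ∀ t, Measurable (x t)
  clamp : ∀ t ω, x t ω = x (clampTime T t) ω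
  holder : ∀ ω, ∃ C, ∀ s t, |x t ω - x s ω| ≤ C * |t - s| ^ r

namespace ClampedHolderProcess

variable {Ω : Type*} [MeasurableSpace Ω] {T r : ℝ} {x : ℝ → Ω → ℝ}

lemma continuous (hx : ClampedHolderProcess T r x) (hr : 0 < r) (ω : Ω) :
    Continuous fun t => x t ω := by
  obtain ⟨C, hC⟩ := hx.holder ω
  exact continuous_of_abs_sub_le_rpow hr hC

lemma measurable_uncurry (hx : ClampedHolderProcess T r x) (hr : 0 < r) :
    Measurable (Function.uncurry x) :=
  measurable_uncurry_of_continuous_of_measurable (hx.continuous hr) hx.measurable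

/-- The event that the path is Hölder with constant `M`. -/
def holderEvent (r : ℝ) (x : ℝ → Ω → ℝ) (M : ℝ) : Set Ω :=
  ⋂ (s : ℚ) (t : ℚ), {ω | |x t ω - x s ω| ≤ M * |(t : ℝ) - s| ^ r}

lemma measurableSet_holderEvent (hx : ClampedHolderProcess T r x) (M : ℝ) :
    MeasurableSet (holderEvent r x M) := by
  refine MeasurableSet.iInter fun s => MeasurableSet.iInter fun t => ?_
  exact measurableSet_le ((hx.measurable t).sub (hx.measurable s)).norm measurable_const

lemma le_of_mem_holderEvent (hx : ClampedHolderProcess T r x) (hr : 0 < r) {M : ℝ} {ω : Ω}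
    (hω : ω ∈ holderEvent r x M) (s t : ℝ) : |x t ω - x s ω| ≤ M * |t - s| ^ r := by
  have hc := hx.continuous hr ω
  have hcl : IsClosed {z : ℝ × ℝ | |x z.2 ω - x z.1 ω| ≤ M * |z.2 - z.1| ^ r} := by
    refine isClosed_le ?_ ?_
    · exact ((hc.comp continuous_snd).sub (hc.comp continuous_fst)).abs
    · exact continuous_const.mul
        ((continuous_snd.sub continuous_fst).abs.rpow_const fun _ => Or.inr hr.le)
  refine isClosed_property2 (p := fun s t : ℝ => |x t ω - x s ω| ≤ M * |t - s| ^ r)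
    Rat.denseRange_cast hcl (fun a b => ?_) s t
  simp only [holderEvent, mem_iInter] at hω
  exact hω a b

lemma exists_mem_holderEvent (hx : ClampedHolderProcess T r x) (ω : Ω) :
    ∃ M₀ : ℝ, ∀ M ≥ M₀, ω ∈ holderEvent r x M := by
  obtain ⟨C, hC⟩ := hx.holder ω
  refine ⟨C, fun M hM => ?_⟩
  simp only [holderEvent, mem_iInter]
  intro s t
  exact (hC s t).trans (by gcongr)

lemma abs_le (hx : ClampedHolderProcess T r x) (hr : 0 < r) (hT : 0 ≤ T) {M : ℝ} {ω : Ω}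
    (hM : 0 ≤ M) (hω : ω ∈ holderEvent r x M) (h0 : |x 0 ω| ≤ M) (t : ℝ) :
    |x t ω| ≤ M + M * T ^ r := by
  have h1 := hx.le_of_mem_holderEvent hr hω 0 (clampTime T t)
  rw [hx.clamp t]
  have hm := clampTime_mem hT t
  have h2 : |clampTime T t - 0| ^ r ≤ T ^ r := by
    rw [sub_zero, abs_of_nonneg hm.1]
    exact Real.rpow_le_rpow hm.1 hm.2 hr.le
  have h3 : |x (clampTime T t) ω| ≤ |x (clampTime T t) ω - x 0 ω| + |x 0 ω| := by
    have := abs_add_le (x (clampTime T t) ω - x 0 ω) (x 0 ω)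
    rwa [sub_add_cancel] at this
  have h4 : M * |clampTime T t - 0| ^ r ≤ M * T ^ r := by gcongr
  linarith

end ClampedHolderProcess

lemma HasZSIntegral.congr {T : ℝ} {f f' g g' : ℝ → ℝ} {I : ℝ} (hT : 0 < T)
    (h : HasZSIntegral 0 T f g I)
    (hf : EqOn f' f (Icc 0 T)) (hg : EqOn g' g (Icc 0 T)) : HasZSIntegral 0 T f' g' I := by
  obtain ⟨fa, ga, gb, h1, h2, h3, κ, hκ0, hκ1, p, q, hp, hq, hpq, φ, ψ, hφ, hψ, hI⟩ := h
  have e0 : ∀ᶠ t in 𝓝[>] (0 : ℝ), t ∈ Icc 0 T := by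
    filter_upwards [Ioo_mem_nhdsGT hT] with t ht using Ioo_subset_Icc_self ht
  have eT : ∀ᶠ t in 𝓝[<] T, t ∈ Icc 0 T := by
    filter_upwards [Ioo_mem_nhdsLT hT] with t ht using Ioo_subset_Icc_self ht
  refine ⟨fa, ga, gb, h1.congr' (e0.mono fun t ht => (hf ht).symm),
    h2.congr' (e0.mono fun t ht => (hg ht).symm), h3.congr' (eT.mono fun t ht => (hg ht).symm),
    κ, hκ0, hκ1, p, q, hp, hq, hpq, φ, ψ, ⟨hφ.1, ?_⟩, ⟨hψ.1, ?_⟩, hI⟩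
  · filter_upwards [hφ.2, ae_restrict_mem measurableSet_Ioo] with t ht hm
    rw [hf (Ioo_subset_Icc_self hm)]; exact ht
  · filter_upwards [hψ.2, ae_restrict_mem measurableSet_Ioo] with t ht hm
    rw [hg (Ioo_subset_Icc_self hm)]; exact ht

lemma summable_mesh_rpow {T a b : ℝ} (hT : 0 < T) {π : ℕ → TaggedPartition T} (hab : a ≤ b)
    (h : Summable fun n => (π n).mesh ^ a) :
    Tendsto (fun n => (π n).mesh) atTop (𝓝 0) ∧ Summable fun n => (π n).mesh ^ b := by
  have hpos := fun n => (π n).mesh_pos hT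
  have hle := fun n => (π n).mesh_le hT
  have h0 := h.tendsto_atTop_zero
  -- Positivity of `a` is forced: meshes are at most `T`, so for `a ≤ 0` the terms stay above `T ^
  -- a` and cannot be summable.
  have ha : 0 < a := by
    by_contra hneg
    have h1 : ∀ n, T ^ a ≤ (π n).mesh ^ a := fun n =>
      Real.rpow_le_rpow_of_nonpos (hpos n) (hle n) (not_lt.1 hneg)
    have := ge_of_tendsto' h0 h1
    exact absurd (Real.rpow_pos_of_pos hT a) this.not_gt
  constructor
  · have := h0.rpow_const (p := a⁻¹) (Or.inr (inv_pos.2 ha).le)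
    rw [Real.zero_rpow (inv_pos.2 ha).ne'] at this
    refine this.congr fun n => ?_
    rw [← Real.rpow_mul (hpos n).le, mul_inv_cancel₀ ha.ne', Real.rpow_one]
  · refine Summable.of_nonneg_of_le (fun n => Real.rpow_nonneg (hpos n).le _) (fun n => ?_)
      (h.mul_right (T ^ (b - a)))
    calc (π n).mesh ^ b = (π n).mesh ^ a * (π n).mesh ^ (b - a) := by
          rw [← Real.rpow_add (hpos n)]; congr 1; ring
      _ ≤ _ := by
        have := Real.rpow_le_rpow (hpos n).le (hle n) (by linarith : 0 ≤ b - a)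
        have := Real.rpow_nonneg (hpos n).le a
        gcongr

lemma exists_strictMono_summable_mesh_rpow {T a : ℝ} (ha : 0 < a) {π : ℕ → TaggedPartition T}
    (h : Tendsto (fun n => (π n).mesh) atTop (𝓝 0)) :
    ∃ φ : ℕ → ℕ, StrictMono φ ∧ Summable fun n => (π (φ n)).mesh ^ a := by
  have h1 : Tendsto (fun n => (π n).mesh ^ a) atTop (𝓝 0) := by
    have := h.rpow_const (p := a) (Or.inr ha.le)
    rwa [Real.zero_rpow ha.ne'] at this
  have h2 : ∀ n : ℕ, ∀ᶠ k in atTop, (π k).mesh ^ a < (1 / 2 : ℝ) ^ n := fun n =>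
    h1.eventually (gt_mem_nhds (by positivity))
  obtain ⟨φ, hφ, hφ2⟩ := extraction_forall_of_eventually h2
  exact ⟨φ, hφ, Summable.of_nonneg_of_le (fun n => Real.rpow_nonneg (π _).mesh_nonneg _)
    (fun n => (hφ2 n).le) summable_geometric_two⟩


lemma measurable_of_locallyBoundedVariationOn {f : ℝ → ℝ} (hf : LocallyBoundedVariationOn f univ) :
    Measurable f := by
  obtain ⟨p, q, hp, hq, rfl⟩ := hf.exists_monotoneOn_sub_monotoneOn
  rw [monotoneOn_univ] at hp hq
  exact hp.measurable.sub hq.measurable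

lemma countable_not_continuousAt_of_locallyBoundedVariationOn {f : ℝ → ℝ}
    (hf : LocallyBoundedVariationOn f univ) : {x | ¬ContinuousAt f x}.Countable := by
  obtain ⟨p, q, hp, hq, rfl⟩ := hf.exists_monotoneOn_sub_monotoneOn
  rw [monotoneOn_univ] at hp hq
  refine (hp.countable_not_continuousAt.union hq.countable_not_continuousAt).mono fun x hx => ?_
  by_contra h
  simp only [mem_union, mem_ofPred_eq, not_or, not_not] at h
  exact hx (h.1.sub h.2)

lemma L1Holder.restrict {Ω : Type*} [MeasurableSpace Ω] {Q : Measure Ω} {u : ℝ → Ω → ℝ}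
    {B C γ : ℝ} (hu : L1Holder Q u B C γ) (S : Set Ω) : L1Holder (Q.restrict S) u B C γ :=
  { hu with
    holder := fun s t => (lintegral_mono' Measure.restrict_le_self le_rfl).trans (hu.holder s t) }

lemma ae_of_forall_ae_restrict {Ω : Type*} [MeasurableSpace Ω] {P : Measure Ω} {S : ℕ → Set Ω}
    (hS : ∀ M, MeasurableSet (S M)) (hcov : ∀ ω, ∃ M, ω ∈ S M) {p : Ω → Prop}
    (h : ∀ M, ∀ᵐ ω ∂(P.restrict (S M)), p ω) : ∀ᵐ ω ∂P, p ω := by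
  have h1 : ∀ᵐ ω ∂P, ∀ M, ω ∈ S M → p ω :=
    ae_all_iff.2 fun M => (ae_restrict_iff' (hS M)).1 (h M)
  filter_upwards [h1] with ω hω
  obtain ⟨M, hM⟩ := hcov ω
  exact hω M hM

lemma rsAverage_add {u v g : ℝ → ℝ} {B B' h s t : ℝ} (hu : Measurable u) (hv : Measurable v)
    (hB : ∀ t, |u t| ≤ B) (hB' : ∀ t, |v t| ≤ B') (hg : Continuous g) :
    rsAverage (fun r => u r + v r) g h s t = rsAverage u g h s t + rsAverage v g h s t := by
  have hsl : Continuous fun r => (g (r + h) - g r) / h := by fun_prop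
  have hui : IntervalIntegrable u volume s t := by
    rw [intervalIntegrable_iff]
    exact Measure.integrableOn_of_bounded (M := B) (by simp) hu.aestronglyMeasurable
      (Eventually.of_forall hB)
  have hvi : IntervalIntegrable v volume s t := by
    rw [intervalIntegrable_iff]
    exact Measure.integrableOn_of_bounded (M := B') (by simp) hv.aestronglyMeasurable
      (Eventually.of_forall hB')
  rw [rsAverage, rsAverage, rsAverage, ← intervalIntegral.integral_add
    (hui.mul_continuousOn hsl.continuousOn) (hvi.mul_continuousOn hsl.continuousOn)]
  congr 1; ext r; ring

lemma TaggedPartition.rsSum_add {T : ℝ} (π : TaggedPartition T) (u v g : ℝ → ℝ) :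
    π.rsSum (fun r => u r + v r) g = π.rsSum u g + π.rsSum v g := by
  simp only [TaggedPartition.rsSum, ← Finset.sum_add_distrib]
  exact Finset.sum_congr rfl fun i _ => by ring

/-! ### The integral for processes with regular paths -/

section Core

variable {Ω : Type*} [MeasurableSpace Ω] {P : Measure Ω} [IsProbabilityMeasure P] {T : ℝ}
  {x y : ℝ → Ω → ℝ} {α β : ℝ} {p : ℝ → ℝ → ℝ} {δ lam C : ℝ} {f : ℝ → ℝ} {c c₀ η₀ K : ℝ}

/-- The part of a function of locally bounded variation acting where the densities are bounded
yields a process that is Hölder continuous in mean. -/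
lemma exists_l1Holder_outerPart (hT : 0 < T) (hα : 0 < α) (hx : ClampedHolderProcess T α x)
    (hp : ∀ t ∈ Ioo 0 T, IsDensityOf P (x t) (p t)) (hδ : 0 < δ) (hlam : 0 < lam) (hC : 0 ≤ C)
    (hmom : ∀ s t, 0 ≤ s → s < t → t ≤ T →
      ∫⁻ ω, ENNReal.ofReal (|x t ω - x s ω| ^ δ) ∂P ≤ ENNReal.ofReal (C * (t - s) ^ lam))
    (hf : LocallyBoundedVariationOn f univ) (hc : 0 ≤ c) (hc₀ : 0 ≤ c₀) (hη₀ : 0 < η₀)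
    (hpc : ∀ t ∈ Ioo 0 T, ∀ z, c - η₀ ≤ |z| → p t z ≤ c₀) {R : ℝ} (hR : 0 ≤ R) :
    ∃ B D, L1Holder P (fun t ω => outerPart f c R (x t ω)) B D (lam / (1 + δ)) := by
  obtain ⟨m, hm, ⟨V, hV0, hV⟩, hhm, hconst⟩ := exists_monotone_majorant_outerPart hf hc hR
  set h := outerPart f c R with hh
  set γ := lam / (1 + δ) with hγ
  have hγ0 : 0 < γ := by positivity
  set D₀ := c₀ * (2 * V) + V * C + V / η₀ with hD₀
  -- The extra `V / T ^ γ` serves the pair `s = 0`, `t = T`, where neither endpoint has an assumed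
  -- density: there the increment is bounded trivially by `V`.
  set D := D₀ + V / T ^ γ with hD
  have hTγ : 0 < T ^ γ := Real.rpow_pos_of_pos hT _
  have hD₀0 : 0 ≤ D₀ := by positivity
  have hVT : 0 ≤ V / T ^ γ := by positivity
  have habs : ∀ a b, |h a - h b| ≤ V := fun a b =>
    (hhm a b).trans (abs_le.2 ⟨by linarith [hV b a], hV a b⟩)
  have hfm := measurable_of_locallyBoundedVariationOn hf
  have hhmeas : Measurable h := by
    have h1 : Measurable (clampAbs R) := (monotone_clampAbs R).measurable
    have h2 : Measurable (clampAbs c) := (monotone_clampAbs c).measurable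
    exact (hfm.comp h1).sub (hfm.comp (h2.comp h1))
  -- If `|z| < c - η₀`, the window `[z - η, z + η]` lies in `[-c, c]`, where `m` is constant.
  have hq : ∀ t ∈ Ioo 0 T, ∀ η ≤ η₀, ∀ z, m (z - η) < m (z + η) → p t z ≤ c₀ := by
    intro t ht η hη z hz
    refine hpc t ht z ?_
    by_contra hlt
    have hz' := abs_lt.1 (not_le.1 hlt)
    by_cases hη0 : 0 ≤ η
    · have := hconst (z - η) ⟨by linarith, by linarith⟩ (z + η) ⟨by linarith, by linarith⟩
      exact hz.ne this
    · exact hz.not_ge (hm (by linarith))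
  have key : ∀ s t, 0 ≤ s → s < t → t ≤ T →
      L1Le P (fun ω => h (x t ω) - h (x s ω)) (D * (t - s) ^ γ) := by
    intro s t hs hst ht
    have hℓ : 0 < t - s := sub_pos.2 hst
    have hle : D₀ * (t - s) ^ γ ≤ D * (t - s) ^ γ := by
      gcongr; linarith
    by_cases hs0 : 0 < s
    · exact (L1Le_increment (hx.measurable s) (hx.measurable t) (hp s ⟨hs0, by linarith⟩) hm hV0 hV hhm
        hη₀ hc₀ (hq s ⟨hs0, by linarith⟩) hδ hC hℓ (hmom s t hs hst ht)).mono hle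
    -- At `s = 0` the roles are exchanged and the density at the later time is used.
    · by_cases htT : t < T
      · have htm : t ∈ Ioo 0 T := ⟨by linarith, htT⟩
        have := L1Le_increment (hx.measurable t) (hx.measurable s) (hp t htm) hm hV0 hV hhm
          hη₀ hc₀ (hq t htm) hδ hC hℓ (by
            simp_rw [abs_sub_comm (x s _)]; exact hmom s t hs hst ht)
        refine (this.neg.congr (Eventually.of_forall fun ω => ?_)).mono hle
        ring
      · have e1 : t - s = T := by linarith
        have := L1Le.of_ae_le (Q := P) (F := fun ω => h (x t ω) - h (x s ω))
          (Eventually.of_forall fun ω => habs _ _) hV0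
        refine this.mono ?_
        rw [probReal_univ, one_mul, e1, hD, add_mul, div_mul_cancel₀ _ hTγ.ne']
        have : 0 ≤ D₀ * T ^ γ := by positivity
        linarith
  refine ⟨V + |h 0|, D, ?_, fun t ω => ?_, by positivity, fun s t => ?_⟩
  · exact hhmeas.comp (hx.measurable_uncurry hα)
  · have := abs_add_le (h (x t ω) - h 0) (h 0)
    rw [sub_add_cancel] at this
    exact this.trans (by gcongr; exact habs _ _)
  · have hs' := clampTime_mem hT.le s
    have ht' := clampTime_mem hT.le t
    have hle : D * |clampTime T t - clampTime T s| ^ γ ≤ D * |t - s| ^ γ := by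
      have := abs_clampTime_sub_le T s t
      gcongr
    have e : (fun ω => h (x t ω) - h (x s ω)) =
        fun ω => h (x (clampTime T t) ω) - h (x (clampTime T s) ω) := by
      ext ω; rw [hx.clamp t, hx.clamp s]
    refine L1Le.mono ?_ hle
    rw [e]
    rcases lt_trichotomy (clampTime T s) (clampTime T t) with hlt | heq | hlt
    · rw [abs_of_pos (sub_pos.2 hlt)]
      exact key _ _ hs'.1 hlt ht'.2
    · rw [heq]; simp [L1Le]
    · rw [abs_sub_comm, abs_of_pos (sub_pos.2 hlt)]
      refine (key _ _ ht'.1 hlt hs'.2).neg.congr (Eventually.of_forall fun ω => ?_)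
      ring

/-- `f` has countably many discontinuities, all with `|z| ≥ c`. Although `x 0` need not have a
density, it has no atom at such a point: it is close to `x t`, whose density is bounded near `z`,
and `t ↓ 0` in `measure_eq_le`. This supplies the limit at zero required by the Zähle-Stieltjes
integral. -/
lemma ae_continuousAt_start (hT : 0 < T) (hx : ClampedHolderProcess T α x)
    (hp : ∀ t ∈ Ioo 0 T, IsDensityOf P (x t) (p t)) (hδ : 0 < δ) (hlam : 0 < lam) (hC : 0 ≤ C)
    (hmom : ∀ s t, 0 ≤ s → s < t → t ≤ T →
      ∫⁻ ω, ENNReal.ofReal (|x t ω - x s ω| ^ δ) ∂P ≤ ENNReal.ofReal (C * (t - s) ^ lam))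
    (hf : LocallyBoundedVariationOn f univ) (hc₀ : 0 ≤ c₀) (hη₀ : 0 < η₀)
    (hpc : ∀ t ∈ Ioo 0 T, ∀ z, c - η₀ ≤ |z| → p t z ≤ c₀)
    (hfc : ∀ z, |z| < c → ContinuousAt f z) : ∀ᵐ ω ∂P, ContinuousAt f (x 0 ω) := by
  have hγ0 : 0 < lam / (1 + δ) := by positivity
  have hatom : ∀ z, c ≤ |z| → P {ω | x 0 ω = z} = 0 := by
    intro z hz
    have hle : ∀ t ∈ Ioo 0 T, P {ω | x 0 ω = z} ≤
        ENNReal.ofReal (2 * (c₀ * 2 + C + 1 / η₀) * t ^ (lam / (1 + δ))) := by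
      intro t ht
      refine measure_eq_le (hx.measurable t) (hx.measurable 0) (hp t ht) hη₀ hc₀ (fun w hw => ?_) hδ hC
        ht.1 ?_
      · refine hpc t ht w ?_
        have := abs_sub_abs_le_abs_sub z w
        rw [abs_sub_comm] at this
        linarith
      · simp_rw [abs_sub_comm (x 0 _)]
        simpa using hmom 0 t le_rfl ht.1 ht.2.le
    have hlim : Tendsto (fun t : ℝ => ENNReal.ofReal
        (2 * (c₀ * 2 + C + 1 / η₀) * t ^ (lam / (1 + δ)))) (𝓝[>] 0) (𝓝 0) := by
      have h1 : Continuous fun t : ℝ => 2 * (c₀ * 2 + C + 1 / η₀) * t ^ (lam / (1 + δ)) :=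
        continuous_const.mul (continuous_id.rpow_const fun _ => Or.inr hγ0.le)
      have h2 := (ENNReal.continuous_ofReal.comp h1).tendsto 0
      simp only [Function.comp, Real.zero_rpow hγ0.ne', mul_zero, ENNReal.ofReal_zero] at h2
      exact h2.mono_left nhdsWithin_le_nhds
    refine le_antisymm (ge_of_tendsto hlim ?_) zero_le
    filter_upwards [Ioo_mem_nhdsGT hT] with t ht using hle t ht
  have hcount : {z | ¬ContinuousAt f z}.Countable :=
    countable_not_continuousAt_of_locallyBoundedVariationOn hf
  rw [ae_iff]
  have hsub : {ω | ¬ContinuousAt f (x 0 ω)} ⊆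
      ⋃ z ∈ {z | ¬ContinuousAt f z}, {ω | x 0 ω = z} := fun ω hω =>
    mem_biUnion (show x 0 ω ∈ {z | ¬ContinuousAt f z} from hω) rfl
  refine measure_mono_null hsub ((measure_biUnion_null_iff hcount).2 fun z hz => hatom z ?_)
  by_contra hlt
  exact hz (hfc z (not_le.1 hlt))

/-- On the event `S M` the path stays in a fixed interval, so `f(x_t)` is a Lipschitz function of a
Hölder path plus a process that is Hölder in mean. The first part converges pathwise by `1 < α + β`,
the second almost surely by summing the `L¹` rates. -/
theorem exists_integral_of_clamped (hT : 0 < T) (hα : 0 < α) (hβ : 0 < β) (hαβ : 1 < α + β)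
    (hx : ClampedHolderProcess T α x) (hy : ClampedHolderProcess T β y)
    (hp : ∀ t ∈ Ioo 0 T, IsDensityOf P (x t) (p t)) (hδ : 0 < δ) (hlam : 0 < lam)
    (hθ : 1 < lam / (1 + δ) + β) (hC : 0 ≤ C)
    (hmom : ∀ s t, 0 ≤ s → s < t → t ≤ T →
      ∫⁻ ω, ENNReal.ofReal (|x t ω - x s ω| ^ δ) ∂P ≤ ENNReal.ofReal (C * (t - s) ^ lam))
    (hf : LocallyBoundedVariationOn f univ) (hc : 0 ≤ c) (hc₀ : 0 ≤ c₀) (hη₀ : 0 < η₀)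
    (hpc : ∀ t ∈ Ioo 0 T, ∀ z, c - η₀ ≤ |z| → p t z ≤ c₀)
    (hfc : ∀ z, |z| < c → ContinuousAt f z) (hK : 0 ≤ K)
    (hLip : ∀ a ∈ Icc (-c) c, ∀ b ∈ Icc (-c) c, |f a - f b| ≤ K * |a - b|) :
    ∃ J : Ω → ℝ, Measurable J ∧
      (∀ᵐ ω ∂P, HasZSIntegral 0 T (fun t => f (x t ω)) (fun t => y t ω) (J ω)) ∧
      ∀ π : ℕ → TaggedPartition T, Tendsto (fun n => (π n).mesh) atTop (𝓝 0) →
        Summable (fun n => (π n).mesh ^ (lam / (1 + δ) + β - 1)) →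
        ∀ᵐ ω ∂P, Tendsto (fun n => (π n).rsSum (fun t => f (x t ω)) (fun t => y t ω))
          atTop (𝓝 (J ω)) := by
  set γ := lam / (1 + δ) with hγ
  have hγ0 : 0 < γ := by positivity
  have hfm := measurable_of_locallyBoundedVariationOn hf
  have hxu := hx.measurable_uncurry hα
  have hyu := hy.measurable_uncurry hβ
  have hu : Measurable (Function.uncurry fun t ω => f (x t ω)) := hfm.comp hxu
  -- the Lipschitz part
  set uL : ℝ → Ω → ℝ := fun t ω => f (clampAbs c (x t ω)) with huL
  have huLm : Measurable (Function.uncurry uL) :=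
    hfm.comp ((monotone_clampAbs c).measurable.comp hxu)
  have huLB : ∀ t ω, |uL t ω| ≤ |f 0| + K * c := by
    intro t ω
    have hm := clampAbs_mem hc (x t ω)
    have h1 := hLip _ hm 0 ⟨by linarith, hc⟩
    have h2 := abs_add_le (f (clampAbs c (x t ω)) - f 0) (f 0)
    rw [sub_add_cancel] at h2
    have h3 : K * |clampAbs c (x t ω) - 0| ≤ K * c := by
      gcongr; rw [sub_zero]; exact abs_le.2 hm
    linarith
  have huLH : ∀ ω, ∃ D, ∀ s t, |uL t ω - uL s ω| ≤ D * |t - s| ^ α := by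
    intro ω
    obtain ⟨D, hD⟩ := hx.holder ω
    refine ⟨K * D, fun s t => ?_⟩
    calc |uL t ω - uL s ω| ≤ K * |clampAbs c (x t ω) - clampAbs c (x s ω)| :=
          hLip _ (clampAbs_mem hc _) _ (clampAbs_mem hc _)
      _ ≤ K * |x t ω - x s ω| := mul_le_mul_of_nonneg_left (abs_clampAbs_sub_le _ _ _) hK
      _ ≤ K * (D * |t - s| ^ α) := by gcongr; exact hD s t
      _ = _ := by ring
  -- A single order `κ` must serve both parts: below `α` for the Lipschitz part, below `γ` for the
  -- outer part, and above `1 - β` for the integrator. The assumptions `1 < α + β` and `1 < γ + β`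
  -- leave room.
  obtain ⟨κ, hκl, hκr⟩ : ∃ κ, max (1 - β) 0 < κ ∧ κ < min γ (min α 1) := by
    refine exists_between (max_lt (lt_min ?_ (lt_min ?_ ?_)) (lt_min hγ0 (lt_min hα one_pos))) <;>
      linarith
  have hκ0 : 0 < κ := (le_max_right _ _).trans_lt hκl
  have hκβ : 1 - κ < β := by linarith [(le_max_left (1 - β) 0).trans_lt hκl]
  have hκγ : κ < γ := hκr.trans_le (min_le_left _ _)
  have hκα : κ < α := hκr.trans_le ((min_le_right _ _).trans (min_le_left _ _))
  have hκ1 : κ < 1 := hκr.trans_le ((min_le_right _ _).trans (min_le_right _ _))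
  have hxneg : ∀ t ≤ 0, ∀ ω, x t ω = x 0 ω := fun t ht ω => by
    rw [hx.clamp t, hx.clamp 0, clampTime_of_nonpos ht, clampTime_of_nonpos le_rfl]
  have hyneg : ∀ t ≤ 0, ∀ ω, y t ω = y 0 ω := fun t ht ω => by
    rw [hy.clamp t, hy.clamp 0, clampTime_of_nonpos ht, clampTime_of_nonpos le_rfl]
  have hyT : ∀ t, T ≤ t → ∀ ω, y t ω = y T ω := fun t ht ω => by
    rw [hy.clamp t, hy.clamp T, clampTime_of_le hT.le ht, clampTime_of_le hT.le le_rfl]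
  have huLMI : ∀ ω, MarchaudIntegrable T κ fun t => uL t ω := fun ω => by
    obtain ⟨D, hD⟩ := huLH ω
    exact marchaudIntegrable_of_holder hκ0 hκα (fun t => huLB t ω) hD
  have hJL : ∀ ω, ∃ I, Tendsto (fun h => rsAverage (fun t => uL t ω) (fun t => y t ω) h 0 T)
      (𝓝[>] 0) (𝓝 I) := by
    intro ω
    obtain ⟨D, hD⟩ := huLH ω
    obtain ⟨Ky, hKy⟩ := hy.holder ω
    obtain ⟨I, -, hI⟩ := exists_hasZSIntegral hT hκ0 hκ1 hκβ
      (huLm.comp (measurable_id.prodMk measurable_const)) (fun t => huLB t ω)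
      (fun t ht => by simp only [Function.comp, Function.uncurry, id, huL]; rw [hxneg t ht])
      (((continuous_of_abs_sub_le_rpow hα hD).tendsto 0).mono_left nhdsWithin_le_nhds)
      (huLMI ω) hKy (fun t ht => hyneg t ht ω) (fun t ht => hyT t ht ω)
    exact ⟨I, hI⟩
  choose JL hJL using hJL
  -- localization
  set S : ℕ → Set Ω := fun M => ClampedHolderProcess.holderEvent α x M ∩
    ClampedHolderProcess.holderEvent β y M ∩ {ω | |x 0 ω| ≤ M} with hS
  have hSm : ∀ M, MeasurableSet (S M) := fun M =>
    ((hx.measurableSet_holderEvent _).inter (hy.measurableSet_holderEvent _)).inter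
      (measurableSet_le (hx.measurable 0).norm measurable_const)
  have hcov : ∀ ω, ∃ M, ω ∈ S M := by
    intro ω
    obtain ⟨M₁, h1⟩ := hx.exists_mem_holderEvent ω
    obtain ⟨M₂, h2⟩ := hy.exists_mem_holderEvent ω
    obtain ⟨M, hM⟩ := exists_nat_ge (max M₁ (max M₂ |x 0 ω|))
    simp only [max_le_iff] at hM
    exact ⟨M, ⟨h1 M hM.1, h2 M hM.2.1⟩, hM.2.2⟩
  have hRM : ∀ M : ℕ, 0 ≤ (M : ℝ) + M * T ^ α := fun M => by positivity
  -- The truncation level `M + M T^α` bounds the path on `S M`, so there the truncation inside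
  -- `outerPart` has no effect. The mean Hölder bound itself holds under the full `P`.
  choose B D hBD using fun M : ℕ =>
    exists_l1Holder_outerPart hT hα hx hp hδ hlam hC hmom hf hc hc₀ hη₀ hpc (hRM M)
  set uh : ℕ → ℝ → Ω → ℝ := fun M t ω => outerPart f c (M + M * T ^ α) (x t ω) with huh
  have hsplit : ∀ M, ∀ ω ∈ S M, ∀ t, f (x t ω) = uL t ω + uh M t ω := by
    intro M ω hω t
    have := hx.abs_le hα hT.le M.cast_nonneg hω.1.1 hω.2 t
    simp only [huL, huh, outerPart]
    rw [clampAbs_of_mem (abs_le.1 this)]; ring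
  have hPH : ∀ M : ℕ, PathHolder (P.restrict (S M)) y M β := fun M =>
    { measurable := hyu
      nonneg := M.cast_nonneg
      holder := by
        filter_upwards [ae_restrict_mem (hSm M)] with ω hω
        exact hy.le_of_mem_holderEvent hβ hω.1.2 }
  have hzs : ∀ᵐ ω ∂P, ∃ I, HasZSIntegral 0 T (fun t => f (x t ω)) (fun t => y t ω) I ∧
      Tendsto (fun h => rsAverage (fun t => f (x t ω)) (fun t => y t ω) h 0 T) (𝓝[>] 0) (𝓝 I) := by
    refine ae_of_forall_ae_restrict hSm hcov fun M => ?_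
    have hcont := ae_continuousAt_start hT hx hp hδ hlam hC hmom hf hc₀ hη₀ hpc hfc
    filter_upwards [ae_restrict_mem (hSm M), ((hBD M).restrict (S M)).ae_marchaudIntegrable hκ0 hκγ,
      ae_restrict_of_ae hcont] with ω hω hMI hct
    obtain ⟨Ky, hKy⟩ := hy.holder ω
    refine exists_hasZSIntegral (B := |f 0| + K * c + B M) hT hκ0 hκ1 hκβ
      (hu.comp (measurable_id.prodMk measurable_const)) (fun t => ?_)
      (fun t ht => by rw [hxneg t ht]) ?_ ?_ hKy (fun t ht => hyneg t ht ω) (fun t ht => hyT t ht ω)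
    · rw [hsplit M ω hω t]
      exact (abs_add_le _ _).trans (add_le_add (huLB t ω) ((hBD M).bound t ω))
    · exact (hct.tendsto.comp ((hx.continuous hα ω).tendsto 0)).mono_left nhdsWithin_le_nhds
    · refine ((huLMI ω).add hMI).congr (Eventually.of_forall fun z => ?_)
      simp only [Pi.add_apply]
      rw [hsplit M ω hω, hsplit M ω hω]
      ring
  have hstep : Tendsto (fun n : ℕ => 1 / ((n : ℝ) + 1)) atTop (𝓝[>] 0) :=
    tendsto_nhdsWithin_iff.2 ⟨tendsto_one_div_add_atTop_nhds_zero_nat,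
      Eventually.of_forall fun n => mem_Ioi.2 Nat.one_div_pos_of_nat⟩
  -- A measurable version of the integral, independent of `M`, is obtained as the limit of the
  -- averages along the steps `1/(n+1)`.
  obtain ⟨J, hJm, hJ⟩ := measurable_limit_of_tendsto_metrizable_ae (μ := P)
    (f := fun (n : ℕ) ω => rsAverage (fun t => f (x t ω)) (fun t => y t ω) (1 / ((n : ℝ) + 1)) 0 T)
    (L := atTop)
    (fun n => (measurable_rsAverage hu hyu _ _ _).aemeasurable) (by
      filter_upwards [hzs] with ω hω
      obtain ⟨I, -, hI⟩ := hω
      exact ⟨I, hI.comp hstep⟩)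
  have hJzs : ∀ᵐ ω ∂P, HasZSIntegral 0 T (fun t => f (x t ω)) (fun t => y t ω) (J ω) ∧
      Tendsto (fun h => rsAverage (fun t => f (x t ω)) (fun t => y t ω) h 0 T)
        (𝓝[>] 0) (𝓝 (J ω)) := by
    filter_upwards [hzs, hJ] with ω hω hJω
    obtain ⟨I, hI1, hI2⟩ := hω
    have : J ω = I := tendsto_nhds_unique hJω (hI2.comp hstep)
    rw [this]; exact ⟨hI1, hI2⟩
  refine ⟨J, hJm, hJzs.mono fun ω h => h.1, fun π hπ hsum => ?_⟩
  have hJLm : Measurable JL := measurable_of_tendsto_metrizable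
    (f := fun (n : ℕ) ω => rsAverage (fun t => uL t ω) (fun t => y t ω) (1 / ((n : ℝ) + 1)) 0 T)
    (fun n => measurable_rsAverage huLm hyu _ _ _)
    (tendsto_pi_nhds.2 fun ω => (hJL ω).comp hstep)
  refine ae_of_forall_ae_restrict hSm hcov fun M => ?_
  have hQ := (hBD M).restrict (S M)
  -- The limit for the outer part follows by subtraction, as the averages are linear in the
  -- integrand and the other two limits are known.
  have hlimh : ∀ᵐ ω ∂(P.restrict (S M)),
      Tendsto (fun h => rsAverage (fun t => uh M t ω) (fun t => y t ω) h 0 T) (𝓝[>] 0)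
        (𝓝 (J ω - JL ω)) := by
    filter_upwards [ae_restrict_mem (hSm M), ae_restrict_of_ae hJzs] with ω hω hJω
    refine (hJω.2.sub (hJL ω)).congr fun h => ?_
    have e : (fun t => f (x t ω)) = fun t => uL t ω + uh M t ω := funext fun t => hsplit M ω hω t
    rw [e, rsAverage_add (u := fun t => uL t ω) (v := fun t => uh M t ω) (huLm.comp (measurable_id.prodMk measurable_const))
      (hQ.measurable.comp (measurable_id.prodMk measurable_const)) (fun t => huLB t ω)
      (fun t => hQ.bound t ω) (hy.continuous hβ ω)]
    ring
  have hrate := fun n => hQ.rsSum_sub_le (hPH M) hγ0 hβ hθ hlimh (π n)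
  have hut : ∀ a, Measurable (uh M a) := fun a => (hBD M).measurable.comp measurable_prodMk_left
  have hzero := ae_tendsto_zero_of_summable_L1Le (fun n =>
    (((π n).measurable_rsSum (fun t _ => hut t) (fun t _ => hy.measurable t)).sub
      (hJm.sub hJLm)).aemeasurable) hrate (fun n => by
        have := youngConst_nonneg (hBD M).nonneg (hPH M).nonneg hβ hθ
        have := (π n).mesh_nonneg
        positivity) (hsum.mul_left _)
  filter_upwards [hzero, ae_restrict_mem (hSm M)] with ω hω hωS
  obtain ⟨D', hD'⟩ := huLH ω
  obtain ⟨Ky, hKy⟩ := hy.holder ω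
  have hL := tendsto_rsSum_of_holder (fun t => huLB t ω) hD' hKy hα hβ hαβ (hJL ω) π hπ
  have hsumlim := (hω.add hL).add_const (J ω - JL ω)
  rw [zero_add, add_sub_cancel] at hsumlim
  refine hsumlim.congr fun n => ?_
  have e : (fun t => f (x t ω)) = fun t => uL t ω + uh M t ω := funext fun t => hsplit M ω hωS t
  rw [e, TaggedPartition.rsSum_add]
  simp only [Pi.sub_apply]
  ring

end Core


/-! ### Reduction of the theorem to regular paths -/

lemma IsDensityOf.congr_ae {Ω : Type*} [MeasurableSpace Ω] {P : Measure Ω} {Z Z' : Ω → ℝ} {q : ℝ → ℝ}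
    (h : IsDensityOf P Z q) (hZ : Z' =ᵐ[P] Z) : IsDensityOf P Z' q :=
  ⟨h.1, h.2.1, by rw [Measure.map_congr hZ]; exact h.2.2⟩

/-- Extension of a process on `[0, T]` to the line by stopping, set to zero on an exceptional set. -/
def clampProcess {Ω : Type*} (T : ℝ) (N : Set Ω) (X : ℝ → Ω → ℝ) (t : ℝ) : Ω → ℝ :=
  Nᶜ.indicator (X (clampTime T t))

lemma clampProcess_of_mem {Ω : Type*} {T t : ℝ} {N : Set Ω} {X : ℝ → Ω → ℝ} {ω : Ω} (hω : ω ∉ N)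
    (ht : t ∈ Icc 0 T) : clampProcess T N X t ω = X t ω := by
  rw [clampProcess, indicator_of_mem hω, clampTime_of_mem ht]

lemma clampedHolderProcess_clampProcess {Ω : Type*} [MeasurableSpace Ω] {T : ℝ} (hT : 0 ≤ T)
    {N : Set Ω} (hN : MeasurableSet N) {X : ℝ → Ω → ℝ} (hX : ∀ t ∈ Icc 0 T, Measurable (X t))
    {r : ℝ≥0} (h : ∀ ω ∉ N, ∃ C : ℝ≥0, HolderOnWith C r (fun t => X t ω) (Icc 0 T)) :
    ClampedHolderProcess T r (clampProcess T N X) where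
  measurable t := (hX _ (clampTime_mem hT t)).indicator hN.compl
  clamp t ω := by
    simp only [clampProcess]
    rw [clampTime_of_mem (clampTime_mem hT t)]
  holder ω := by
    by_cases hω : ω ∈ N
    · refine ⟨0, fun s t => ?_⟩
      simp [clampProcess, hω]
    · obtain ⟨C, hC⟩ := h ω hω
      refine ⟨C, fun s t => ?_⟩
      simp only [clampProcess, indicator_of_mem (show ω ∈ Nᶜ from hω)]
      have h1 := hC.dist_le (clampTime_mem hT t) (clampTime_mem hT s)
      rw [Real.dist_eq, Real.dist_eq] at h1
      refine h1.trans ?_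
      have := abs_clampTime_sub_le T s t
      gcongr

theorem theorem3 {Ω : Type*} [MeasurableSpace Ω] (P : Measure Ω) [IsProbabilityMeasure P]
    (T : ℝ) (hT : 0 < T)
    (X Y : ℝ → Ω → ℝ)
    (hXm : ∀ t ∈ Set.Icc 0 T, Measurable (X t))
    (hYm : ∀ t ∈ Set.Icc 0 T, Measurable (Y t))
    (α β : ℝ≥0) (hα : 0 < α) (hβ : 0 < β) (hαβ : 1 < (α : ℝ) + β)
    (hX : HolderProcess P T α X) (hY : HolderProcess P T β Y)
    -- the densities of `X_t`, `0 < t < T`, and their integrable bound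
    (p : ℝ → ℝ → ℝ) (hp : ∀ t ∈ Set.Ioo 0 T, IsDensityOf P (X t) (p t))
    (phat : ℝ → ℝ) (hphat : IntegrableOn phat (Set.Ioo 0 T))
    (hbound : ∀ᵐ t ∂(volume.restrict (Set.Ioo 0 T)), ∀ y, p t y ≤ phat t)
    -- the moment bound for the increments of `X`
    (δ lam : ℝ) (hδ : 1 < δ) (hlam : 1 < lam) (hδlam : 1 < lam / (1 + δ) + β)
    (hmoment : ∃ C : ℝ, ∀ s t : ℝ, 0 ≤ s → s < t → t ≤ T →
      ∫⁻ ω, ENNReal.ofReal (|X t ω - X s ω| ^ δ) ∂P ≤ ENNReal.ofReal (C * (t - s) ^ lam))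
    (f : ℝ → ℝ) (hf : LocallyBoundedVariationOn f Set.univ)
    (hcase : ∃ c₀ : ℝ,
      ((∀ t ∈ Set.Ioo 0 T, ∀ x : ℝ, p t x ≤ c₀) ∧
        ∀ᵐ ω ∂P, ∃ l : ℝ, Tendsto (fun t => f (X t ω)) (𝓝[>] 0) (𝓝 l)) ∨
      (∃ ε : ℝ, 0 < ε ∧ (∀ t ∈ Set.Ioo 0 T, ∀ x : ℝ, ε / 2 ≤ |x| → p t x ≤ c₀) ∧
        ∃ K : ℝ≥0, LipschitzOnWith K f (Set.Ioo (-ε) ε))) :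
    ∃ J : Ω → ℝ, Measurable J ∧
      (∀ π : ℕ → TaggedPartition T, Tendsto (fun n => (π n).mesh) atTop (𝓝 0) →
        TendstoInMeasure P
          (fun n ω => (π n).rsSum (fun t => f (X t ω)) (fun t => Y t ω)) atTop J) ∧
      (∀ᵐ ω ∂P, HasZSIntegral 0 T (fun t => f (X t ω)) (fun t => Y t ω) (J ω)) ∧
      (∀ π : ℕ → TaggedPartition T, ∀ a : ℝ, a < lam / (1 + δ) + β - 1 →
        Summable (fun n => (π n).mesh ^ a) →
        ∀ᵐ ω ∂P, Tendsto (fun n => (π n).rsSum (fun t => f (X t ω)) (fun t => Y t ω))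
          atTop (𝓝 (J ω))) := by
  -- both cases amount to a bound of the densities outside an interval where `f` is Lipschitz
  obtain ⟨c, c₁, η₀, K, hc, hc₁, hη₀, hpc, hfc, hK, hLip⟩ : ∃ c c₁ η₀ K : ℝ, 0 ≤ c ∧ 0 ≤ c₁ ∧ 0 < η₀ ∧
      (∀ t ∈ Ioo 0 T, ∀ z, c - η₀ ≤ |z| → p t z ≤ c₁) ∧ (∀ z, |z| < c → ContinuousAt f z) ∧ 0 ≤ K ∧
      ∀ a ∈ Icc (-c) c, ∀ b ∈ Icc (-c) c, |f a - f b| ≤ K * |a - b| := by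
    obtain ⟨c₀, ⟨h1, -⟩ | ⟨ε, hε, h1, K, hK⟩⟩ := hcase
    -- With a global density bound the Lipschitz interval degenerates to the point `0`.
    · refine ⟨0, max c₀ 0, 1, 0, le_rfl, le_max_right _ _, one_pos,
        fun t ht z _ => (h1 t ht z).trans (le_max_left _ _),
        fun z hz => absurd hz (abs_nonneg z).not_gt, le_rfl, fun a ha b hb => ?_⟩
      simp only [neg_zero, Icc_self, mem_singleton_iff] at ha hb
      simp [ha, hb]
    · have hsub : ∀ a ∈ Icc (-(3 * ε / 4)) (3 * ε / 4), a ∈ Ioo (-ε) ε := fun a ha =>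
        ⟨by linarith [ha.1], by linarith [ha.2]⟩
      -- With `c = 3ε/4` and `η₀ = ε/4` one has `c - η₀ = ε/2`, exactly where the density bound
      -- starts, while `[-c, c]` stays inside the interval where `f` is Lipschitz.
      refine ⟨3 * ε / 4, max c₀ 0, ε / 4, K, by linarith, le_max_right _ _, by linarith,
        fun t ht z hz => (h1 t ht z (by linarith)).trans (le_max_left _ _), fun z hz => ?_, K.2,
        fun a ha b hb => ?_⟩
      · have hz' := abs_lt.1 hz
        exact hK.continuousOn.continuousAt (Ioo_mem_nhds (by linarith) (by linarith))
      · simpa [Real.dist_eq] using hK.dist_le_mul a (hsub a ha) b (hsub b hb)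
  obtain ⟨C, hC⟩ := hmoment
  -- modification of the processes off a null set
  set G : Set Ω := {ω | (∃ D : ℝ≥0, HolderOnWith D α (fun t => X t ω) (Icc 0 T)) ∧
    ∃ D : ℝ≥0, HolderOnWith D β (fun t => Y t ω) (Icc 0 T)} with hG
  have hG0 : P Gᶜ = 0 := by
    have : ∀ᵐ ω ∂P, ω ∈ G := by
      filter_upwards [hX, hY] with ω h1 h2 using ⟨h1, h2⟩
    exact this
  -- The set of regular paths need not be measurable, so a measurable null set containing its
  -- complement is removed.
  set N := toMeasurable P Gᶜ with hN
  have hNm : MeasurableSet N := measurableSet_toMeasurable _ _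
  have hN0 : ∀ᵐ ω ∂P, ω ∉ N := by
    rw [ae_iff]; simpa [hN, measure_toMeasurable] using hG0
  have hNG : ∀ ω ∉ N, ω ∈ G := fun ω hω => by
    by_contra h
    exact hω (subset_toMeasurable P Gᶜ h)
  set x := clampProcess T N X with hx
  set y := clampProcess T N Y with hy
  have hxX : ∀ ω ∉ N, ∀ t ∈ Icc 0 T, x t ω = X t ω := fun ω hω t ht => clampProcess_of_mem hω ht
  have hyY : ∀ ω ∉ N, ∀ t ∈ Icc 0 T, y t ω = Y t ω := fun ω hω t ht => clampProcess_of_mem hω ht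
  have hxae : ∀ t ∈ Icc 0 T, x t =ᵐ[P] X t := fun t ht => by
    filter_upwards [hN0] with ω hω using hxX ω hω t ht
  have hδ0 : 0 < δ := by linarith
  have hlam0 : 0 < lam := by linarith
  obtain ⟨J, hJm, hJzs, hJlim⟩ := exists_integral_of_clamped (P := P) (C := max C 0) hT
    (NNReal.coe_pos.2 hα) (NNReal.coe_pos.2 hβ) hαβ
    (clampedHolderProcess_clampProcess hT.le hNm hXm fun ω hω => (hNG ω hω).1)
    (clampedHolderProcess_clampProcess hT.le hNm hYm fun ω hω => (hNG ω hω).2)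
    (fun t ht => (hp t ht).congr_ae (hxae t (Ioo_subset_Icc_self ht))) hδ0 hlam0 hδlam
    (le_max_right _ _) (fun s t hs hst ht => by
      have e : ∫⁻ ω, ENNReal.ofReal (|x t ω - x s ω| ^ δ) ∂P =
          ∫⁻ ω, ENNReal.ofReal (|X t ω - X s ω| ^ δ) ∂P := by
        refine lintegral_congr_ae ?_
        filter_upwards [hN0] with ω hω
        rw [hxX ω hω t ⟨by linarith, ht⟩, hxX ω hω s ⟨hs, by linarith⟩]
      refine e.le.trans ((hC s t hs hst ht).trans (ENNReal.ofReal_le_ofReal ?_))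
      have := Real.rpow_nonneg (sub_pos.2 hst).le lam
      gcongr
      exact le_max_left _ _) hf hc hc₁ hη₀ hpc hfc hK hLip
  have hae : ∀ π : ℕ → TaggedPartition T, Tendsto (fun n => (π n).mesh) atTop (𝓝 0) →
      Summable (fun n => (π n).mesh ^ (lam / (1 + δ) + β - 1)) →
      ∀ᵐ ω ∂P, Tendsto (fun n => (π n).rsSum (fun t => f (X t ω)) (fun t => Y t ω))
        atTop (𝓝 (J ω)) := by
    intro π hπ hsum
    filter_upwards [hJlim π hπ hsum, hN0] with ω hω hωN
    refine hω.congr fun n => (π n).rsSum_congr (fun t ht => ?_) (fun t ht => hyY ω hωN t ht)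
    exact congrArg f (hxX ω hωN t ht)
  have hfm := measurable_of_locallyBoundedVariationOn hf
  refine ⟨J, hJm, fun π hπ => ?_, ?_, fun π a ha hsum => ?_⟩
  -- Convergence in probability holds if every subsequence has an almost surely convergent further
  -- subsequence; the latter is chosen so that the mesh powers are summable.
  · rw [exists_seq_tendstoInMeasure_atTop_iff fun n => ((π n).measurable_rsSum
      (u := fun t ω => f (X t ω)) (fun t ht => hfm.comp (hXm t ht)) hYm).aestronglyMeasurable]
    intro ns hns
    obtain ⟨φ, hφ, hφsum⟩ := exists_strictMono_summable_mesh_rpow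
      (a := lam / (1 + δ) + β - 1) (by linarith) (hπ.comp hns.tendsto_atTop)
    exact ⟨φ, hφ, hae (fun n => π (ns (φ n))) (hπ.comp (hns.tendsto_atTop.comp hφ.tendsto_atTop)) hφsum⟩
  · filter_upwards [hJzs, hN0] with ω hω hωN
    refine hω.congr hT (fun t ht => ?_) (fun t ht => (hyY ω hωN t ht).symm)
    exact congrArg f (hxX ω hωN t ht).symm
  -- Meshes are bounded by `T`, so summability for the exponent `a` passes to the larger exponent of
  -- the rate.
  · obtain ⟨h1, h2⟩ := summable_mesh_rpow hT ha.le hsum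
    exact hae π h1 h2

end
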